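/- \textbf{Setting.} Let $X=(X^x_t)_{t\ge0}$, $x\in[0,\infty)$, $X^x_0=x$, be a regular one-dimensional diffusion on $[0,\infty)$: a measurable family of continuous processes that is strong Markov with respect to the right-continuous filtration generated by the process, and such that every point of $(0,\infty)$ is reached with positive probability from every other point of $(0,\infty)$ (the behaviour at $0$ is arbitrary). Let $K>0$, $g(x)=(K-x)^+$, and let $\rho$ be a random discount rate with distribution $F_\rho$ on $[0,\infty)$, $\mathbb P(\rho>0)>0$. Let $\phi:(0,\infty)\to\mathbb R$ be an attitude function satisfying C-(iii) below, extended by $\phi(0):=\lim_{y\downarrow0}\phi(y)\in[-\infty,\infty)$. For a Borel set $R\subseteq[0,\infty)$ put $\tau(x,R)=\inf\{t>0:X^x_t\in R\}$, $$J(x,R)=\int_0^\infty\phi\Big(\mathbb E\big[e^{-r\tau(x,R)}g(X^x_{\tau(x,R)})\mathbf 1_{\{\tau(x,R)<\infty\}}\big]\Big)\,dF_\rho(r)\in[-\infty,\infty),\qquad V(x,R)=\phi(g(x))\vee J(x,R),$$ $S_R=\{x:\phi(g(x))>J(x,R)\}$, $I_R=\{x:\phi(g(x))=J(x,R)\}$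 and $\Theta(R)=S_R\cup(I_R\cap R)$. A Borel set $R$ is an \emph{equilibrium} if $\Theta(R)=R$; an equilibrium $R^*$ is \emph{optimal} if $V(x,R^*)\ge V(x,R)$ for every equilibrium $R$ and every $x\ge0$. For $a\le x$ let $\tau^x_a=\inf\{t>0:X^x_t=a\}$ and $H(r,a,x)=\ln\mathbb E[e^{-r\tau_a^x}\mathbf 1_{\{\tau_a^x<\infty\}}]$. \textbf{Conditions} (``increasing'' means nondecreasing). \begin{itemize} \item C-(i): every closed equilibrium $R\subseteq[0,K]$ is of the form $[0,a]$ with $0\le a\le K$. \item C-(ii): for $r\ge0$, $0<a\le K$ and $x>a$ the function $H(r,a,x)$ is differentiable in $x$ and in $a$; (a) the limit $\lim_{x\downarrow a}\partial_xH(r,a,x)$ exists and is increasing in $a\in(0,K]$ for fixed $r$; (b) $\partial_aH(r,a,x)$ is increasing in $r$ for fixed $a<x$. \item C-(iii): $\phi$ is $C^1$ and strictly increasing on $(0,\infty)$, and $x\mapsto x\phi'(x)$ is increasing. \end{itemize} \textbf{Theorem.} (1) Assume C-(i), C-(ii) and C-(iii). Then there is $a^*\in[0,K]$ such that, for $a\ge0$,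 $[0,a]$ is an equilibrium if and only if $a\ge a^*$. Moreover $[0,a^*]$ is the smallest equilibrium, in the sense that $[0,a^*]\subseteq\overline R$ for every equilibrium $R$, and it is an optimal equilibrium. (2) Let $X$ be a geometric Brownian motion $dX_t=\mu X_t\,dt+\sigma X_t\,dW_t$ with $\mu,\sigma>0$, let $f(r)=\sqrt{(\frac{\mu}{\sigma^2}-\frac12)^2+\frac{2r}{\sigma^2}}+\frac{\mu}{\sigma^2}-\frac12$ and assume $\int f\,dF_\rho<\infty$. Then, for every $\phi$ satisfying C-(iii), the conclusion of (1) holds with $$a^*=\frac{\int_0^\infty f(r)\,dF_\rho(r)}{1+\int_0^\infty f(r)\,dF_\rho(r)}\,K\in(0,K).$$ (3) Let $X$ be a Bessel process of index $\nu>-\frac12$ (dimension $n=2\nu+2$, the square root of a squared Bessel process) and assume $\int\sqrt{2r}\,dF_\rho(r)<\infty$. With $K_\nu$ the modified Bessel function of the second kind, the integral below is finite for $a\in(0,K)$, the equation $$-\int_0^\infty\frac{K_{\nu+1}(a\sqrt{2r})}{K_\nu(a\sqrt{2r})}\sqrt{2r}\,dF_\rho(r)+\frac1{K-a}=0$$ (at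 $r=0$ the integrand is its limit $2\max(\nu,0)/a$) has a unique solution $a^*\in(0,K)$, and for every $\phi$ satisfying C-(iii) the conclusion of (1) holds with this $a^*$. For $n=3$, that is $\nu=\frac12$, with $M=\int_0^\infty\sqrt{2r}\,dF_\rho(r)$, $$a^*=\frac{MK-2+\sqrt{4+M^2K^2}}{2M}\in(0,K).$$ In particular the thresholds in (2) and (3) do not depend on $\phi$ and coincide with those of the linear case $\phi(x)=x$. -/

import Mathlib

open Set Filter Topology MeasureTheory ProbabilityTheory
open scoped NNReal ENNReal

namespace DiverseStopping

/-- A regular one-dimensional diffusion on `[0, ∞)`: a family `X x` (`x ≥ 0`) of continuous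
processes with `X x 0 = x` on one probability space, with the strong Markov property with respect
to the right-continuous filtration generated by the process, such that every point of the interior
`(0, ∞)` is reached with positive probability from every other one.  The behaviour at the boundary
point `0` (entrance, natural, absorbing, reflecting, ...) is left free. -/
structure RegularDiffusion (Ω : Type*) [MeasurableSpace Ω] where
  /-- the probability measure -/
  P : Measure Ω
  isProbabilityMeasure : IsProbabilityMeasure P
  /-- `X x t ω` is the position at time `t` of the path `ω` of the process started at `x` -/
  X : ℝ≥0 → ℝ≥0 → Ω → ℝ≥0
  measurable_X : ∀ x t, Measurable (X x t)
  start : ∀ x ω, X x 0 ω = x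
  continuous_path : ∀ x ω, Continuous fun t => X x t ω
  measurable_law : ∀ B : Set (ℝ≥0 → ℝ≥0), MeasurableSet B →
    Measurable fun x => P {ω | (fun t => X x t ω) ∈ B}
  strongMarkov : ∀ (x : ℝ≥0) (τ : Ω → WithTop ℝ≥0)
    (hτ : IsStoppingTime
      (Filtration.natural (X x) fun t => (measurable_X x t).stronglyMeasurable).rightCont τ)
    (A : Set Ω), MeasurableSet[hτ.measurableSpace] A →
    ∀ B : Set (ℝ≥0 → ℝ≥0), MeasurableSet B →
      P (A ∩ {ω | τ ω ≠ ⊤} ∩ {ω | (fun t => X x ((τ ω).untopD 0 + t) ω) ∈ B}) =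
        ∫⁻ ω in A ∩ {ω | τ ω ≠ ⊤},
          P {ω' | (fun t => X (X x ((τ ω).untopD 0) ω) t ω') ∈ B} ∂P
  regular : ∀ x y : ℝ≥0, 0 < x → 0 < y → 0 < P {ω | ∃ t, X x t ω = y}

/-- The first hitting time `inf {t > 0 : w t ∈ R}` of the path `w`, with `inf ∅ = ∞`. -/
noncomputable def hitTime (w : ℝ≥0 → ℝ≥0) (R : Set ℝ≥0) : ℝ≥0∞ :=
  sInf ((fun t : ℝ≥0 => (t : ℝ≥0∞)) '' {t : ℝ≥0 | 0 < t ∧ w t ∈ R})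

/-- The put payoff `(K - x)⁺`. -/
noncomputable def put (K x : ℝ≥0) : ℝ := max ((K : ℝ) - (x : ℝ)) 0

open Classical in
/-- The payoff `g`, discounted at rate `r`, collected at the hitting time of `R` along the path `w`;
it is zero if `R` is never hit. -/
noncomputable def discountedPayoff (g : ℝ≥0 → ℝ) (r : ℝ≥0) (R : Set ℝ≥0) (w : ℝ≥0 → ℝ≥0) : ℝ :=
  if hitTime w R = ⊤ then 0
  else Real.exp (-(r : ℝ) * (hitTime w R).toReal) * g (w (hitTime w R).toNNReal)

open Classical in
/-- The attitude function `φ`, continuous and increasing on `(0, ∞)`, extended by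
`φ(0) = lim_{y ↓ 0} φ(y) = inf_{y > 0} φ(y) ∈ [-∞, ∞)`. -/
noncomputable def extendPhi (φ : ℝ → ℝ) (x : ℝ) : EReal :=
  if 0 < x then (φ x : EReal) else ⨅ y : Ioi (0 : ℝ), (φ y : EReal)

/-- The integral of an extended-real function, as the difference of the integrals of the positive
and the negative part. -/
noncomputable def erealIntegral (F : Measure ℝ≥0) (f : ℝ≥0 → EReal) : EReal :=
  ((∫⁻ r, (f r).toENNReal ∂F : ℝ≥0∞) : EReal) - ((∫⁻ r, (-f r).toENNReal ∂F : ℝ≥0∞) : EReal)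

variable {Ω : Type*} [MeasurableSpace Ω]

/-- `J(x, R)`, the aggregated payoff of stopping when the process started at `x` hits `R`. -/
noncomputable def J (D : RegularDiffusion Ω) (F : Measure ℝ≥0) (φ : ℝ → ℝ) (K : ℝ≥0)
    (x : ℝ≥0) (R : Set ℝ≥0) : EReal :=
  erealIntegral F fun r =>
    extendPhi φ (∫ ω, discountedPayoff (put K) r R (fun t => D.X x t ω) ∂D.P)

/-- The stopping region `S_R`. -/
def stoppingRegion (D : RegularDiffusion Ω) (F : Measure ℝ≥0) (φ : ℝ → ℝ) (K : ℝ≥0)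
    (R : Set ℝ≥0) : Set ℝ≥0 :=
  {x | J D F φ K x R < extendPhi φ (put K x)}

/-- The indifference region `I_R`. -/
def indifferenceRegion (D : RegularDiffusion Ω) (F : Measure ℝ≥0) (φ : ℝ → ℝ) (K : ℝ≥0)
    (R : Set ℝ≥0) : Set ℝ≥0 :=
  {x | extendPhi φ (put K x) = J D F φ K x R}

/-- The policy improvement operator `Θ(R) = S_R ∪ (I_R ∩ R)`. -/
def improve (D : RegularDiffusion Ω) (F : Measure ℝ≥0) (φ : ℝ → ℝ) (K : ℝ≥0)
    (R : Set ℝ≥0) : Set ℝ≥0 :=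
  stoppingRegion D F φ K R ∪ (indifferenceRegion D F φ K R ∩ R)

/-- A (mild, time-consistent) equilibrium: a Borel set `R ⊆ [0, ∞)` with `Θ(R) = R`. -/
def IsEquilibrium (D : RegularDiffusion Ω) (F : Measure ℝ≥0) (φ : ℝ → ℝ) (K : ℝ≥0)
    (R : Set ℝ≥0) : Prop :=
  MeasurableSet R ∧ improve D F φ K R = R

/-- `V(x, R) = φ(g(x)) ∨ J(x, R)`. -/
noncomputable def V (D : RegularDiffusion Ω) (F : Measure ℝ≥0) (φ : ℝ → ℝ) (K : ℝ≥0)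
    (x : ℝ≥0) (R : Set ℝ≥0) : EReal :=
  max (extendPhi φ (put K x)) (J D F φ K x R)

/-- An optimal equilibrium: its value dominates that of every equilibrium at every `x ≥ 0`. -/
def IsOptimalEquilibrium (D : RegularDiffusion Ω) (F : Measure ℝ≥0) (φ : ℝ → ℝ) (K : ℝ≥0)
    (R : Set ℝ≥0) : Prop :=
  IsEquilibrium D F φ K R ∧
    ∀ R', IsEquilibrium D F φ K R' → ∀ x, V D F φ K x R' ≤ V D F φ K x R

/-- `𝔼[e^{-r τ_a^x}]`, where `e^{-r τ} = 0` on `{τ = ∞}` (also for `r = 0`). -/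
noncomputable def hitLaplace (D : RegularDiffusion Ω) (r a x : ℝ≥0) : ℝ :=
  ∫ ω, discountedPayoff (fun _ => 1) r {a} (fun t => D.X x t ω) ∂D.P

/-- `H(r, a, x) = ln 𝔼[e^{-r τ_a^x}]` as a function of real `a, x ≥ 0`. -/
noncomputable def H (D : RegularDiffusion Ω) (r : ℝ≥0) (a x : ℝ) : ℝ :=
  Real.log (hitLaplace D r a.toNNReal x.toNNReal)

/-- Condition C-(i): the equilibria among the closed policies `R ⊆ [0, K]` are of the form
`[0, a]`. -/
def CondI (D : RegularDiffusion Ω) (F : Measure ℝ≥0) (φ : ℝ → ℝ) (K : ℝ≥0) : Prop :=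
  ∀ R : Set ℝ≥0, IsClosed R → R ⊆ Icc 0 K → IsEquilibrium D F φ K R →
    ∃ a ≤ K, R = Icc 0 a

/-- Condition C-(ii), with the existence of the derivatives and of the limit that it mentions. -/
structure CondII (D : RegularDiffusion Ω) (K : ℝ≥0) : Prop where
  differentiable_x : ∀ r : ℝ≥0, ∀ a ∈ Ioc (0 : ℝ) K, ∀ x > a,
    DifferentiableAt ℝ (fun y => H D r a y) x
  differentiable_a : ∀ r : ℝ≥0, ∀ a ∈ Ioc (0 : ℝ) K, ∀ x > a,
    DifferentiableAt ℝ (fun b => H D r b x) a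
  /-- part (a) -/
  monotone_a : ∀ r : ℝ≥0, ∃ m : ℝ → ℝ,
    (∀ a ∈ Ioc (0 : ℝ) K, Tendsto (fun x => deriv (fun y => H D r a y) x) (𝓝[>] a) (𝓝 (m a))) ∧
      MonotoneOn m (Ioc (0 : ℝ) K)
  /-- part (b) -/
  monotone_r : ∀ a ∈ Ioc (0 : ℝ) K, ∀ x > a,
    Monotone fun r : ℝ≥0 => deriv (fun b => H D r b x) a

/-- Condition C-(iii). -/
structure CondIII (φ : ℝ → ℝ) : Prop where
  contDiffOn : ContDiffOn ℝ 1 φ (Ioi 0)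
  strictMonoOn : StrictMonoOn φ (Ioi 0)
  monotoneOn : MonotoneOn (fun x => deriv φ x * x) (Ioi 0)

/-- `[0, a]` is an equilibrium iff `a ≥ a*`; `[0, a*]` is the smallest equilibrium (up to closure)
and it is the optimal one. -/
def IsOptimalThreshold (D : RegularDiffusion Ω) (F : Measure ℝ≥0) (φ : ℝ → ℝ) (K aStar : ℝ≥0) :
    Prop :=
  (∀ a : ℝ≥0, IsEquilibrium D F φ K (Icc 0 a) ↔ aStar ≤ a) ∧
    (∀ R, IsEquilibrium D F φ K R → Icc 0 aStar ⊆ closure R) ∧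
    IsOptimalEquilibrium D F φ K (Icc 0 aStar)

/-- For every starting point `x`, the process `Y x = h (X x)` is a weak solution of
`dY = β(Y) dt + √α(Y) dW`: it solves the martingale problem for the generator
`A f = (1/2) α f'' + β f'` on smooth compactly supported functions. -/
def SolvesMartingaleProblem (D : RegularDiffusion Ω) (h : ℝ → ℝ) (α β : ℝ → ℝ) : Prop :=
  ∀ (x : ℝ≥0) (f : ℝ → ℝ), ContDiff ℝ (⊤ : ℕ∞) f → HasCompactSupport f →
    Martingale
      (fun (t : ℝ≥0) ω => f (h (D.X x t ω)) -
        ∫ s in (0 : ℝ)..t,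
          (1 / 2 * α (h (D.X x s.toNNReal ω)) * deriv (deriv f) (h (D.X x s.toNNReal ω)) +
            β (h (D.X x s.toNNReal ω)) * deriv f (h (D.X x s.toNNReal ω))))
      (Filtration.natural (D.X x) fun t => (D.measurable_X x t).stronglyMeasurable) D.P

/-- Geometric Brownian motion `dX = μ X dt + σ X dW`. -/
def IsGeometricBrownianMotion (D : RegularDiffusion Ω) (μ σ : ℝ) : Prop :=
  SolvesMartingaleProblem D id (fun y => σ ^ 2 * y ^ 2) (fun y => μ * y)

/-- The Bessel process of index `ν` (dimension `n = 2ν + 2`): its square is the squared Bessel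
process `dZ = n dt + 2 √Z dW`. -/
def IsBesselProcess (D : RegularDiffusion Ω) (ν : ℝ) : Prop :=
  SolvesMartingaleProblem D (fun y => y ^ 2) (fun z => 4 * z) (fun _ => 2 * ν + 2)

/-- `f(r) = √((μ/σ² - 1/2)² + 2r/σ²) + μ/σ² - 1/2`. -/
noncomputable def gbmExponent (μ σ : ℝ) (r : ℝ≥0) : ℝ :=
  √((μ / σ ^ 2 - 1 / 2) ^ 2 + 2 * r / σ ^ 2) + μ / σ ^ 2 - 1 / 2

/-- The modified Bessel function of the second kind, for `z > 0`. -/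
noncomputable def besselK (ν z : ℝ) : ℝ :=
  ∫ t in Ioi (0 : ℝ), Real.exp (-z * Real.cosh t) * Real.cosh (ν * t)

open Classical in
/-- `√(2r) K_{ν+1}(a√(2r)) / K_ν(a√(2r))`, with its limit `2 ν⁺ / a` at `r = 0`. -/
noncomputable def besselRate (ν a : ℝ) (r : ℝ≥0) : ℝ :=
  if r = 0 then 2 * max ν 0 / a
  else √(2 * r) * besselK (ν + 1) (a * √(2 * r)) / besselK ν (a * √(2 * r))

end DiverseStopping

namespace DiverseStopping

/-! ### Integrals of extended-real functions bounded above -/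

/-! In the logarithmic coordinate `u ↦ φ (exp u)`, condition C-(iii) is convexity, and the slope is
positive because `φ` is strictly increasing (`CondIII.tangent_le`, `CondIII.slope_pos`). The payoff
of waiting for `[0, a]` from `x > a` is `(K - a) exp (logHit D r a x)`, and the strong Markov
property makes `logHit` additive along levels (`logHit_add`). Part (a) of C-(ii) then says that
`logHit` is convex in the starting point (`CondII.logConvex`).

For `a < K` the policy `[0, a]` is an equilibrium exactly when `-∫ logHit D r a x dF ≤ (x - a) / (K
- a)` for all `x` in `(a, K)`, with `a` accessible. This condition, `SmoothFit`, does not involve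
`φ`. It suffices by taking the tangent at `log (K - x)` and averaging, as in Jensen's inequality
(`SmoothFit.isEquilibrium`). It is necessary by letting the starting point decrease to `a`, where
convexity of `logHit` and Fatou's lemma turn the first-order inequality into an inequality for every
`x` (`smoothFit_of_isEquilibrium`). `SmoothFit` passes to larger levels and to limits from the
right, so it holds exactly from some threshold `a*` on.

For optimality, paths oscillate immediately around interior points, so `closure R ∩ [0, K]` pays at
least as much as `R` and is again an equilibrium; by C-(i) it is some `[0, a]` with `a ≥ a*`. To
compare `[0, a*]` with `[0, a]`, use the tangent at the log-payoff of `[0, a]`. The slope and the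
increment of the log-payoff are both decreasing in `r`, and the increment has nonnegative mean by
`SmoothFit`. Chebyshev's integral inequality gives a nonnegative gain
(`integral_mul_nonneg_of_antitone`, `J_Icc_le`).

In the examples, a discounted Dynkin formula expresses the Laplace transforms through bounded
solutions of `A U = r U` (`hitLaplace_mul_eq`). The decay rate of `logHit` decreases in the level,
while `1 / (K - a)` increases; the level where the integrated rate equals `1 / (K - a)` is the
threshold (`HasDecayRate.smoothFit_iff`). Condition C-(i) follows from a submartingale property:
inside a gap of `R` below a point of `R`, waiting without discounting pays at most `K - x`, and a
positive discount rate makes this strict. -/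

theorem erealIntegral_mono (F : Measure ℝ≥0) {f g : ℝ≥0 → EReal} (h : ∀ r, f r ≤ g r) :
    erealIntegral F f ≤ erealIntegral F g := by
  refine EReal.sub_le_sub ?_ ?_
  · exact EReal.coe_ennreal_le_coe_ennreal_iff.2
      (lintegral_mono fun r => EReal.toENNReal_le_toENNReal (h r))
  · exact EReal.coe_ennreal_le_coe_ennreal_iff.2
      (lintegral_mono fun r => EReal.toENNReal_le_toENNReal (EReal.neg_le_neg_iff.2 (h r)))

theorem erealIntegral_const (F : Measure ℝ≥0) [IsProbabilityMeasure F] (c : EReal) :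
    erealIntegral F (fun _ => c) = c := by
  simp only [erealIntegral, lintegral_const, measure_univ, mul_one]
  rcases le_total c 0 with h | h
  · rw [EReal.toENNReal_of_nonpos h, EReal.coe_toENNReal (by simpa using EReal.neg_le_neg_iff.2 h)]
    simp
  · rw [EReal.coe_toENNReal h,
      EReal.toENNReal_of_nonpos (by simpa using EReal.neg_le_neg_iff.2 h)]
    simp

theorem erealIntegral_coe (F : Measure ℝ≥0) {g : ℝ≥0 → ℝ} (hg : Integrable g F) :
    erealIntegral F (fun r => (g r : EReal)) = ((∫ r, g r ∂F : ℝ) : EReal) := by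
  have h1 : ∫⁻ r, ENNReal.ofReal (g r) ∂F ≠ ⊤ :=
    (lt_of_le_of_lt (lintegral_mono fun r => Real.ofReal_le_enorm (g r)) hg.2).ne
  have h2 : ∫⁻ r, ENNReal.ofReal (-g r) ∂F ≠ ⊤ :=
    (lt_of_le_of_lt (lintegral_mono fun r => Real.ofReal_le_enorm (-g r)) hg.neg.2).ne
  rw [integral_eq_lintegral_pos_part_sub_lintegral_neg_part hg]
  simp only [erealIntegral, ← EReal.coe_neg, EReal.real_coe_toENNReal]
  rw [EReal.coe_sub, ← EReal.coe_ennreal_toReal h1, ← EReal.coe_ennreal_toReal h2]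

/-- A subtraction-free form of `c - x = (c⁺ - c⁻) - (x⁺ - x⁻)`: it survives integration in `ℝ≥0∞`,
where no difference `∞ - ∞` can arise. -/
theorem toENNReal_sub_add (c : ℝ) {x : EReal} (hx : x ≤ c) :
    ((c : EReal) - x).toENNReal + (x.toENNReal + ENNReal.ofReal (-c)) =
      ENNReal.ofReal c + (-x).toENNReal := by
  induction x with
  | bot => simp
  | top => simp at hx
  | coe x =>
    have hxc : x ≤ c := by exact_mod_cast hx
    rw [← EReal.coe_sub, ← EReal.coe_neg]
    simp only [EReal.real_coe_toENNReal]
    rcases le_total 0 x with h0 | h0 <;> rcases le_total 0 c with h1 | h1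
    · rw [ENNReal.ofReal_of_nonpos (by linarith : -c ≤ 0),
        ENNReal.ofReal_of_nonpos (by linarith : -x ≤ 0), add_zero, add_zero,
        ← ENNReal.ofReal_add (by linarith) h0]
      congr 1; ring
    · have : x = 0 := by linarith
      have : c = 0 := by linarith
      simp [*]
    · rw [ENNReal.ofReal_of_nonpos (by linarith : -c ≤ 0),
        ENNReal.ofReal_of_nonpos (by linarith : x ≤ 0), add_zero, add_zero,
        ← ENNReal.ofReal_add h1 (by linarith)]
      congr 1
    · rw [ENNReal.ofReal_of_nonpos h0, ENNReal.ofReal_of_nonpos h1, zero_add, zero_add,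
        ← ENNReal.ofReal_add (by linarith) (by linarith)]
      congr 1; ring

/-- For integrands bounded above only the deficit `c - f` can have infinite integral. This turns
statements about `erealIntegral` into statements about a single `lintegral`, to which Fatou's lemma
applies. -/
theorem erealIntegral_eq_sub (F : Measure ℝ≥0) [IsProbabilityMeasure F] {f : ℝ≥0 → EReal}
    (hf : Measurable f) (c : ℝ) (hc : ∀ r, f r ≤ c) :
    erealIntegral F f = (c : EReal) - ((∫⁻ r, ((c : EReal) - f r).toENNReal ∂F : ℝ≥0∞) : EReal) := by
  have hmp : Measurable fun r => (f r).toENNReal := hf.ereal_toENNReal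
  have hmn : Measurable fun r => (-f r).toENNReal := hf.neg.ereal_toENNReal
  have key : (∫⁻ r, ((c : EReal) - f r).toENNReal ∂F) +
      ((∫⁻ r, (f r).toENNReal ∂F) + ENNReal.ofReal (-c)) =
      ENNReal.ofReal c + ∫⁻ r, (-f r).toENNReal ∂F := by
    have h := lintegral_congr (μ := F) fun r => toENNReal_sub_add c (hc r)
    rwa [lintegral_add_right _ (hmp.add_const _), lintegral_add_right _ measurable_const,
      lintegral_add_right _ hmn, lintegral_const, lintegral_const, measure_univ, mul_one,
      mul_one] at h
  have hpos : ∫⁻ r, (f r).toENNReal ∂F ≠ ⊤ := by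
    refine (lt_of_le_of_lt (lintegral_mono fun r => EReal.toENNReal_le_toENNReal (hc r)) ?_).ne
    simp
  unfold erealIntegral
  set A := ∫⁻ r, ((c : EReal) - f r).toENNReal ∂F
  set B := ∫⁻ r, (f r).toENNReal ∂F
  set N := ∫⁻ r, (-f r).toENNReal ∂F
  by_cases hA : A = ⊤
  · have hN : N = ⊤ := by
      rw [hA, top_add] at key
      by_contra h
      exact ENNReal.add_ne_top.2 ⟨ENNReal.ofReal_ne_top, h⟩ key.symm
    simp [hA, hN]
  · have hN : N ≠ ⊤ := by
      intro h
      rw [h, add_top] at key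
      exact ENNReal.add_ne_top.2 ⟨hA, ENNReal.add_ne_top.2 ⟨hpos, ENNReal.ofReal_ne_top⟩⟩ key
    rw [← EReal.coe_ennreal_toReal hA, ← EReal.coe_ennreal_toReal hN,
      ← EReal.coe_ennreal_toReal hpos, ← EReal.coe_sub, ← EReal.coe_sub]
    congr 1
    have := congrArg ENNReal.toReal key
    rw [ENNReal.toReal_add hA (ENNReal.add_ne_top.2 ⟨hpos, ENNReal.ofReal_ne_top⟩),
      ENNReal.toReal_add hpos ENNReal.ofReal_ne_top, ENNReal.toReal_add ENNReal.ofReal_ne_top hN,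
      ENNReal.toReal_ofReal', ENNReal.toReal_ofReal'] at this
    rcases le_total 0 c with h | h
    · rw [max_eq_left h, max_eq_right (by linarith)] at this
      linarith
    · rw [max_eq_right h, max_eq_left (by linarith)] at this
      linarith

theorem lintegral_sub_le_of_le_erealIntegral (F : Measure ℝ≥0) [IsProbabilityMeasure F]
    {f : ℝ≥0 → EReal} (hf : Measurable f) {c v : ℝ} (hc : ∀ r, f r ≤ c)
    (h : (v : EReal) ≤ erealIntegral F f) :
    ∫⁻ r, ((c : EReal) - f r).toENNReal ∂F ≤ ENNReal.ofReal (c - v) := by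
  rw [erealIntegral_eq_sub F hf c hc] at h
  set A := ∫⁻ r, ((c : EReal) - f r).toENNReal ∂F
  have hA : A ≠ ⊤ := by
    intro hA
    simp [hA] at h
  rw [← EReal.coe_ennreal_toReal hA, ← EReal.coe_sub, EReal.coe_le_coe_iff] at h
  rw [← ENNReal.ofReal_toReal hA]
  exact ENNReal.ofReal_le_ofReal (by linarith)

theorem erealIntegral_lt (F : Measure ℝ≥0) [IsProbabilityMeasure F] {f : ℝ≥0 → EReal}
    (hf : Measurable f) {c : ℝ} (hc : ∀ r, f r ≤ c) (h : 0 < F {r | f r < c}) :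
    erealIntegral F f < c := by
  rw [erealIntegral_eq_sub F hf c hc]
  have hm : Measurable fun r => ((c : EReal) - f r).toENNReal :=
    ((Antitone.measurable fun _ _ h => EReal.sub_le_sub le_rfl h).comp hf).ereal_toENNReal
  have hA : 0 < ∫⁻ r, ((c : EReal) - f r).toENNReal ∂F := by
    rw [lintegral_pos_iff_support hm]
    refine lt_of_lt_of_le h (measure_mono fun r hr => ?_)
    simp only [Function.mem_support, ne_eq, EReal.toENNReal_ne_zero_iff]
    exact EReal.sub_pos.2 hr
  set A := ∫⁻ r, ((c : EReal) - f r).toENNReal ∂F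
  by_cases hT : A = ⊤
  · simp [hT]
  · rw [← EReal.coe_ennreal_toReal hT, ← EReal.coe_sub, EReal.coe_lt_coe_iff]
    have := ENNReal.toReal_pos hA.ne' hT
    linarith

/-! ### The attitude function -/

theorem extendPhi_of_pos {φ : ℝ → ℝ} {x : ℝ} (hx : 0 < x) : extendPhi φ x = (φ x : EReal) :=
  if_pos hx

theorem extendPhi_of_nonpos {φ : ℝ → ℝ} {x : ℝ} (hx : x ≤ 0) :
    extendPhi φ x = extendPhi φ 0 := by
  simp [extendPhi, not_lt.2 hx]

theorem extendPhi_zero_le {φ : ℝ → ℝ} (x : ℝ) : extendPhi φ 0 ≤ extendPhi φ x := by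
  rcases lt_or_ge 0 x with h | h
  · rw [extendPhi_of_pos h]
    simp only [extendPhi, lt_irrefl, if_false]
    exact iInf_le (fun y : Ioi (0 : ℝ) => (φ y : EReal)) ⟨x, h⟩
  · rw [extendPhi_of_nonpos h]

theorem extendPhi_mono {φ : ℝ → ℝ} (hφ : StrictMonoOn φ (Ioi 0)) : Monotone (extendPhi φ) := by
  intro x y hxy
  rcases lt_or_ge 0 x with h | h
  · rw [extendPhi_of_pos h, extendPhi_of_pos (h.trans_le hxy), EReal.coe_le_coe_iff]
    exact hφ.monotoneOn h (h.trans_le hxy) hxy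
  · rw [extendPhi_of_nonpos h]
    exact extendPhi_zero_le y

theorem extendPhi_lt {φ : ℝ → ℝ} (hφ : StrictMonoOn φ (Ioi 0)) {x y : ℝ} (hxy : x < y)
    (hy : 0 < y) : extendPhi φ x < extendPhi φ y := by
  rcases lt_or_ge 0 x with h | h
  · rw [extendPhi_of_pos h, extendPhi_of_pos hy, EReal.coe_lt_coe_iff]
    exact hφ h hy hxy
  · rw [extendPhi_of_nonpos h]
    refine lt_of_le_of_lt (extendPhi_zero_le (y / 2)) ?_
    rw [extendPhi_of_pos (half_pos hy), extendPhi_of_pos hy, EReal.coe_lt_coe_iff]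
    exact hφ (half_pos hy) hy (half_lt_self hy)

namespace CondIII

variable {φ : ℝ → ℝ}

theorem differentiableAt (h : CondIII φ) {x : ℝ} (hx : 0 < x) : DifferentiableAt ℝ φ x :=
  (h.contDiffOn.differentiableOn one_ne_zero).differentiableAt (Ioi_mem_nhds hx)

/-- `x φ'(x)` in logarithmic coordinates: the derivative of `u ↦ φ (exp u)`. -/
theorem hasDerivAt_exp (h : CondIII φ) (u : ℝ) :
    HasDerivAt (fun u => φ (Real.exp u)) (deriv φ (Real.exp u) * Real.exp u) u :=
  (h.differentiableAt (Real.exp_pos u)).hasDerivAt.comp u (Real.hasDerivAt_exp u)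

theorem monotone_slope (h : CondIII φ) :
    Monotone fun u => deriv φ (Real.exp u) * Real.exp u := fun _ _ huv =>
  h.monotoneOn (Real.exp_pos _) (Real.exp_pos _) (Real.exp_le_exp.2 huv)

theorem strictMono_exp (h : CondIII φ) : StrictMono fun u => φ (Real.exp u) := fun _ _ huv =>
  h.strictMonoOn (Real.exp_pos _) (Real.exp_pos _) (Real.exp_lt_exp.2 huv)

/-- The mean value theorem writes each chord slope of `u ↦ φ (exp u)` as a slope at an intermediate
point, which C-(iii) compares with the slope at `u` on either side. -/
theorem tangent_le (h : CondIII φ) (u v : ℝ) :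
    φ (Real.exp u) + deriv φ (Real.exp u) * Real.exp u * (v - u) ≤ φ (Real.exp v) := by
  have hc : Continuous fun u => φ (Real.exp u) :=
    continuous_iff_continuousAt.2 fun u => (h.hasDerivAt_exp u).continuousAt
  rcases lt_trichotomy u v with huv | rfl | huv
  · obtain ⟨w, hw, hw'⟩ := exists_hasDerivAt_eq_slope (fun u => φ (Real.exp u)) _ huv
      hc.continuousOn fun w _ => h.hasDerivAt_exp w
    rw [eq_div_iff (by linarith)] at hw'
    have := mul_le_mul_of_nonneg_right (h.monotone_slope hw.1.le) (sub_nonneg.2 huv.le)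
    simp only at this
    linarith
  · simp
  · obtain ⟨w, hw, hw'⟩ := exists_hasDerivAt_eq_slope (fun u => φ (Real.exp u)) _ huv
      hc.continuousOn fun w _ => h.hasDerivAt_exp w
    rw [eq_div_iff (by linarith)] at hw'
    have := mul_le_mul_of_nonneg_right (h.monotone_slope hw.2.le) (sub_nonneg.2 huv.le)
    simp only at this
    linarith

/-- A strictly increasing convex function has no critical point: the tangent at `u` lies below the
graph at `u - 1`, where the value is already strictly smaller. -/
theorem slope_pos (h : CondIII φ) (u : ℝ) : 0 < deriv φ (Real.exp u) * Real.exp u := by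
  have h1 := h.tangent_le u (u - 1)
  have h2 := h.strictMono_exp (sub_one_lt u)
  simp only at h2
  linarith

end CondIII

/-! ### Hitting times of continuous paths -/

theorem hitTime_lt_iff {w : ℝ≥0 → ℝ≥0} {R : Set ℝ≥0} {t : ℝ≥0∞} :
    hitTime w R < t ↔ ∃ s : ℝ≥0, 0 < s ∧ (s : ℝ≥0∞) < t ∧ w s ∈ R := by
  simp only [hitTime, sInf_lt_iff, mem_image, mem_ofPred_eq]
  constructor
  · rintro ⟨_, ⟨s, ⟨h0, hs⟩, rfl⟩, h⟩
    exact ⟨s, h0, h, hs⟩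
  · rintro ⟨s, h0, h, hs⟩
    exact ⟨s, ⟨s, ⟨h0, hs⟩, rfl⟩, h⟩

theorem hitTime_le {w : ℝ≥0 → ℝ≥0} {R : Set ℝ≥0} {s : ℝ≥0} (h0 : 0 < s) (hs : w s ∈ R) :
    hitTime w R ≤ s :=
  sInf_le ⟨s, ⟨h0, hs⟩, rfl⟩

theorem le_hitTime {w : ℝ≥0 → ℝ≥0} {R : Set ℝ≥0} {t : ℝ≥0∞}
    (h : ∀ s : ℝ≥0, 0 < s → w s ∈ R → t ≤ s) : t ≤ hitTime w R := by
  refine le_sInf ?_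
  rintro _ ⟨s, ⟨h0, hs⟩, rfl⟩
  exact h s h0 hs

theorem hitTime_anti (w : ℝ≥0 → ℝ≥0) {R R' : Set ℝ≥0} (h : R ⊆ R') :
    hitTime w R' ≤ hitTime w R :=
  le_hitTime fun _ h0 hs => hitTime_le h0 (h hs)

theorem exists_seq_tendsto_hitTime {w : ℝ≥0 → ℝ≥0} {R : Set ℝ≥0} (h : hitTime w R ≠ ⊤) :
    ∃ s : ℕ → ℝ≥0, (∀ n, 0 < s n ∧ w (s n) ∈ R) ∧
      Tendsto s atTop (𝓝 (hitTime w R).toNNReal) := by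
  set T := (hitTime w R).toNNReal
  have hT : hitTime w R = T := (ENNReal.coe_toNNReal h).symm
  have h1 : ∀ n : ℕ, ∃ s : ℝ≥0, 0 < s ∧ s < T + ((n : ℝ≥0) + 1)⁻¹ ∧ w s ∈ R := fun n => by
    have h2 : hitTime w R < ((T + ((n : ℝ≥0) + 1)⁻¹ : ℝ≥0) : ℝ≥0∞) := by
      rw [hT, ENNReal.coe_lt_coe]
      exact lt_add_of_pos_right _ (by positivity)
    obtain ⟨s, h0, hs, hR⟩ := hitTime_lt_iff.1 h2
    exact ⟨s, h0, ENNReal.coe_lt_coe.1 hs, hR⟩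
  choose s h0 hs hR using h1
  refine ⟨s, fun n => ⟨h0 n, hR n⟩, ?_⟩
  refine tendsto_of_tendsto_of_tendsto_of_le_of_le (g := fun _ => T)
    (h := fun n : ℕ => T + ((n : ℝ≥0) + 1)⁻¹) tendsto_const_nhds ?_ (fun n => ?_)
    (fun n => (hs n).le)
  · have : Tendsto (fun n : ℕ => ((n : ℝ≥0) + 1)⁻¹) atTop (𝓝 0) := by
      simpa [Function.comp_def] using (tendsto_inv_atTop_nhds_zero_nat (𝕜 := ℝ≥0)).comp (tendsto_add_atTop_nat 1)
    simpa using this.const_add T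
  · have := hitTime_le (h0 n) (hR n)
    rwa [hT, ENNReal.coe_le_coe] at this

theorem apply_hitTime_mem {w : ℝ≥0 → ℝ≥0} (hw : Continuous w) {C : Set ℝ≥0} (hC : IsClosed C)
    (h : hitTime w C ≠ ⊤) : w (hitTime w C).toNNReal ∈ C := by
  obtain ⟨s, hs, hlim⟩ := exists_seq_tendsto_hitTime h
  exact hC.mem_of_tendsto ((hw.tendsto _).comp hlim) (Eventually.of_forall fun n => (hs n).2)

/-- The paths that visit `C` at a time in `(0, t)`, described through countably many times; the
description is correct for continuous paths and closed `C`. -/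
def hitsBefore (C : Set ℝ≥0) (t : ℝ≥0) : Set (ℝ≥0 → ℝ≥0) :=
  {w | ∃ n : ℕ, ∀ m : ℕ, ∃ k : ℕ, (((n : ℝ≥0) + 1)⁻¹ ≤ TopologicalSpace.denseSeq ℝ≥0 k ∧
    TopologicalSpace.denseSeq ℝ≥0 k + ((n : ℝ≥0) + 1)⁻¹ ≤ t) ∧
    Metric.infEDist (w (TopologicalSpace.denseSeq ℝ≥0 k)) C < ((m : ℝ≥0∞) + 1)⁻¹}

/-- On the compact interval `[δ, t - δ]` the distance to `C` attains its infimum, so arbitrarily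
small distances at countably many times force a genuine visit. Conversely, times of the dense
sequence near a visit have small distance. -/
theorem mem_hitsBefore_iff {w : ℝ≥0 → ℝ≥0} (hw : Continuous w) {C : Set ℝ≥0} (hC : IsClosed C)
    {t : ℝ≥0} : w ∈ hitsBefore C t ↔ hitTime w C < t := by
  have hd : Continuous fun s => Metric.infEDist (w s) C := Metric.continuous_infEDist.comp hw
  rw [hitTime_lt_iff]
  constructor
  · rintro ⟨n, hn⟩
    set δ : ℝ≥0 := ((n : ℝ≥0) + 1)⁻¹
    have hδ : 0 < δ := by positivity
    have hne : (Icc δ (t - δ)).Nonempty := by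
      obtain ⟨k, hk, -⟩ := hn 0
      exact ⟨_, hk.1, le_tsub_of_add_le_right hk.2⟩
    obtain ⟨s, hs, hmin⟩ := isCompact_Icc.exists_isMinOn hne hd.continuousOn
    have h0 : Metric.infEDist (w s) C = 0 := by
      by_contra h
      obtain ⟨m, hm⟩ := ENNReal.exists_inv_nat_lt h
      obtain ⟨k, hk, hk'⟩ := hn m
      have h1 := hmin ⟨hk.1, le_tsub_of_add_le_right hk.2⟩
      have h2 : ((m : ℝ≥0∞) + 1)⁻¹ ≤ (m : ℝ≥0∞)⁻¹ := ENNReal.inv_le_inv.2 le_self_add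
      exact absurd (lt_of_le_of_lt h1 (hk'.trans_le h2)) (not_lt.2 hm.le)
    -- This rules out that the truncated subtraction `t - δ` collapses to `0`.
    have hδt : δ ≤ t - δ := hs.1.trans hs.2
    refine ⟨s, hδ.trans_le hs.1, ?_, ?_⟩
    · rw [ENNReal.coe_lt_coe]
      refine hs.2.trans_lt (tsub_lt_self ?_ hδ)
      exact hδ.trans_le (hδt.trans tsub_le_self)
    · exact (Metric.mem_iff_infEDist_zero_of_closed hC).2 h0
  · rintro ⟨s, h0, hst, hs⟩
    rw [ENNReal.coe_lt_coe] at hst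
    obtain ⟨n, hn⟩ := exists_nat_gt (max s⁻¹ (t - s)⁻¹)
    set δ : ℝ≥0 := ((n : ℝ≥0) + 1)⁻¹ with hδ
    have h1 : δ < s := by
      rw [hδ, inv_lt_comm₀ (by positivity) h0]
      exact ((le_max_left _ _).trans_lt hn).trans (lt_add_one _)
    have h2 : δ < t - s := by
      rw [hδ, inv_lt_comm₀ (by positivity) (tsub_pos_of_lt hst)]
      exact ((le_max_right _ _).trans_lt hn).trans (lt_add_one _)
    refine ⟨n, fun m => ?_⟩
    have hopen : IsOpen {q : ℝ≥0 | δ < q ∧ q + δ < t ∧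
        Metric.infEDist (w q) C < ((m : ℝ≥0∞) + 1)⁻¹} :=
      (isOpen_lt continuous_const continuous_id).inter
        ((isOpen_lt (by fun_prop) continuous_const).inter (isOpen_lt hd continuous_const))
    obtain ⟨k, hk⟩ := (TopologicalSpace.denseRange_denseSeq ℝ≥0).exists_mem_open hopen
      ⟨s, h1, by rw [add_comm]; exact lt_tsub_iff_right.1 h2, by
        rw [Metric.infEDist_zero_of_mem hs]; simp⟩
    exact ⟨k, ⟨hk.1.le, hk.2.1.le⟩, hk.2.2⟩

theorem measurableSet_comp_hitsBefore {Ω : Type*} {m : MeasurableSpace Ω} {X : ℝ≥0 → Ω → ℝ≥0}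
    (C : Set ℝ≥0) (t : ℝ≥0) (hX : ∀ s ≤ t, Measurable (X s)) :
    MeasurableSet {ω | (fun s => X s ω) ∈ hitsBefore C t} := by
  have : {ω | (fun s => X s ω) ∈ hitsBefore C t} = ⋃ n : ℕ, ⋂ m : ℕ, ⋃ k : ℕ,
      {ω | (((n : ℝ≥0) + 1)⁻¹ ≤ TopologicalSpace.denseSeq ℝ≥0 k ∧
        TopologicalSpace.denseSeq ℝ≥0 k + ((n : ℝ≥0) + 1)⁻¹ ≤ t) ∧
        Metric.infEDist (X (TopologicalSpace.denseSeq ℝ≥0 k) ω) C < ((m : ℝ≥0∞) + 1)⁻¹} := by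
    ext ω
    simp only [hitsBefore, mem_ofPred_eq, mem_iUnion, mem_iInter]
  rw [this]
  refine MeasurableSet.iUnion fun n => MeasurableSet.iInter fun m => MeasurableSet.iUnion fun k => ?_
  by_cases h : ((n : ℝ≥0) + 1)⁻¹ ≤ TopologicalSpace.denseSeq ℝ≥0 k ∧
    TopologicalSpace.denseSeq ℝ≥0 k + ((n : ℝ≥0) + 1)⁻¹ ≤ t
  · simp only [h, true_and]
    exact measurableSet_lt (measurable_infEDist.comp (hX _ (le_self_add.trans h.2)))
      measurable_const
  · simp only [h, false_and, ofPred_false]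
    exact MeasurableSet.empty

theorem measurableSet_hitsBefore (C : Set ℝ≥0) (t : ℝ≥0) : MeasurableSet (hitsBefore C t) :=
  measurableSet_comp_hitsBefore (X := fun s (w : ℝ≥0 → ℝ≥0) => w s) C t fun _ _ =>
    measurable_pi_apply _

section Paths

variable {Ω : Type*} {m : MeasurableSpace Ω} {X : ℝ≥0 → Ω → ℝ≥0}

theorem measurableSet_hitTime_lt (hc : ∀ ω, Continuous fun t => X t ω) {C : Set ℝ≥0}
    (hC : IsClosed C) (t : ℝ≥0) (hX : ∀ s ≤ t, Measurable (X s)) :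
    MeasurableSet {ω | hitTime (fun s => X s ω) C < t} := by
  simpa only [mem_hitsBefore_iff (hc _) hC] using measurableSet_comp_hitsBefore C t hX

theorem measurable_of_lt_coe {f : Ω → ℝ≥0∞} (h : ∀ t : ℝ≥0, MeasurableSet {ω | f ω < t}) :
    Measurable f := by
  refine measurable_of_Iio fun t => ?_
  induction t with
  | top =>
    have : f ⁻¹' Iio ⊤ = ⋃ n : ℕ, {ω | f ω < ((n : ℝ≥0) : ℝ≥0∞)} := by
      ext ω
      simp only [mem_preimage, mem_Iio, mem_iUnion, mem_ofPred_eq]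
      constructor
      · intro h
        obtain ⟨n, hn⟩ := ENNReal.exists_nat_gt h.ne
        exact ⟨n, by exact_mod_cast hn⟩
      · rintro ⟨n, hn⟩
        exact hn.trans ENNReal.coe_lt_top
    rw [this]
    exact MeasurableSet.iUnion fun n => h _
  | coe t => exact h t

theorem measurable_hitTime (hX : ∀ t, Measurable (X t)) (hc : ∀ ω, Continuous fun t => X t ω)
    {C : Set ℝ≥0} (hC : IsClosed C) : Measurable fun ω => hitTime (fun t => X t ω) C :=
  measurable_of_lt_coe fun t => measurableSet_hitTime_lt hc hC t fun s _ => hX s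

theorem measurable_apply_random_time (hX : ∀ t, Measurable (X t))
    (hc : ∀ ω, Continuous fun t => X t ω) {T : Ω → ℝ≥0} (hT : Measurable T) :
    Measurable fun ω => X (T ω) ω :=
  (measurable_uncurry_of_continuous_of_measurable (u := X) hc hX).comp (hT.prodMk measurable_id)

theorem measurable_discountedPayoff (hX : ∀ t, Measurable (X t))
    (hc : ∀ ω, Continuous fun t => X t ω) {C : Set ℝ≥0} (hC : IsClosed C) {g : ℝ≥0 → ℝ}
    (hg : Measurable g) (r : ℝ≥0) :
    Measurable fun ω => discountedPayoff g r C fun t => X t ω := by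
  have hτ := measurable_hitTime hX hc hC
  refine Measurable.ite (hτ (measurableSet_singleton ⊤)) measurable_const ?_
  exact (Real.measurable_exp.comp (hτ.ennreal_toReal.const_mul _)).mul
    (hg.comp (measurable_apply_random_time hX hc hτ.ennreal_toNNReal))

end Paths

/-! ### Put payoff, discounted payoffs and immediate visits -/

theorem put_nonneg (K x : ℝ≥0) : 0 ≤ put K x := le_max_right _ _

theorem put_le (K x : ℝ≥0) : put K x ≤ K :=
  max_le (sub_le_self _ x.2) K.2

theorem put_of_le {K x : ℝ≥0} (h : x ≤ K) : put K x = K - x :=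
  max_eq_left (sub_nonneg.2 (NNReal.coe_le_coe.2 h))

theorem put_of_ge {K x : ℝ≥0} (h : K ≤ x) : put K x = 0 :=
  max_eq_right (sub_nonpos.2 (NNReal.coe_le_coe.2 h))

theorem put_anti (K : ℝ≥0) : Antitone (put K) := fun _ _ h =>
  max_le_max_right _ (sub_le_sub_left (NNReal.coe_le_coe.2 h) _)

theorem measurable_put (K : ℝ≥0) : Measurable (put K) := (put_anti K).measurable

section Payoff

variable {g : ℝ≥0 → ℝ} {R : Set ℝ≥0} {w : ℝ≥0 → ℝ≥0} {r : ℝ≥0}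

theorem discountedPayoff_of_top (h : hitTime w R = ⊤) : discountedPayoff g r R w = 0 := if_pos h

theorem discountedPayoff_of_ne_top (h : hitTime w R ≠ ⊤) : discountedPayoff g r R w =
    Real.exp (-(r : ℝ) * (hitTime w R).toReal) * g (w (hitTime w R).toNNReal) := if_neg h

theorem discountedPayoff_nonneg (hg : ∀ x, 0 ≤ g x) (r : ℝ≥0) (R : Set ℝ≥0) (w : ℝ≥0 → ℝ≥0) :
    0 ≤ discountedPayoff g r R w := by
  unfold discountedPayoff
  split_ifs
  · exact le_rfl
  · exact mul_nonneg (Real.exp_pos _).le (hg _)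

theorem discountedPayoff_anti (hg : ∀ x, 0 ≤ g x) (R : Set ℝ≥0) (w : ℝ≥0 → ℝ≥0) :
    Antitone fun r => discountedPayoff g r R w := by
  intro r s hrs
  unfold discountedPayoff
  split_ifs
  · exact le_rfl
  · refine mul_le_mul_of_nonneg_right (Real.exp_le_exp.2 ?_) (hg _)
    have : (r : ℝ) ≤ s := hrs
    have := mul_le_mul_of_nonneg_right this (ENNReal.toReal_nonneg (a := hitTime w R))
    linarith

theorem discountedPayoff_le {c : ℝ} (hg : ∀ x, 0 ≤ g x) (hc : ∀ x, g x ≤ c) (r : ℝ≥0)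
    (R : Set ℝ≥0) (w : ℝ≥0 → ℝ≥0) : discountedPayoff g r R w ≤ c := by
  unfold discountedPayoff
  split_ifs
  · exact (hg 0).trans (hc 0)
  · refine (mul_le_of_le_one_left (hg _) (Real.exp_le_one_iff.2 ?_)).trans (hc _)
    rw [neg_mul]
    exact neg_nonpos.2 (mul_nonneg r.2 ENNReal.toReal_nonneg)

theorem discountedPayoff_zero_rate (h : hitTime w R ≠ ⊤) :
    discountedPayoff g 0 R w = g (w (hitTime w R).toNNReal) := by
  simp [discountedPayoff, h]

end Payoff

/-- The paths that visit `O` at arbitrarily small positive times, described through countably many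
times; the description is correct for continuous paths and open `O`. -/
def immediatelyVisits (O : Set ℝ≥0) : Set (ℝ≥0 → ℝ≥0) :=
  {w | ∀ n : ℕ, ∃ k : ℕ, (0 < TopologicalSpace.denseSeq ℝ≥0 k ∧
    TopologicalSpace.denseSeq ℝ≥0 k < ((n : ℝ≥0) + 1)⁻¹) ∧ w (TopologicalSpace.denseSeq ℝ≥0 k) ∈ O}

theorem measurableSet_immediatelyVisits {O : Set ℝ≥0} (hO : MeasurableSet O) :
    MeasurableSet (immediatelyVisits O) := by
  have : immediatelyVisits O = ⋂ n : ℕ, ⋃ k : ℕ, {w : ℝ≥0 → ℝ≥0 |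
      (0 < TopologicalSpace.denseSeq ℝ≥0 k ∧
        TopologicalSpace.denseSeq ℝ≥0 k < ((n : ℝ≥0) + 1)⁻¹) ∧
        w (TopologicalSpace.denseSeq ℝ≥0 k) ∈ O} := by
    ext w
    simp only [immediatelyVisits, mem_ofPred_eq, mem_iUnion, mem_iInter]
  rw [this]
  refine MeasurableSet.iInter fun n => MeasurableSet.iUnion fun k => ?_
  by_cases h : 0 < TopologicalSpace.denseSeq ℝ≥0 k ∧
        TopologicalSpace.denseSeq ℝ≥0 k < ((n : ℝ≥0) + 1)⁻¹
  · simp only [h, true_and]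
    exact measurable_pi_apply _ hO
  · simp only [h, false_and, ofPred_false]
    exact MeasurableSet.empty

theorem exists_of_mem_immediatelyVisits {O : Set ℝ≥0} {w : ℝ≥0 → ℝ≥0}
    (h : w ∈ immediatelyVisits O) {ε : ℝ≥0} (hε : 0 < ε) : ∃ s, 0 < s ∧ s < ε ∧ w s ∈ O := by
  obtain ⟨n, hn⟩ := exists_nat_gt ε⁻¹
  obtain ⟨k, hk, hk'⟩ := h n
  refine ⟨_, hk.1, hk.2.trans ?_, hk'⟩
  rw [inv_lt_comm₀ (by positivity) hε]
  exact hn.trans (lt_add_one _)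

theorem mem_immediatelyVisits {O : Set ℝ≥0} (hO : IsOpen O) {w : ℝ≥0 → ℝ≥0} (hw : Continuous w)
    (h : ∀ ε : ℝ≥0, 0 < ε → ∃ s, 0 < s ∧ s < ε ∧ w s ∈ O) : w ∈ immediatelyVisits O := by
  intro n
  have hopen : IsOpen {q : ℝ≥0 | (0 < q ∧ q < ((n : ℝ≥0) + 1)⁻¹) ∧ w q ∈ O} :=
    ((isOpen_lt continuous_const continuous_id).inter
      (isOpen_lt continuous_id continuous_const)).inter (hO.preimage hw)
  obtain ⟨s, h0, h1, h2⟩ := h ((n : ℝ≥0) + 1)⁻¹ (by positivity)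
  exact (TopologicalSpace.denseRange_denseSeq ℝ≥0).exists_mem_open hopen ⟨s, ⟨h0, h1⟩, h2⟩

theorem measurableSet_hitTime_open_lt {Ω : Type*} {m : MeasurableSpace Ω} {X : ℝ≥0 → Ω → ℝ≥0}
    (hc : ∀ ω, Continuous fun t => X t ω) {O : Set ℝ≥0} (hO : IsOpen O) (t : ℝ≥0)
    (hX : ∀ s ≤ t, Measurable (X s)) :
    MeasurableSet {ω | hitTime (fun s => X s ω) O < t} := by
  have : {ω | hitTime (fun s => X s ω) O < t} = ⋃ k : ℕ, {ω |
      (0 < TopologicalSpace.denseSeq ℝ≥0 k ∧ TopologicalSpace.denseSeq ℝ≥0 k < t) ∧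
        X (TopologicalSpace.denseSeq ℝ≥0 k) ω ∈ O} := by
    ext ω
    simp only [mem_ofPred_eq, mem_iUnion, hitTime_lt_iff, ENNReal.coe_lt_coe]
    constructor
    · rintro ⟨s, h0, hs, hsO⟩
      have hopen : IsOpen {q : ℝ≥0 | (0 < q ∧ q < t) ∧ X q ω ∈ O} :=
        ((isOpen_lt continuous_const continuous_id).inter
          (isOpen_lt continuous_id continuous_const)).inter (hO.preimage (hc ω))
      exact (TopologicalSpace.denseRange_denseSeq ℝ≥0).exists_mem_open hopen ⟨s, ⟨h0, hs⟩, hsO⟩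
    · rintro ⟨k, hk, hk'⟩
      exact ⟨_, hk.1, hk.2, hk'⟩
  rw [this]
  refine MeasurableSet.iUnion fun k => ?_
  by_cases h : 0 < TopologicalSpace.denseSeq ℝ≥0 k ∧ TopologicalSpace.denseSeq ℝ≥0 k < t
  · simp only [h, true_and]
    exact hX _ h.2.le hO.measurableSet
  · simp only [h, false_and, ofPred_false]
    exact MeasurableSet.empty

/-! ### The strong Markov property at hitting times -/

namespace RegularDiffusion

variable {Ω : Type*} [MeasurableSpace Ω] (D : RegularDiffusion Ω)

instance : IsProbabilityMeasure D.P := D.isProbabilityMeasure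

/-- The path `t ↦ X x t ω`. -/
def path (x : ℝ≥0) (ω : Ω) : ℝ≥0 → ℝ≥0 := fun t => D.X x t ω

theorem continuous_path' (x : ℝ≥0) (ω : Ω) : Continuous (D.path x ω) := D.continuous_path x ω

@[simp] theorem path_zero (x : ℝ≥0) (ω : Ω) : D.path x ω 0 = x := D.start x ω

theorem measurable_path (x : ℝ≥0) : Measurable (D.path x) :=
  measurable_pi_lambda _ fun t => D.measurable_X x t

/-- The filtration generated by the process started at `x`. -/
def filtration (x : ℝ≥0) : Filtration ℝ≥0 ‹MeasurableSpace Ω› :=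
  Filtration.natural (D.X x) fun t => (D.measurable_X x t).stronglyMeasurable

theorem measurable_filtration (x : ℝ≥0) {s t : ℝ≥0} (hst : s ≤ t) :
    Measurable[D.filtration x t] (D.X x s) := by
  refine Measurable.mono (comap_measurable (D.X x s)) ?_ le_rfl
  exact le_iSup₂_of_le (f := fun j (_ : j ≤ t) => MeasurableSpace.comap (D.X x j) _) s hst le_rfl

/-- The path up to time `t` decides `{τ < t}` but not always `{τ ≤ t}`; for the right-continuous
filtration the former is enough. -/
theorem isStoppingTime_hitTime (x : ℝ≥0) {R : Set ℝ≥0} (hR : IsClosed R ∨ IsOpen R) :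
    IsStoppingTime (D.filtration x).rightCont
      fun ω => (hitTime (D.path x ω) R : WithTop ℝ≥0) := by
  refine isStoppingTime_of_measurableSet_lt_of_isRightContinuous fun t => ?_
  refine (D.filtration x).le_rightCont t _ ?_
  rcases hR with h | h
  · exact measurableSet_hitTime_lt (m := D.filtration x t) (D.continuous_path x) h t
      fun s hs => D.measurable_filtration x hs
  · exact measurableSet_hitTime_open_lt (m := D.filtration x t) (D.continuous_path x) h t
      fun s hs => D.measurable_filtration x hs

theorem measurable_hitTime {R : Set ℝ≥0} (hR : IsClosed R) (x : ℝ≥0) :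
    Measurable fun ω => hitTime (D.path x ω) R :=
  DiverseStopping.measurable_hitTime (D.measurable_X x) (D.continuous_path x) hR

/-- The strong Markov property at the hitting time of a closed or open set. -/
theorem strongMarkov_hitTime (x : ℝ≥0) {R : Set ℝ≥0} (hR : IsClosed R ∨ IsOpen R)
    {S : Set ℝ≥0∞} (hS : MeasurableSet S) {B : Set (ℝ≥0 → ℝ≥0)} (hB : MeasurableSet B) :
    D.P {ω | hitTime (D.path x ω) R ∈ S ∧ hitTime (D.path x ω) R ≠ ⊤ ∧
        (fun t => D.path x ω ((hitTime (D.path x ω) R).toNNReal + t)) ∈ B} =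
      ∫⁻ ω in {ω | hitTime (D.path x ω) R ∈ S ∧ hitTime (D.path x ω) R ≠ ⊤},
        D.P {ω' | D.path (D.path x ω (hitTime (D.path x ω) R).toNNReal) ω' ∈ B} ∂D.P := by
  have hτ := D.isStoppingTime_hitTime x hR
  have hA : MeasurableSet[hτ.measurableSpace] {ω | hitTime (D.path x ω) R ∈ S} := by
    have hm : @Measurable _ _ hτ.measurableSpace _ fun ω => hitTime (D.path x ω) R :=
      measurable_of_lt_coe (m := hτ.measurableSpace) fun t => hτ.measurableSet_lt' t
    exact hm hS
  have h : D.P ({ω | hitTime (D.path x ω) R ∈ S ∧ hitTime (D.path x ω) R ≠ ⊤} ∩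
      {ω | (fun t => D.path x ω ((hitTime (D.path x ω) R).toNNReal + t)) ∈ B}) =
      ∫⁻ ω in {ω | hitTime (D.path x ω) R ∈ S ∧ hitTime (D.path x ω) R ≠ ⊤},
        D.P {ω' | D.path (D.path x ω (hitTime (D.path x ω) R).toNNReal) ω' ∈ B} ∂D.P :=
    D.strongMarkov x _ hτ _ hA B hB
  refine Eq.trans (congrArg D.P ?_) h
  ext ω
  exact and_assoc.symm

end RegularDiffusion

theorem measurableSet_forall_exists {α : Type*} [MeasurableSpace α] {p : ℕ → ℕ → α → Prop}
    (h : ∀ n k, MeasurableSet {w | p n k w}) : MeasurableSet {w | ∀ n, ∃ k, p n k w} := by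
  have : {w | ∀ n, ∃ k, p n k w} = ⋂ n, ⋃ k, {w | p n k w} := by
    ext w
    simp
  rw [this]
  exact MeasurableSet.iInter fun n => MeasurableSet.iUnion fun k => h n k

/-! ### Oscillation of paths and passage to closed policies -/

namespace RegularDiffusion

variable {Ω : Type*} [MeasurableSpace Ω] (D : RegularDiffusion Ω)

theorem hitTime_ne_top_pos {x y : ℝ≥0} (hx : 0 < x) (hy : 0 < y) (hxy : x ≠ y) {R : Set ℝ≥0}
    (hR : y ∈ R) : 0 < D.P {ω | hitTime (D.path x ω) R ≠ ⊤} := by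
  refine (D.regular x y hx hy).trans_le (measure_mono ?_)
  rintro ω ⟨t, ht⟩
  have h0 : 0 < t := by
    rw [pos_iff_ne_zero]
    rintro rfl
    exact hxy (by rw [← ht, D.start])
  exact ((hitTime_le (w := D.path x ω) h0 (by rw [path, ht]; exact hR)).trans_lt
    ENNReal.coe_lt_top).ne

/-- The process started at an accessible frontier point of an open set visits that set
immediately. -/
theorem ae_mem_immediatelyVisits {O : Set ℝ≥0} (hO : IsOpen O) {y : ℝ≥0} (hy : y ∉ O)
    (hfr : frontier O ⊆ {y}) (hpos : 0 < D.P {ω | hitTime (D.path y ω) O ≠ ⊤}) :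
    ∀ᵐ ω ∂D.P, D.path y ω ∈ immediatelyVisits O := by
  have hB := measurableSet_immediatelyVisits hO.measurableSet
  -- At the hitting time of the open set the path sits on the frontier, hence at `y`, and it visits
  -- the set at arbitrarily small times afterwards.
  have key : ∀ ω, hitTime (D.path y ω) O ≠ ⊤ →
      D.path y ω (hitTime (D.path y ω) O).toNNReal = y ∧
      (fun t => D.path y ω ((hitTime (D.path y ω) O).toNNReal + t)) ∈ immediatelyVisits O := by
    intro ω h
    set w := D.path y ω
    have hw : Continuous w := D.continuous_path' y ω
    obtain ⟨s, hs, hlim⟩ := exists_seq_tendsto_hitTime h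
    set T := (hitTime w O).toNNReal
    have hT : hitTime w O = T := (ENNReal.coe_toNNReal h).symm
    have hcl : w T ∈ closure O :=
      mem_closure_of_tendsto ((hw.tendsto _).comp hlim) (Eventually.of_forall fun n => (hs n).2)
    -- If `w T` were in `O` with `T > 0`, continuity would give an earlier positive visit; if `T =
    -- 0`, the starting point `y` would lie in `O`.
    have hnot : w T ∉ O := by
      intro hTO
      rcases eq_or_ne T 0 with h0 | h0
      · rw [h0] at hTO
        exact hy (by simpa [w] using hTO)
      · have hev : ∀ᶠ t in 𝓝[<] T, w t ∈ O ∧ 0 < t :=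
          ((hw.tendsto T).eventually (hO.mem_nhds hTO)).filter_mono nhdsWithin_le_nhds |>.and
            ((eventually_gt_nhds (pos_iff_ne_zero.2 h0)).filter_mono nhdsWithin_le_nhds)
        have : (𝓝[<] T).NeBot := nhdsLT_neBot_of_exists_lt ⟨0, pos_iff_ne_zero.2 h0⟩
        obtain ⟨t, ⟨ht, ht0⟩, htT⟩ := (hev.and self_mem_nhdsWithin).exists
        have := hitTime_le ht0 ht
        rw [hT, ENNReal.coe_le_coe] at this
        exact absurd htT (not_lt.2 this)
    have hTy : w T = y := hfr ⟨hcl, by rwa [hO.interior_eq]⟩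
    refine ⟨hTy, mem_immediatelyVisits hO (hw.comp (by fun_prop)) fun ε hε => ?_⟩
    obtain ⟨n, hn⟩ := (hlim.eventually (gt_mem_nhds (lt_add_of_pos_right T hε))).exists
    have h1 : T ≤ s n := by
      have := hitTime_le (hs n).1 (hs n).2
      rwa [hT, ENNReal.coe_le_coe] at this
    have h2 : T < s n := lt_of_le_of_ne h1 fun h => hnot (h ▸ (hs n).2)
    refine ⟨s n - T, tsub_pos_of_lt h2, ?_, ?_⟩
    · rw [tsub_lt_iff_left h1]
      exact hn
    · simp only [add_tsub_cancel_of_le h1]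
      exact (hs n).2
  have h := D.strongMarkov_hitTime y (Or.inr hO) MeasurableSet.univ hB
  have e1 : {ω | hitTime (D.path y ω) O ∈ univ ∧ hitTime (D.path y ω) O ≠ ⊤ ∧
      (fun t => D.path y ω ((hitTime (D.path y ω) O).toNNReal + t)) ∈ immediatelyVisits O} =
      {ω | hitTime (D.path y ω) O ≠ ⊤} := by
    ext ω
    simp only [mem_univ, true_and, mem_ofPred_eq]
    exact ⟨fun h => h.1, fun h => ⟨h, (key ω h).2⟩⟩
  have e2 : {ω | hitTime (D.path y ω) O ∈ univ ∧ hitTime (D.path y ω) O ≠ ⊤} =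
      {ω | hitTime (D.path y ω) O ≠ ⊤} := by
    simp only [mem_univ, true_and]
  have hm : MeasurableSet {ω | hitTime (D.path y ω) O ≠ ⊤} := by
    have : Measurable fun ω => hitTime (D.path y ω) O :=
      measurable_of_lt_coe fun t =>
        measurableSet_hitTime_open_lt (D.continuous_path y) hO t fun s _ => D.measurable_X y s
    exact (this (measurableSet_singleton ⊤)).compl
  rw [e1, e2, setLIntegral_congr_fun hm (g := fun _ => D.P {ω' | D.path y ω' ∈ immediatelyVisits O})
    fun ω hω => by simp only [(key ω hω).1], setLIntegral_const] at h
  -- The strong Markov identity now reads `p = q p`, where `p > 0` is the probability of reaching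
  -- `O` and `q` that of visiting it immediately; so `q = 1`.
  have h1 : D.P {ω' | D.path y ω' ∈ immediatelyVisits O} = 1 := by
    have h2 := (ENNReal.mul_eq_right hpos.ne' (measure_ne_top D.P _)).1 h.symm
    exact h2
  exact (prob_compl_eq_zero_iff (D.measurable_path y hB)).2 h1

/-- The paths that start in `(0, ∞)` and do not immediately move both below and above their
starting point. -/
def nonOscillating : Set (ℝ≥0 → ℝ≥0) :=
  {w | 0 < w 0 ∧ ¬ ((∀ n : ℕ, ∃ k : ℕ, (0 < TopologicalSpace.denseSeq ℝ≥0 k ∧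
      TopologicalSpace.denseSeq ℝ≥0 k < ((n : ℝ≥0) + 1)⁻¹) ∧
        w (TopologicalSpace.denseSeq ℝ≥0 k) < w 0) ∧
    (∀ n : ℕ, ∃ k : ℕ, (0 < TopologicalSpace.denseSeq ℝ≥0 k ∧
      TopologicalSpace.denseSeq ℝ≥0 k < ((n : ℝ≥0) + 1)⁻¹) ∧
        w 0 < w (TopologicalSpace.denseSeq ℝ≥0 k)))}

theorem mem_nonOscillating_iff {w : ℝ≥0 → ℝ≥0} : w ∈ nonOscillating ↔
    0 < w 0 ∧ ¬ (w ∈ immediatelyVisits (Iio (w 0)) ∧ w ∈ immediatelyVisits (Ioi (w 0))) := Iff.rfl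

theorem measurableSet_nonOscillating : MeasurableSet nonOscillating := by
  have hlt : ∀ s t : ℝ≥0, MeasurableSet {w : ℝ≥0 → ℝ≥0 | w s < w t} := fun s t =>
    measurableSet_lt (measurable_pi_apply _) (measurable_pi_apply _)
  have h0 : MeasurableSet {w : ℝ≥0 → ℝ≥0 | 0 < w 0} :=
    measurableSet_lt measurable_const (measurable_pi_apply _)
  refine h0.inter
    (MeasurableSet.compl (MeasurableSet.inter ?_ ?_))
  · exact measurableSet_forall_exists fun n k => (MeasurableSet.const _).inter (hlt _ _)
  · exact measurableSet_forall_exists fun n k => (MeasurableSet.const _).inter (hlt _ _)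

theorem ae_immediatelyVisits_Iio {y : ℝ≥0} (hy : 0 < y) :
    ∀ᵐ ω ∂D.P, D.path y ω ∈ immediatelyVisits (Iio y) :=
  D.ae_mem_immediatelyVisits isOpen_Iio (by simp) (frontier_lt_subset_eq continuous_id continuous_const)
    (D.hitTime_ne_top_pos hy (half_pos hy) (half_lt_self hy).ne' (half_lt_self hy))

theorem ae_immediatelyVisits_Ioi {y : ℝ≥0} (hy : 0 < y) :
    ∀ᵐ ω ∂D.P, D.path y ω ∈ immediatelyVisits (Ioi y) :=
  D.ae_mem_immediatelyVisits isOpen_Ioi (by simp) (fun z hz =>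
      (frontier_lt_subset_eq continuous_const continuous_id hz : y = z).symm)
    (D.hitTime_ne_top_pos hy (add_pos hy one_pos) (lt_add_one y).ne (lt_add_one y))

theorem measure_nonOscillating (y : ℝ≥0) : D.P {ω | D.path y ω ∈ nonOscillating} = 0 := by
  rcases eq_or_ne y 0 with rfl | hy
  · simp [mem_nonOscillating_iff]
  · have h1 := D.ae_immediatelyVisits_Iio (pos_iff_ne_zero.2 hy)
    have h2 := D.ae_immediatelyVisits_Ioi (pos_iff_ne_zero.2 hy)
    rw [measure_eq_zero_iff_ae_notMem]
    filter_upwards [h1, h2] with ω h1 h2 h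
    rw [mem_nonOscillating_iff, path_zero] at h
    exact h.2 ⟨h1, h2⟩

theorem ae_oscillating_after_hitTime (x : ℝ≥0) {C : Set ℝ≥0} (hC : IsClosed C) :
    ∀ᵐ ω ∂D.P, hitTime (D.path x ω) C ≠ ⊤ →
      (fun t => D.path x ω ((hitTime (D.path x ω) C).toNNReal + t)) ∉ nonOscillating := by
  have h := D.strongMarkov_hitTime x (Or.inl hC) MeasurableSet.univ measurableSet_nonOscillating
  simp only [mem_univ, true_and, D.measure_nonOscillating, lintegral_zero] at h
  rw [measure_eq_zero_iff_ae_notMem] at h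
  filter_upwards [h] with ω hω h1 h2
  exact hω ⟨h1, h2⟩

/-- Shortly after its start the path has been both below and above `v 0`, so by the intermediate
value theorem it has covered a whole neighbourhood of `v 0`, which contains a point of `R`. -/
theorem exists_mem_of_oscillating {v : ℝ≥0 → ℝ≥0} (hv : Continuous v) (h0 : 0 < v 0)
    (h : v ∉ nonOscillating) {R : Set ℝ≥0} (hR : v 0 ∈ closure R) {ε : ℝ≥0} (hε : 0 < ε) :
    ∃ s, 0 < s ∧ s < ε ∧ v s ∈ R := by
  rw [mem_nonOscillating_iff] at h
  obtain ⟨h1, h2⟩ := not_not.1 fun h' => h ⟨h0, h'⟩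
  obtain ⟨s, hs0, hs, hsv⟩ := exists_of_mem_immediatelyVisits h1 hε
  obtain ⟨t, ht0, ht, htv⟩ := exists_of_mem_immediatelyVisits h2 hε
  obtain ⟨y, hy, hyR⟩ := mem_closure_iff.1 hR (Ioo (v s) (v t)) isOpen_Ioo ⟨hsv, htv⟩
  obtain ⟨u, hu, huy⟩ := intermediate_value_uIcc hv.continuousOn
    (Icc_subset_uIcc (Ioo_subset_Icc_self hy) : y ∈ uIcc (v s) (v t))
  rw [uIcc, mem_Icc] at hu
  refine ⟨u, (lt_min hs0 ht0).trans_le hu.1, hu.2.trans_lt (max_lt hs ht), ?_⟩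
  rw [huy]
  exact hyR

/-- Replacing a policy `R` by `closure R ∩ [0, K]` does not decrease the payoff. -/
theorem discountedPayoff_le_closure {w : ℝ≥0 → ℝ≥0} (hw : Continuous w) (K r : ℝ≥0)
    (R : Set ℝ≥0) (h : hitTime w (closure R ∩ Icc 0 K) ≠ ⊤ →
      (fun t => w ((hitTime w (closure R ∩ Icc 0 K)).toNNReal + t)) ∉ nonOscillating) :
    discountedPayoff (put K) r R w ≤ discountedPayoff (put K) r (closure R ∩ Icc 0 K) w := by
  set C := closure R ∩ Icc 0 K
  have hC : IsClosed C := isClosed_closure.inter isClosed_Icc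
  by_cases hR : hitTime w R = ⊤
  · rw [discountedPayoff_of_top hR]
    exact discountedPayoff_nonneg (put_nonneg K) _ _ _
  obtain ⟨s, hs, hlim⟩ := exists_seq_tendsto_hitTime hR
  set T := (hitTime w R).toNNReal with hT
  have hT' : hitTime w R = T := (ENNReal.coe_toNNReal hR).symm
  have hwlim := (hw.tendsto T).comp hlim
  -- Stopping at or above `K` pays nothing, so only `w T < K` matters; then `C` is hit no later than
  -- `R`.
  rcases le_or_gt K (w T) with hK | hK
  · rw [discountedPayoff_of_ne_top hR, ← hT, put_of_ge hK, mul_zero]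
    exact discountedPayoff_nonneg (put_nonneg K) _ _ _
  have hle : hitTime w C ≤ T := by
    refine ge_of_tendsto (ENNReal.tendsto_coe.2 hlim) ?_
    filter_upwards [hwlim.eventually (gt_mem_nhds hK)] with n hn
    exact hitTime_le (hs n).1 ⟨subset_closure (hs n).2, zero_le, hn.le⟩
  have hCtop : hitTime w C ≠ ⊤ := (hle.trans_lt ENNReal.coe_lt_top).ne
  have hmem := apply_hitTime_mem hw hC hCtop
  set S := (hitTime w C).toNNReal with hS
  have hS' : hitTime w C = S := (ENNReal.coe_toNNReal hCtop).symm
  have hST : S ≤ T := by rwa [hS', ENNReal.coe_le_coe] at hle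
  -- Oscillation is unavailable at `0`, but there the payoff has its maximal value `K` and is
  -- collected no later.
  rcases eq_or_ne (w S) 0 with h0 | h0
  · rw [discountedPayoff_of_ne_top hR, discountedPayoff_of_ne_top hCtop, ← hT, ← hS, h0, hT', hS']
    refine mul_le_mul (Real.exp_le_exp.2 ?_) ?_ (put_nonneg _ _) (Real.exp_pos _).le
    · simp only [ENNReal.coe_toReal, neg_mul]
      exact neg_le_neg (mul_le_mul_of_nonneg_left (NNReal.coe_le_coe.2 hST) r.2)
    · rw [put_of_le zero_le]
      simpa using put_le K (w T)
  -- Oscillating around a point of `closure R` after time `S`, the path visits `R` immediately, so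
  -- both hitting times coincide.
  · have hTS : T ≤ S := by
      refine le_of_forall_pos_le_add fun ε hε => ?_
      obtain ⟨u, hu0, hu, huR⟩ := exists_mem_of_oscillating (R := R)
        (hw.comp (by fun_prop : Continuous fun t => S + t))
        (by simpa using pos_iff_ne_zero.2 h0) (h hCtop) (by simpa using hmem.1) hε
      have := hitTime_le (add_pos_of_nonneg_of_pos zero_le hu0) huR
      rw [hT', ENNReal.coe_le_coe] at this
      exact this.trans (by gcongr)
    have : S = T := le_antisymm hST hTS
    rw [discountedPayoff_of_ne_top hR, discountedPayoff_of_ne_top hCtop, ← hT, ← hS, hT', hS', this]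

/-- The expected discounted payoff of stopping when the process started at `x` hits `R`. -/
noncomputable def expectedPayoff (K r x : ℝ≥0) (R : Set ℝ≥0) : ℝ :=
  ∫ ω, discountedPayoff (put K) r R (D.path x ω) ∂D.P

theorem integrable_discountedPayoff {g : ℝ≥0 → ℝ} (hg : Measurable g) (h0 : ∀ x, 0 ≤ g x) {c : ℝ}
    (hc : ∀ x, g x ≤ c) (r x : ℝ≥0) {C : Set ℝ≥0} (hC : IsClosed C) :
    Integrable (fun ω => discountedPayoff g r C (D.path x ω)) D.P := by
  refine Integrable.of_bound (measurable_discountedPayoff (D.measurable_X x) (D.continuous_path x)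
    hC hg r).aestronglyMeasurable c (Eventually.of_forall fun ω => ?_)
  rw [Real.norm_of_nonneg (discountedPayoff_nonneg h0 _ _ _)]
  exact discountedPayoff_le h0 hc _ _ _

theorem expectedPayoff_le (K r x : ℝ≥0) (R : Set ℝ≥0) : D.expectedPayoff K r x R ≤ K := by
  have h := integral_mono_of_nonneg (μ := D.P)
    (f := fun ω => discountedPayoff (put K) r R (D.path x ω)) (g := fun _ => (K : ℝ))
    (Eventually.of_forall fun ω => discountedPayoff_nonneg (put_nonneg K) _ _ _)
    (integrable_const _)
    (Eventually.of_forall fun ω => discountedPayoff_le (put_nonneg K) (put_le K) _ _ _)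
  simpa [expectedPayoff] using h

theorem expectedPayoff_anti (K x : ℝ≥0) {C : Set ℝ≥0} (hC : IsClosed C) :
    Antitone fun r => D.expectedPayoff K r x C := fun _ _ hrs =>
  integral_mono (D.integrable_discountedPayoff (measurable_put K) (put_nonneg K) (put_le K) _ x hC)
    (D.integrable_discountedPayoff (measurable_put K) (put_nonneg K) (put_le K) _ x hC)
    fun _ => discountedPayoff_anti (put_nonneg K) _ _ hrs

theorem expectedPayoff_le_closure (K r x : ℝ≥0) (R : Set ℝ≥0) :
    D.expectedPayoff K r x R ≤ D.expectedPayoff K r x (closure R ∩ Icc 0 K) := by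
  have hC : IsClosed (closure R ∩ Icc 0 K) := isClosed_closure.inter isClosed_Icc
  refine integral_mono_of_nonneg
    (Eventually.of_forall fun ω => discountedPayoff_nonneg (put_nonneg K) _ _ _)
    (D.integrable_discountedPayoff (measurable_put K) (put_nonneg K) (put_le K) _ x hC) ?_
  filter_upwards [D.ae_oscillating_after_hitTime x hC] with ω hω
  exact discountedPayoff_le_closure (D.continuous_path' x ω) K r R hω

/-- From an interior point the path oscillates immediately and returns to its starting point at
arbitrarily small positive times, so the hitting time vanishes almost surely. -/
theorem expectedPayoff_of_mem (K r : ℝ≥0) {x : ℝ≥0} (hx : 0 < x) {C : Set ℝ≥0} (hC : x ∈ C) :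
    D.expectedPayoff K r x C = put K x := by
  have h : ∀ᵐ ω ∂D.P, discountedPayoff (put K) r C (D.path x ω) = put K x := by
    filter_upwards [D.ae_immediatelyVisits_Iio hx, D.ae_immediatelyVisits_Ioi hx] with ω h1 h2
    have h0 : hitTime (D.path x ω) C = 0 := by
      refine le_antisymm (le_of_forall_gt fun ε hε => ?_) zero_le
      obtain ⟨δ, hδ0, hδ⟩ := ENNReal.lt_iff_exists_nnreal_btwn.1 hε
      obtain ⟨u, hu0, hu, huC⟩ := exists_mem_of_oscillating (R := C) (D.continuous_path' x ω)
        (by simpa using hx) (fun h => by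
          rw [mem_nonOscillating_iff, path_zero] at h
          exact h.2 ⟨h1, h2⟩) (by simpa using subset_closure hC) (by exact_mod_cast hδ0 : 0 < δ)
      exact (hitTime_le hu0 huC).trans_lt ((ENNReal.coe_lt_coe.2 hu).trans hδ)
    rw [discountedPayoff_of_ne_top (by simp [h0]), h0]
    simp
  rw [expectedPayoff, integral_congr_ae h]
  simp

end RegularDiffusion

/-! ### Equilibria as inequalities off the stopping set -/

section Equilibria

variable {Ω : Type*} [MeasurableSpace Ω] {D : RegularDiffusion Ω} {F : Measure ℝ≥0}
  [IsProbabilityMeasure F] {φ : ℝ → ℝ} {K : ℝ≥0}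

theorem J_eq (D : RegularDiffusion Ω) (F : Measure ℝ≥0) (φ : ℝ → ℝ) (K x : ℝ≥0) (R : Set ℝ≥0) :
    J D F φ K x R = erealIntegral F fun r => extendPhi φ (D.expectedPayoff K r x R) := rfl

omit [IsProbabilityMeasure F] in
theorem J_le_closure (hφ : StrictMonoOn φ (Ioi 0)) (x : ℝ≥0) (R : Set ℝ≥0) :
    J D F φ K x R ≤ J D F φ K x (closure R ∩ Icc 0 K) :=
  erealIntegral_mono F fun r => extendPhi_mono hφ (D.expectedPayoff_le_closure K r x R)

theorem extendPhi_zero_le_J (x : ℝ≥0) (R : Set ℝ≥0) : extendPhi φ 0 ≤ J D F φ K x R := by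
  rw [← erealIntegral_const F (extendPhi φ 0)]
  exact erealIntegral_mono F fun r => extendPhi_zero_le (D.expectedPayoff K r x R)

theorem J_le (hφ : StrictMonoOn φ (Ioi 0)) (x : ℝ≥0) (R : Set ℝ≥0) :
    J D F φ K x R ≤ extendPhi φ K := by
  rw [← erealIntegral_const F (extendPhi φ K)]
  exact erealIntegral_mono F fun r => extendPhi_mono hφ (D.expectedPayoff_le K r x R)

/-- At interior points stopping is immediate and equality holds. At `0` an immediate return is not
guaranteed, but no payoff exceeds `g 0 = K`. -/
theorem J_le_of_mem (hφ : StrictMonoOn φ (Ioi 0)) {x : ℝ≥0} {R : Set ℝ≥0} (hx : x ∈ R) :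
    J D F φ K x R ≤ extendPhi φ (put K x) := by
  rcases eq_or_ne x 0 with rfl | h
  · rw [put_of_le zero_le]
    simpa using J_le hφ 0 R
  · rw [J_eq]
    simp only [D.expectedPayoff_of_mem K _ (pos_iff_ne_zero.2 h) hx, erealIntegral_const, le_refl]

/-- On `R` the payoff of waiting never exceeds that of stopping, so points of `R` always stay in
`Θ(R)`. At `x ≥ K` stopping yields the minimal value `φ(0)`, so no strict incentive to stop can
arise there. -/
theorem isEquilibrium_iff (hφ : StrictMonoOn φ (Ioi 0)) {R : Set ℝ≥0} (hR : MeasurableSet R) :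
    IsEquilibrium D F φ K R ↔ ∀ x ∉ R, x < K → extendPhi φ (put K x) ≤ J D F φ K x R := by
  simp only [IsEquilibrium, hR, true_and]
  constructor
  · intro h x hx _
    by_contra hlt
    exact hx (h ▸ Or.inl (not_le.1 hlt))
  · intro h
    refine Subset.antisymm ?_ fun x hx => ?_
    · rintro x (hx | hx)
      · by_contra hxR
        rcases lt_or_ge x K with hK | hK
        · exact absurd (h x hxR hK) (not_le.2 hx)
        · have h1 : J D F φ K x R < extendPhi φ (put K x) := hx
          rw [put_of_ge hK] at h1
          exact absurd (extendPhi_zero_le_J x R) (not_le.2 h1)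
      · exact hx.2
    · rcases (J_le_of_mem (D := D) (F := F) (K := K) hφ hx).lt_or_eq with h1 | h1
      · exact Or.inl h1
      · exact Or.inr ⟨h1.symm, hx⟩

/-- The enlargement below `K` leaves fewer points to test, and the payoff of waiting at those points
does not decrease. -/
theorem IsEquilibrium.closure_inter (hφ : StrictMonoOn φ (Ioi 0)) {R : Set ℝ≥0}
    (h : IsEquilibrium D F φ K R) : IsEquilibrium D F φ K (closure R ∩ Icc 0 K) := by
  rw [isEquilibrium_iff hφ (isClosed_closure.inter isClosed_Icc).measurableSet]
  intro x hx hxK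
  have hxR : x ∉ R := fun h => hx ⟨subset_closure h, zero_le, hxK.le⟩
  exact ((isEquilibrium_iff hφ h.1).1 h x hxR hxK).trans (J_le_closure hφ x R)

theorem isEquilibrium_Icc_of_le (hφ : StrictMonoOn φ (Ioi 0)) {a : ℝ≥0} (ha : K ≤ a) :
    IsEquilibrium D F φ K (Icc 0 a) := by
  rw [isEquilibrium_iff hφ measurableSet_Icc]
  intro x hx hxK
  exact absurd ⟨zero_le, hxK.le.trans ha⟩ hx

end Equilibria

/-! ### Discount factors and hitting times of levels -/

/-- The discount factor `e^{-r T}`, zero for `T = ∞`. -/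
noncomputable def discount (r : ℝ≥0) (T : ℝ≥0∞) : ℝ :=
  if T = ⊤ then 0 else Real.exp (-(r : ℝ) * T.toReal)

theorem discountedPayoff_one (r : ℝ≥0) (R : Set ℝ≥0) (w : ℝ≥0 → ℝ≥0) :
    discountedPayoff (fun _ => 1) r R w = discount r (hitTime w R) := by
  unfold discountedPayoff discount
  split_ifs <;> simp

@[simp] theorem discount_top (r : ℝ≥0) : discount r ⊤ = 0 := if_pos rfl

theorem discount_of_ne_top (r : ℝ≥0) {T : ℝ≥0∞} (h : T ≠ ⊤) :
    discount r T = Real.exp (-(r : ℝ) * T.toReal) := if_neg h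

theorem discount_nonneg (r : ℝ≥0) (T : ℝ≥0∞) : 0 ≤ discount r T := by
  unfold discount
  split_ifs
  · exact le_rfl
  · exact (Real.exp_pos _).le

theorem discount_pos (r : ℝ≥0) {T : ℝ≥0∞} (h : T ≠ ⊤) : 0 < discount r T := by
  rw [discount_of_ne_top r h]
  exact Real.exp_pos _

theorem discount_le_one (r : ℝ≥0) (T : ℝ≥0∞) : discount r T ≤ 1 := by
  unfold discount
  split_ifs
  · exact zero_le_one
  · rw [Real.exp_le_one_iff, neg_mul]
    exact neg_nonpos.2 (mul_nonneg r.2 ENNReal.toReal_nonneg)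

theorem discount_anti (T : ℝ≥0∞) : Antitone fun r => discount r T := by
  intro r s hrs
  by_cases h : T = ⊤
  · simp [h]
  · simp only [discount_of_ne_top _ h]
    refine Real.exp_le_exp.2 ?_
    have := mul_le_mul_of_nonneg_right (NNReal.coe_le_coe.2 hrs) (ENNReal.toReal_nonneg (a := T))
    linarith

theorem measurable_discount (r : ℝ≥0) : Measurable (discount r) :=
  Measurable.ite (measurableSet_singleton ⊤) measurable_const
    (Real.measurable_exp.comp (ENNReal.measurable_toReal.const_mul _))

theorem discount_add (r : ℝ≥0) (S T : ℝ≥0∞) :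
    discount r (S + T) = discount r S * discount r T := by
  by_cases hS : S = ⊤
  · simp [hS]
  by_cases hT : T = ⊤
  · simp [hT]
  rw [discount_of_ne_top r hS, discount_of_ne_top r hT,
    discount_of_ne_top r (ENNReal.add_ne_top.2 ⟨hS, hT⟩), ENNReal.toReal_add hS hT,
    ← Real.exp_add]
  congr 1
  ring

/-- Positivity of `r` matters: at `r = 0` the factor jumps from `1` to `0` at `T = ⊤`. -/
theorem tendsto_discount {r : ℝ≥0} (hr : 0 < r) {T : ℕ → ℝ≥0∞} {S : ℝ≥0∞}
    (h : Tendsto T atTop (𝓝 S)) : Tendsto (fun n => discount r (T n)) atTop (𝓝 (discount r S)) := by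
  have hr' : (0 : ℝ) < r := hr
  by_cases hS : S = ⊤
  · rw [hS, discount_top]
    rw [hS] at h
    rw [Metric.tendsto_atTop]
    intro ε hε
    have hlim : Tendsto (fun M : ℝ => Real.exp (-(r : ℝ) * M)) atTop (𝓝 0) :=
      Real.tendsto_exp_atBot.comp (tendsto_id.const_mul_atTop_of_neg (by linarith))
    obtain ⟨M, hM, hM0⟩ := ((hlim.eventually (gt_mem_nhds hε)).and (eventually_ge_atTop 0)).exists
    obtain ⟨N, hN⟩ := eventually_atTop.1 (ENNReal.tendsto_nhds_top_iff_nnreal.1 h ⟨M, hM0⟩)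
    refine ⟨N, fun n hn => ?_⟩
    rw [Real.dist_eq, sub_zero, abs_of_nonneg (discount_nonneg _ _)]
    refine lt_of_le_of_lt ?_ hM
    by_cases hT : T n = ⊤
    · rw [hT, discount_top]
      exact (Real.exp_pos _).le
    · rw [discount_of_ne_top _ hT]
      refine Real.exp_le_exp.2 ?_
      have h1 : M ≤ (T n).toReal := by
        have := (ENNReal.toReal_le_toReal ENNReal.coe_ne_top hT).2 (hN n hn).le
        exact this
      nlinarith
  · have hev : ∀ᶠ n in atTop, T n ≠ ⊤ := h.eventually_ne hS
    rw [discount_of_ne_top _ hS]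
    have h1 : Tendsto (fun n => Real.exp (-(r : ℝ) * (T n).toReal)) atTop
        (𝓝 (Real.exp (-(r : ℝ) * S.toReal))) :=
      (Real.continuous_exp.tendsto _).comp (((ENNReal.tendsto_toReal hS).comp h).const_mul _)
    refine h1.congr' ?_
    filter_upwards [hev] with n hn
    rw [discount_of_ne_top _ hn]

theorem tendsto_discount_rate (T : ℝ≥0∞) {r : ℕ → ℝ≥0} {s : ℝ≥0} (h : Tendsto r atTop (𝓝 s)) :
    Tendsto (fun n => discount (r n) T) atTop (𝓝 (discount s T)) := by
  by_cases hT : T = ⊤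
  · simp [hT]
  · simp only [discount_of_ne_top _ hT]
    exact (Real.continuous_exp.tendsto _).comp (((NNReal.tendsto_coe.2 h).neg).mul_const _)

open Classical in
/-- A functional of the whole path space, measurable for the product `σ`-algebra, that agrees with
the hitting time of a closed set on continuous paths. -/
noncomputable def hitTimeModification (C : Set ℝ≥0) (w : ℝ≥0 → ℝ≥0) : ℝ≥0∞ :=
  ⨅ k : ℕ, if w ∈ hitsBefore C (TopologicalSpace.denseSeq ℝ≥0 k) then
    (TopologicalSpace.denseSeq ℝ≥0 k : ℝ≥0∞) else ⊤

theorem measurable_hitTimeModification (C : Set ℝ≥0) : Measurable (hitTimeModification C) :=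
  Measurable.iInf fun _ =>
    Measurable.ite (measurableSet_hitsBefore C _) measurable_const measurable_const

theorem hitTimeModification_eq {C : Set ℝ≥0} (hC : IsClosed C) {w : ℝ≥0 → ℝ≥0}
    (hw : Continuous w) : hitTimeModification C w = hitTime w C := by
  refine le_antisymm (le_of_forall_gt fun c hc => ?_) (le_iInf fun k => ?_)
  · obtain ⟨p, hp, hpc⟩ := ENNReal.lt_iff_exists_nnreal_btwn.1 hc
    have hopen : IsOpen {q : ℝ≥0 | hitTime w C < q ∧ (q : ℝ≥0∞) < c} :=
      (isOpen_lt continuous_const ENNReal.continuous_coe).inter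
        (isOpen_lt ENNReal.continuous_coe continuous_const)
    obtain ⟨k, hk, hkc⟩ := (TopologicalSpace.denseRange_denseSeq ℝ≥0).exists_mem_open hopen
      ⟨p, hp, hpc⟩
    refine (iInf_le _ k).trans_lt ?_
    rwa [if_pos ((mem_hitsBefore_iff hw hC).2 hk)]
  · split_ifs with h
    · exact ((mem_hitsBefore_iff hw hC).1 h).le
    · exact le_top

theorem exists_apply_eq_of_lt {w : ℝ≥0 → ℝ≥0} (hw : Continuous w) {b s : ℝ≥0} (h0 : b < w 0)
    (hs : w s ≤ b) : ∃ u, 0 < u ∧ u ≤ s ∧ w u = b := by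
  obtain ⟨u, hu, hub⟩ := intermediate_value_Icc' (zero_le : 0 ≤ s) hw.continuousOn ⟨hs, h0.le⟩
  refine ⟨u, pos_iff_ne_zero.2 ?_, hu.2, hub⟩
  rintro rfl
  exact h0.ne hub.symm

/-- A continuous path started above `b` passes through `b` on its way down to `a`. -/
theorem hitTime_singleton_eq_add {w : ℝ≥0 → ℝ≥0} (hw : Continuous w) {a b : ℝ≥0} (hab : a < b)
    (hb : b < w 0) (hT : hitTime w {b} ≠ ⊤) : hitTime w {a} =
      hitTime w {b} + hitTime (fun t => w ((hitTime w {b}).toNNReal + t)) {a} := by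
  set T := (hitTime w {b}).toNNReal
  have hT' : hitTime w {b} = T := (ENNReal.coe_toNNReal hT).symm
  have hwT : w T = b := apply_hitTime_mem hw isClosed_singleton hT
  rw [hT']
  refine le_antisymm ?_ (le_hitTime fun s h0 hs => ?_)
  · rw [← tsub_le_iff_left]
    refine le_hitTime fun u hu hua => ?_
    rw [tsub_le_iff_left]
    exact_mod_cast hitTime_le (add_pos_of_nonneg_of_pos zero_le hu) hua
  · obtain ⟨u, hu0, hus, hub⟩ := exists_apply_eq_of_lt hw hb
      (((mem_singleton_iff.1 hs).trans_le hab.le) : w s ≤ b)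
    have hTu : T ≤ u := by
      have := hitTime_le (R := {b}) hu0 hub
      rwa [hT', ENNReal.coe_le_coe] at this
    have hTs : T < s := by
      refine lt_of_le_of_ne (hTu.trans hus) fun h => ?_
      rw [← h, hwT] at hs
      exact hab.ne' hs
    have h1 : hitTime (fun t => w (T + t)) {a} ≤ ((s - T : ℝ≥0) : ℝ≥0∞) :=
      hitTime_le (tsub_pos_of_lt hTs) (by simpa [add_tsub_cancel_of_le hTs.le] using hs)
    calc (T : ℝ≥0∞) + hitTime (fun t => w (T + t)) {a} ≤ T + ((s - T : ℝ≥0) : ℝ≥0∞) := by gcongr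
      _ = s := by rw [← ENNReal.coe_add, add_tsub_cancel_of_le hTs.le]

theorem hitTime_singleton_mono {w : ℝ≥0 → ℝ≥0} (hw : Continuous w) {a b : ℝ≥0} (hab : a ≤ b)
    (hb : b < w 0) : hitTime w {b} ≤ hitTime w {a} :=
  le_hitTime fun s _ hs => by
    obtain ⟨u, hu0, hus, hub⟩ := exists_apply_eq_of_lt hw hb
      (((mem_singleton_iff.1 hs).trans_le hab) : w s ≤ b)
    exact (hitTime_le hu0 hub).trans (ENNReal.coe_le_coe.2 hus)

theorem hitTime_Icc {w : ℝ≥0 → ℝ≥0} (hw : Continuous w) {a : ℝ≥0} (ha : a < w 0) :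
    hitTime w (Icc 0 a) = hitTime w {a} := by
  refine le_antisymm (hitTime_anti w (by simp)) (le_hitTime fun s _ hs => ?_)
  obtain ⟨u, hu0, hus, hub⟩ := exists_apply_eq_of_lt hw ha hs.2
  exact (hitTime_le hu0 hub).trans (ENNReal.coe_le_coe.2 hus)

/-- Hitting times of lower levels depend left-continuously on the level. -/
theorem tendsto_hitTime_singleton {w : ℝ≥0 → ℝ≥0} (hw : Continuous w) {a : ℝ≥0} {u : ℕ → ℝ≥0}
    (hu : Antitone u) (hua : ∀ n, a ≤ u n) (huw : ∀ n, u n < w 0) (hlim : Tendsto u atTop (𝓝 a)) :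
    Tendsto (fun n => hitTime w {u n}) atTop (𝓝 (hitTime w {a})) := by
  have hmono : Monotone fun n => hitTime w {u n} := fun m n hmn =>
    hitTime_singleton_mono hw (hu hmn) (huw m)
  have ht := tendsto_atTop_iSup hmono
  suffices h : ⨆ n, hitTime w {u n} = hitTime w {a} by rwa [h] at ht
  refine le_antisymm (iSup_le fun n => hitTime_singleton_mono hw (hua n) (huw n)) ?_
  set S := ⨆ n, hitTime w {u n} with hS
  by_cases hT : S = ⊤
  · rw [hT]
    exact le_top
  have hne : ∀ n, hitTime w {u n} ≠ ⊤ := fun n =>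
    ((le_iSup (fun n => hitTime w {u n}) n).trans_lt (lt_top_iff_ne_top.2 hT)).ne
  have hwu : ∀ n, w (hitTime w {u n}).toNNReal = u n := fun n =>
    apply_hitTime_mem hw isClosed_singleton (hne n)
  have h1 : Tendsto (fun n => w (hitTime w {u n}).toNNReal) atTop (𝓝 (w S.toNNReal)) :=
    (hw.tendsto _).comp ((ENNReal.tendsto_toNNReal hT).comp ht)
  simp only [hwu] at h1
  have hwS : w S.toNNReal = a := tendsto_nhds_unique h1 hlim
  -- `hitTime` counts only positive times. Here `S = 0` is impossible because the path starts
  -- strictly above `a`.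
  have h0 : 0 < S.toNNReal := by
    rw [pos_iff_ne_zero]
    intro h
    rw [h] at hwS
    exact absurd (hwS ▸ (hua 0).trans_lt (huw 0)) (lt_irrefl _)
  rw [← ENNReal.coe_toNNReal hT]
  exact hitTime_le h0 hwS

/-! ### Laplace transforms of hitting times of levels -/

namespace RegularDiffusion

variable {Ω : Type*} [MeasurableSpace Ω] (D : RegularDiffusion Ω)

theorem hitLaplace_eq (r a x : ℝ≥0) :
    hitLaplace D r a x = ∫ ω, discount r (hitTime (D.path x ω) {a}) ∂D.P := by
  simp only [← discountedPayoff_one]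
  rfl

theorem integrable_discount (r x : ℝ≥0) {C : Set ℝ≥0} (hC : IsClosed C) :
    Integrable (fun ω => discount r (hitTime (D.path x ω) C)) D.P := by
  refine Integrable.of_bound
    ((measurable_discount r).comp (D.measurable_hitTime hC x)).aestronglyMeasurable 1
    (Eventually.of_forall fun ω => ?_)
  rw [Real.norm_of_nonneg (discount_nonneg _ _)]
  exact discount_le_one _ _

/-- By the strong Markov property, the Laplace transforms of the hitting times multiply. -/
theorem hitLaplace_mul (r : ℝ≥0) {a b x : ℝ≥0} (hab : a < b) (hbx : b < x) :
    hitLaplace D r a x = hitLaplace D r b x * hitLaplace D r a b := by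
  set A : Set Ω := {ω | hitTime (D.path x ω) {b} ≠ ⊤}
  have hτ : Measurable fun ω => hitTime (D.path x ω) {b} :=
    D.measurable_hitTime isClosed_singleton x
  have hA : MeasurableSet A := (hτ (measurableSet_singleton ⊤)).compl
  set θ : Ω → ℝ≥0 → ℝ≥0 := fun ω t => D.path x ω ((hitTime (D.path x ω) {b}).toNNReal + t)
  have hθ : Measurable θ := measurable_pi_lambda _ fun t =>
    measurable_apply_random_time (D.measurable_X x) (D.continuous_path x)
      (hτ.ennreal_toNNReal.add_const t)
  have hG := measurable_hitTimeModification {a}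
  have hGb : Measurable fun ω => hitTimeModification {a} (D.path b ω) :=
    hG.comp (D.measurable_path b)
  have hp : Measurable fun ω => (hitTime (D.path x ω) {b}, hitTimeModification {a} (θ ω)) :=
    hτ.prodMk (hG.comp hθ)
  have hd : Measurable fun p : ℝ≥0∞ × ℝ≥0∞ => discount r p.1 * discount r p.2 :=
    ((measurable_discount r).comp measurable_fst).mul ((measurable_discount r).comp measurable_snd)
  -- On `A` the path restarts from the fixed point `b`, so the time to reach `b` and the further
  -- time to reach `a` have a product law. The strong Markov property needs events of the product
  -- `σ`-algebra, whence the measurable modification.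
  have hlaw : ((D.P.restrict A).map fun ω => hitTime (D.path x ω) {b}).prod
      (D.P.map fun ω => hitTimeModification {a} (D.path b ω)) =
      (D.P.restrict A).map fun ω => (hitTime (D.path x ω) {b}, hitTimeModification {a} (θ ω)) := by
    refine Measure.prod_eq fun s t hs ht => ?_
    rw [Measure.map_apply hp (hs.prod ht), Measure.map_apply hτ hs,
      Measure.map_apply hGb ht, Measure.restrict_apply (hp (hs.prod ht)),
      Measure.restrict_apply (hτ hs)]
    have h := D.strongMarkov_hitTime x (Or.inl (isClosed_singleton (x := b))) hs (hG ht)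
    have hm : MeasurableSet {ω | hitTime (D.path x ω) {b} ∈ s ∧ hitTime (D.path x ω) {b} ≠ ⊤} :=
      (hτ hs).inter hA
    rw [setLIntegral_congr_fun hm
      (g := fun _ => D.P {ω' | D.path b ω' ∈ hitTimeModification {a} ⁻¹' t}) fun ω hω => by
        have : D.path x ω (hitTime (D.path x ω) {b}).toNNReal = b :=
          apply_hitTime_mem (D.continuous_path' x ω) isClosed_singleton hω.2
        simp only [this], setLIntegral_const, mul_comm] at h
    refine Eq.trans (congrArg D.P ?_) h
    ext ω
    simp only [mem_inter_iff, mem_preimage, mem_prod, mem_ofPred_eq, A, θ]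
    tauto
  have hlhs : hitLaplace D r a x = ∫ p, discount r p.1 * discount r p.2
      ∂((D.P.restrict A).map fun ω => (hitTime (D.path x ω) {b}, hitTimeModification {a} (θ ω))) := by
    rw [integral_map hp.aemeasurable hd.aestronglyMeasurable, hitLaplace_eq,
      ← setIntegral_eq_integral_of_forall_compl_eq_zero (s := A)]
    · refine setIntegral_congr_fun hA fun ω hω => ?_
      have hc := D.continuous_path' x ω
      have hcθ : Continuous (θ ω) := hc.comp (continuous_const.add continuous_id)
      simp only
      rw [hitTimeModification_eq isClosed_singleton hcθ, ← discount_add,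
        hitTime_singleton_eq_add hc hab (by simpa using hbx) hω]
    · intro ω hω
      have h1 : hitTime (D.path x ω) {b} = ⊤ := not_not.1 hω
      have h2 := hitTime_singleton_mono (D.continuous_path' x ω) hab.le (by simpa using hbx)
      rw [h1, top_le_iff] at h2
      rw [h2, discount_top]
  rw [hlhs, ← hlaw, integral_prod_mul, integral_map hτ.aemeasurable
    (measurable_discount r).aestronglyMeasurable, integral_map hGb.aemeasurable
    (measurable_discount r).aestronglyMeasurable, hitLaplace_eq, hitLaplace_eq]
  congr 1
  · refine setIntegral_eq_integral_of_forall_compl_eq_zero fun ω hω => ?_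
    have h1 : hitTime (D.path x ω) {b} = ⊤ := not_not.1 hω
    rw [h1, discount_top]
  · refine integral_congr_ae (Eventually.of_forall fun ω => ?_)
    simp only [hitTimeModification_eq isClosed_singleton (D.continuous_path' b ω)]

theorem hitLaplace_nonneg (r a x : ℝ≥0) : 0 ≤ hitLaplace D r a x := by
  rw [hitLaplace_eq]
  exact integral_nonneg fun _ => discount_nonneg _ _

theorem hitLaplace_le_one (r a x : ℝ≥0) : hitLaplace D r a x ≤ 1 := by
  rw [hitLaplace_eq]
  have := integral_mono (D.integrable_discount r x (isClosed_singleton (x := a)))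
    (integrable_const (1 : ℝ)) fun ω => discount_le_one _ _
  simpa using this

theorem hitLaplace_anti (a x : ℝ≥0) : Antitone fun r => hitLaplace D r a x := by
  intro r s hrs
  simp only [hitLaplace_eq]
  exact integral_mono (D.integrable_discount s x isClosed_singleton)
    (D.integrable_discount r x isClosed_singleton) fun ω => discount_anti _ hrs

theorem hitLaplace_pos_iff (r a x : ℝ≥0) :
    0 < hitLaplace D r a x ↔ 0 < D.P {ω | hitTime (D.path x ω) {a} ≠ ⊤} := by
  rw [hitLaplace_eq, integral_pos_iff_support_of_nonneg (fun ω => discount_nonneg _ _)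
    (D.integrable_discount r x isClosed_singleton)]
  have : Function.support (fun ω => discount r (hitTime (D.path x ω) {a})) =
      {ω | hitTime (D.path x ω) {a} ≠ ⊤} := by
    ext ω
    simp only [Function.mem_support, mem_ofPred_eq]
    constructor
    · intro h h'
      rw [h', discount_top] at h
      exact h rfl
    · intro h
      exact (discount_pos r h).ne'
  rw [this]

theorem hitLaplace_pos (r : ℝ≥0) {a x : ℝ≥0} (ha : 0 < a) (hax : a < x) :
    0 < hitLaplace D r a x :=
  (D.hitLaplace_pos_iff r a x).2 (D.hitTime_ne_top_pos (ha.trans hax) ha hax.ne' rfl)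

/-- The point `a` is reached with positive probability from every point above it. -/
def Accessible (a : ℝ≥0) : Prop := ∀ x, a < x → 0 < hitLaplace D 0 a x

theorem accessible_of_pos {a : ℝ≥0} (ha : 0 < a) : D.Accessible a := fun _ hx =>
  D.hitLaplace_pos 0 ha hx

variable {D} in
theorem Accessible.pos {a x : ℝ≥0} (h : D.Accessible a) (hx : a < x) (r : ℝ≥0) :
    0 < hitLaplace D r a x :=
  (D.hitLaplace_pos_iff r a x).2 ((D.hitLaplace_pos_iff 0 a x).1 (h x hx))

theorem tendsto_hitLaplace_rate (a x : ℝ≥0) {r : ℕ → ℝ≥0} {s : ℝ≥0} (h : Tendsto r atTop (𝓝 s)) :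
    Tendsto (fun n => hitLaplace D (r n) a x) atTop (𝓝 (hitLaplace D s a x)) := by
  simp only [hitLaplace_eq]
  refine tendsto_integral_of_dominated_convergence (fun _ => 1)
    (fun n => (D.integrable_discount _ x isClosed_singleton).aestronglyMeasurable)
    (integrable_const _) (fun n => Eventually.of_forall fun ω => ?_)
    (Eventually.of_forall fun ω => tendsto_discount_rate _ h)
  rw [Real.norm_of_nonneg (discount_nonneg _ _)]
  exact discount_le_one _ _

theorem tendsto_hitLaplace_level_of_pos {r : ℝ≥0} (hr : 0 < r) {a x : ℝ≥0} {u : ℕ → ℝ≥0}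
    (hu : Antitone u) (hua : ∀ n, a ≤ u n) (hux : ∀ n, u n < x) (hlim : Tendsto u atTop (𝓝 a)) :
    Tendsto (fun n => hitLaplace D r (u n) x) atTop (𝓝 (hitLaplace D r a x)) := by
  simp only [hitLaplace_eq]
  refine tendsto_integral_of_dominated_convergence (fun _ => 1)
    (fun n => (D.integrable_discount _ x isClosed_singleton).aestronglyMeasurable)
    (integrable_const _) (fun n => Eventually.of_forall fun ω => ?_)
    (Eventually.of_forall fun ω => tendsto_discount hr (tendsto_hitTime_singleton
      (D.continuous_path' x ω) hu hua (by simpa using hux) hlim))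
  rw [Real.norm_of_nonneg (discount_nonneg _ _)]
  exact discount_le_one _ _

/-- At `r = 0` dominated convergence fails where `a` is not reached although every `u n` is. The
case `r = 1` and the product formula give `hitLaplace D 1 a (u n) → 1`; since lowering the rate
increases the transform, the same holds at rate `0`, and the product formula at rate `0` concludes.
-/
theorem tendsto_hitLaplace_level (r : ℝ≥0) {a x : ℝ≥0} (ha : D.Accessible a) {u : ℕ → ℝ≥0}
    (hu : Antitone u) (hua : ∀ n, a < u n) (hux : ∀ n, u n < x) (hlim : Tendsto u atTop (𝓝 a)) :
    Tendsto (fun n => hitLaplace D r (u n) x) atTop (𝓝 (hitLaplace D r a x)) := by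
  rcases eq_or_ne r 0 with rfl | hr
  · have hax : a < x := (hua 0).trans (hux 0)
    have h1 := D.tendsto_hitLaplace_level_of_pos one_pos hu (fun n => (hua n).le) hux hlim
    have hp1 := ha.pos hax 1
    have h2 : Tendsto (fun n => hitLaplace D 1 a (u n)) atTop (𝓝 1) := by
      have h3 : Tendsto (fun n => hitLaplace D 1 a x / hitLaplace D 1 (u n) x) atTop (𝓝 1) := by
        have := (tendsto_const_nhds (x := hitLaplace D 1 a x)).div h1 hp1.ne'
        rwa [div_self hp1.ne'] at this
      refine h3.congr fun n => ?_
      rw [D.hitLaplace_mul 1 (hua n) (hux n), mul_div_cancel_left₀]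
      exact (D.hitLaplace_pos 1 (pos_of_gt (hua n)) (hux n)).ne'
    have h3 : Tendsto (fun n => hitLaplace D 0 a (u n)) atTop (𝓝 1) :=
      tendsto_of_tendsto_of_tendsto_of_le_of_le h2 tendsto_const_nhds
        (fun n => D.hitLaplace_anti a (u n) zero_le) (fun n => D.hitLaplace_le_one 0 a (u n))
    have h4 := (tendsto_const_nhds (x := hitLaplace D 0 a x)).div h3 one_ne_zero
    rw [div_one] at h4
    refine h4.congr fun n => ?_
    rw [Pi.div_apply, D.hitLaplace_mul 0 (hua n) (hux n), mul_div_cancel_right₀]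
    exact (ha _ (hua n)).ne'
  · exact D.tendsto_hitLaplace_level_of_pos (pos_iff_ne_zero.2 hr) hu (fun n => (hua n).le) hux hlim

theorem expectedPayoff_Icc (K r : ℝ≥0) {a x : ℝ≥0} (hax : a < x) :
    D.expectedPayoff K r x (Icc 0 a) = put K a * hitLaplace D r a x := by
  rw [expectedPayoff, hitLaplace_eq, ← integral_const_mul]
  refine integral_congr_ae (Eventually.of_forall fun ω => ?_)
  have hc := D.continuous_path' x ω
  have h := hitTime_Icc hc (a := a) (by simpa using hax)
  by_cases hT : hitTime (D.path x ω) {a} = ⊤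
  · simp [discountedPayoff_of_top (h.trans hT), hT]
  · have h1 : D.path x ω (hitTime (D.path x ω) {a}).toNNReal = a :=
      apply_hitTime_mem hc isClosed_singleton hT
    simp only [discountedPayoff_of_ne_top (h ▸ hT), discount_of_ne_top _ hT, h, h1, mul_comm]

end RegularDiffusion

/-! ### Equilibrium of `[0, a]` is equivalent to the smooth-fit inequality -/

section Core

variable {Ω : Type*} [MeasurableSpace Ω] {D : RegularDiffusion Ω} {F : Measure ℝ≥0} {φ : ℝ → ℝ}
  {K : ℝ≥0}

/-- The logarithm of the Laplace transform of the hitting time of `a` from `x`. -/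
noncomputable def logHit (D : RegularDiffusion Ω) (r a x : ℝ≥0) : ℝ := Real.log (hitLaplace D r a x)

theorem logHit_nonpos (r a x : ℝ≥0) : logHit D r a x ≤ 0 :=
  Real.log_nonpos (D.hitLaplace_nonneg r a x) (D.hitLaplace_le_one r a x)

theorem exp_logHit {a x : ℝ≥0} (ha : D.Accessible a) (hx : a < x) (r : ℝ≥0) :
    Real.exp (logHit D r a x) = hitLaplace D r a x := Real.exp_log (ha.pos hx r)

theorem logHit_add {a b x : ℝ≥0} (ha : D.Accessible a) (hab : a < b) (hbx : b < x) (r : ℝ≥0) :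
    logHit D r a x = logHit D r b x + logHit D r a b := by
  rw [logHit, D.hitLaplace_mul r hab hbx, Real.log_mul]
  · rfl
  · exact (D.hitLaplace_pos r (pos_of_gt hab) hbx).ne'
  · exact (ha.pos hab r).ne'

theorem measurable_logHit (a x : ℝ≥0) : Measurable fun r => logHit D r a x :=
  Real.measurable_log.comp (D.hitLaplace_anti a x).measurable

theorem logHit_anti {a x : ℝ≥0} (ha : D.Accessible a) (hx : a < x) :
    Antitone fun r => logHit D r a x := fun _ s hrs =>
  Real.log_le_log (ha.pos hx s) (D.hitLaplace_anti a x hrs)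

theorem tendsto_logHit (r : ℝ≥0) {a x : ℝ≥0} (ha : D.Accessible a) {u : ℕ → ℝ≥0}
    (hu : Antitone u) (hua : ∀ n, a < u n) (hux : ∀ n, u n < x) (hlim : Tendsto u atTop (𝓝 a)) :
    Tendsto (fun n => logHit D r (u n) x) atTop (𝓝 (logHit D r a x)) :=
  (D.tendsto_hitLaplace_level r ha hu hua hux hlim).log (ha.pos ((hua 0).trans (hux 0)) r).ne'

/-- Convexity on `(0, K)` of the logarithm of the decreasing `r`-harmonic function, in terms of
slopes. -/
def LogConvex (D : RegularDiffusion Ω) (K : ℝ≥0) : Prop :=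
  ∀ r a b x : ℝ≥0, 0 < a → a < b → b < x → x < K →
    logHit D r a b * ((x : ℝ) - b) ≤ logHit D r b x * ((b : ℝ) - a)

/-- A sequence of levels decreasing to `a` inside `(a, x)`. -/
noncomputable def levels (a x : ℝ≥0) (n : ℕ) : ℝ≥0 := a + (x - a) / (n + 2)

theorem levels_anti (a x : ℝ≥0) : Antitone (levels a x) := by
  intro m n hmn
  have : (m : ℝ≥0) ≤ n := by exact_mod_cast hmn
  unfold levels
  gcongr

theorem lt_levels {a x : ℝ≥0} (h : a < x) (n : ℕ) : a < levels a x n :=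
  lt_add_of_pos_right _ (div_pos (tsub_pos_of_lt h) (by positivity))

theorem levels_lt {a x : ℝ≥0} (h : a < x) (n : ℕ) : levels a x n < x := by
  -- The shift by `2` keeps even the level with `n = 0` strictly below `x`.
  have h1 : (x - a) / ((n : ℝ≥0) + 2) < x - a :=
    div_lt_self (tsub_pos_of_lt h) (lt_of_lt_of_le one_lt_two le_add_self)
  calc levels a x n < a + (x - a) := by
        unfold levels
        gcongr
    _ = x := add_tsub_cancel_of_le h.le

theorem tendsto_levels (a x : ℝ≥0) : Tendsto (levels a x) atTop (𝓝 a) := by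
  have h : Tendsto (fun n : ℕ => ((n : ℝ≥0) + 2)⁻¹) atTop (𝓝 0) := by
    have := (tendsto_inv_atTop_nhds_zero_nat (𝕜 := ℝ≥0)).comp (tendsto_add_atTop_nat 2)
    simpa [Function.comp_def] using this
  have h2 := (h.const_mul (x - a)).const_add a
  simp only [mul_zero, add_zero] at h2
  exact h2.congr fun n => by rw [levels, div_eq_mul_inv]

/-- Extends the slope inequality to an accessible `a = 0`, by continuity of `logHit` as levels
decrease to `a`. -/
theorem LogConvex.slope (hL : LogConvex D K) {a b x : ℝ≥0} (ha : D.Accessible a) (hab : a < b)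
    (hbx : b < x) (hx : x < K) (r : ℝ≥0) :
    logHit D r a b * ((x : ℝ) - b) ≤ logHit D r b x * ((b : ℝ) - a) := by
  have h1 := (tendsto_logHit r ha (levels_anti a b) (lt_levels hab) (levels_lt hab)
    (tendsto_levels a b)).mul_const ((x : ℝ) - b)
  have h2 : Tendsto (fun n => logHit D r b x * ((b : ℝ) - levels a b n)) atTop
      (𝓝 (logHit D r b x * ((b : ℝ) - a))) :=
    ((NNReal.tendsto_coe.2 (tendsto_levels a b)).const_sub _).const_mul _
  exact le_of_tendsto_of_tendsto' h1 h2 fun n =>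
    hL r _ b x (pos_of_gt (lt_levels hab n)) (levels_lt hab n) hbx hx

theorem LogConvex.chord (hL : LogConvex D K) {a t x : ℝ≥0} (ha : D.Accessible a) (hat : a < t)
    (htx : t < x) (hx : x < K) (r : ℝ≥0) :
    logHit D r a t * ((x : ℝ) - a) ≤ logHit D r a x * ((t : ℝ) - a) := by
  have h1 := hL.slope ha hat htx hx r
  rw [logHit_add ha hat htx]
  linarith

/-- The smooth-fit inequality at `a`, integrated over `(a, x)`. -/
def SmoothFit (D : RegularDiffusion Ω) (F : Measure ℝ≥0) (K a : ℝ≥0) : Prop :=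
  D.Accessible a ∧ ∀ x : ℝ≥0, a < x → x < K →
    ∫⁻ r, ENNReal.ofReal (-logHit D r a x) ∂F ≤ ENNReal.ofReal (((x : ℝ) - a) / (K - a))

/-- The finite bound on the `lintegral` already contains integrability, since `logHit` is
nonpositive. -/
theorem SmoothFit.integrable {a x : ℝ≥0} (h : SmoothFit D F K a) (hax : a < x) (hx : x < K) :
    Integrable (fun r => logHit D r a x) F := by
  refine ⟨(measurable_logHit a x).aestronglyMeasurable, ?_⟩
  have h1 : ∀ r, ‖logHit D r a x‖ₑ = ENNReal.ofReal (-logHit D r a x) := fun r => by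
    rw [← enorm_neg, Real.enorm_of_nonneg (neg_nonneg.2 (logHit_nonpos r a x))]
  rw [HasFiniteIntegral]
  simp only [h1]
  exact (h.2 x hax hx).trans_lt ENNReal.ofReal_lt_top

/-- This is `log y ≤ y - 1` at `y = (K - x) / (K - a)`. It is what allows the linear smooth-fit
bound to imply the logarithmic one. -/
theorem log_sub_log_le {a x K : ℝ} (hax : a < K) (hx : x < K) :
    Real.log (K - x) - Real.log (K - a) ≤ -((x - a) / (K - a)) := by
  rw [← Real.log_div (by linarith) (by linarith)]
  refine (Real.log_le_sub_one_of_pos (div_pos (by linarith) (by linarith))).trans_eq ?_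
  have : K - a ≠ 0 := by linarith
  field_simp
  ring

theorem SmoothFit.integral_ge {a x : ℝ≥0} (h : SmoothFit D F K a) (hax : a < x) (hx : x < K) :
    Real.log (K - x) - Real.log (K - a) ≤ ∫ r, logHit D r a x ∂F := by
  have hax' : (a : ℝ) < x := hax
  have hx' : (x : ℝ) < K := hx
  have h1 : ∫ r, -logHit D r a x ∂F ≤ (x - a) / (K - a) := by
    rw [integral_eq_lintegral_of_nonneg_ae
      (Eventually.of_forall fun r => neg_nonneg.2 (logHit_nonpos r a x))
      (measurable_logHit a x).neg.aestronglyMeasurable]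
    exact ENNReal.toReal_le_of_le_ofReal (div_nonneg (by linarith) (by linarith)) (h.2 x hax hx)
  rw [integral_neg] at h1
  have := log_sub_log_le (hax'.trans hx') hx'
  linarith

theorem J_Icc_eq {a x : ℝ≥0} (ha : D.Accessible a) (hax : a < x) (haK : a < K) :
    J D F φ K x (Icc 0 a) =
      erealIntegral F fun r => (φ (Real.exp (Real.log (K - a) + logHit D r a x)) : EReal) := by
  have haK' : (a : ℝ) < K := haK
  rw [J_eq]
  congr 1
  ext r
  rw [D.expectedPayoff_Icc K r hax, put_of_le haK.le, Real.exp_add, Real.exp_log (by linarith),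
    exp_logHit ha hax]
  exact extendPhi_of_pos (mul_pos (by linarith) (ha.pos hax r))

variable [IsProbabilityMeasure F]

/-- The convex function `u ↦ φ (exp u)` lies above its tangent at the log-payoff `log (K - x)` of
immediate stopping. Averaging the tangent over `r` leaves a positive multiple of `log (K - a) + ∫
logHit - log (K - x)`, nonnegative by `SmoothFit.integral_ge`. -/
theorem SmoothFit.isEquilibrium (hφ : CondIII φ) {a : ℝ≥0} (haK : a < K) (h : SmoothFit D F K a) :
    IsEquilibrium D F φ K (Icc 0 a) := by
  rw [isEquilibrium_iff hφ.strictMonoOn measurableSet_Icc]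
  intro x hxa hxK
  have hax : a < x := by
    by_contra hle
    exact hxa ⟨zero_le, not_lt.1 hle⟩
  have hxK' : (x : ℝ) < K := hxK
  rw [J_Icc_eq h.1 hax haK, put_of_le hxK.le, extendPhi_of_pos (by linarith)]
  have hint := h.integrable hax hxK
  set u := Real.log (K - x)
  have hu : Real.exp u = K - x := Real.exp_log (by linarith)
  set s := deriv φ (Real.exp u) * Real.exp u
  have hs : 0 < s := hφ.slope_pos u
  have he : (fun r => φ (K - x) + s * (Real.log (K - a) + logHit D r a x - u)) =
      fun r => φ (K - x) + s * (Real.log (K - a) - u) + s * logHit D r a x := by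
    ext r
    ring
  have haff : Integrable (fun r => φ (K - x) + s * (Real.log (K - a) + logHit D r a x - u)) F := by
    rw [he]
    exact (integrable_const _).add (hint.const_mul s)
  have hval : φ (K - x) ≤ ∫ r, φ (K - x) + s * (Real.log (K - a) + logHit D r a x - u) ∂F := by
    rw [he, integral_add (integrable_const _) (hint.const_mul s), integral_const_mul]
    simp only [integral_const, probReal_univ, one_smul]
    have := h.integral_ge hax hxK
    nlinarith
  refine (EReal.coe_le_coe_iff.2 hval).trans ?_
  rw [← erealIntegral_coe F haff]
  refine erealIntegral_mono F fun r => EReal.coe_le_coe_iff.2 ?_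
  have := hφ.tangent_le u (Real.log (K - a) + logHit D r a x)
  rwa [← hu]

/-- Only `a = 0` is in question. If some `x` in `(0, K)` never reached `0`, waiting would pay
nothing at any rate, which is strictly worse than stopping. Starting points above `K` first descend
to `K / 2`. -/
theorem accessible_of_isEquilibrium (hφ : CondIII φ) {a : ℝ≥0} (haK : a < K)
    (h : IsEquilibrium D F φ K (Icc 0 a)) : D.Accessible a := by
  rcases eq_or_ne a 0 with rfl | ha
  · have h1 : ∀ x : ℝ≥0, 0 < x → x < K → 0 < hitLaplace D 0 0 x := by
      intro x hx hxK
      have hxK' : (x : ℝ) < K := hxK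
      by_contra hn
      have hzero : ∀ r, hitLaplace D r 0 x = 0 := fun r =>
        le_antisymm ((D.hitLaplace_anti 0 x zero_le).trans (not_lt.1 hn))
          (D.hitLaplace_nonneg _ _ _)
      have h2 := (isEquilibrium_iff hφ.strictMonoOn measurableSet_Icc).1 h x (by simpa using hx.ne') hxK
      rw [J_eq] at h2
      simp only [D.expectedPayoff_Icc K _ hx, hzero, mul_zero, erealIntegral_const] at h2
      rw [put_of_le hxK.le] at h2
      exact absurd (extendPhi_lt hφ.strictMonoOn (sub_pos.2 hxK') (sub_pos.2 hxK')) (not_lt.2 h2)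
    intro x hx
    rcases lt_or_ge x K with hxK | hxK
    · exact h1 x hx hxK
    · have hK2 : K / 2 < K := half_lt_self haK
      rw [D.hitLaplace_mul 0 (half_pos haK) (hK2.trans_le hxK)]
      exact mul_pos (D.hitLaplace_pos 0 (half_pos haK) (hK2.trans_le hxK))
        (h1 _ (half_pos haK) hK2)
  · exact D.accessible_of_pos (pos_iff_ne_zero.2 ha)

theorem tendsto_slope_of_hasDerivAt {f : ℝ → ℝ} {f' x q : ℝ} (hf : HasDerivAt f f' x)
    {δ : ℕ → ℝ} (hδ : ∀ n, 0 < δ n) (hlim : Tendsto δ atTop (𝓝 0)) :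
    Tendsto (fun n => (f x - f (x - δ n * q)) / δ n) atTop (𝓝 (f' * q)) := by
  have h1 : HasDerivAt (fun t => f (x - t * q)) (f' * (-q)) 0 := by
    have h2 : HasDerivAt (fun t : ℝ => x - t * q) (-q) 0 := by
      simpa using ((hasDerivAt_id (0 : ℝ)).mul_const q).const_sub x
    have h3 : HasDerivAt f f' (x - 0 * q) := by simpa using hf
    exact h3.comp 0 h2
  have h2 := (hasDerivAt_iff_tendsto_slope_zero.1 h1).comp
    (tendsto_nhdsWithin_iff.2 ⟨hlim, Eventually.of_forall fun n => (hδ n).ne'⟩)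
  have h3 := h2.neg
  simp only [mul_neg, neg_neg] at h3
  refine h3.congr fun n => ?_
  simp only [Function.comp_apply, zero_add, zero_mul, sub_zero, smul_eq_mul]
  rw [div_eq_inv_mul]
  ring

/-- At levels `t` decreasing to `a`, the equilibrium inequality bounds the mean loss of `φ` from
waiting by `φ(K - a) - φ(K - t)`. Dividing by `t - a` would give the derivative of `logHit` at `a`
in the limit; the chord inequality bounds the loss below through the chord to the fixed `x`, so no
such derivative is needed. Fatou's lemma passes to the limit without a dominating function. -/
theorem smoothFit_of_isEquilibrium (hφ : CondIII φ) (hL : LogConvex D K) {a : ℝ≥0} (haK : a < K)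
    (h : IsEquilibrium D F φ K (Icc 0 a)) : SmoothFit D F K a := by
  have ha := accessible_of_isEquilibrium hφ haK h
  refine ⟨ha, fun x hax hxK => ?_⟩
  have haK' : (a : ℝ) < K := haK
  have hax' : (a : ℝ) < x := hax
  have hxa : (0 : ℝ) < x - a := by linarith
  set u := Real.log (K - a)
  have hu : Real.exp u = K - a := Real.exp_log (by linarith)
  set s := deriv φ (Real.exp u) * Real.exp u with hs_def
  have hs : 0 < s := hφ.slope_pos u
  -- `-q r` is the slope of the chord of `logHit` from `a` to the fixed `x`.
  set q : ℝ≥0 → ℝ := fun r => -logHit D r a x / (x - a)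
  have hq0 : ∀ r, 0 ≤ q r := fun r => div_nonneg (neg_nonneg.2 (logHit_nonpos r a x)) hxa.le
  have hqm : Measurable q := (measurable_logHit a x).neg.div_const _
  set δ : ℕ → ℝ := fun n => (levels a x n : ℝ) - a
  have hδ : ∀ n, 0 < δ n := fun n => sub_pos.2 (NNReal.coe_lt_coe.2 (lt_levels hax n))
  have hδlim : Tendsto δ atTop (𝓝 0) := by
    have := (NNReal.tendsto_coe.2 (tendsto_levels a x)).sub_const (a : ℝ)
    rwa [sub_self] at this
  set f : ℕ → ℝ≥0 → ℝ≥0∞ := fun n r =>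
    ENNReal.ofReal ((φ (Real.exp u) - φ (Real.exp (u - δ n * q r))) / δ n) with hf
  have hφm : Monotone fun v => φ (Real.exp v) := hφ.strictMono_exp.monotone
  have hfm : ∀ n, Measurable (f n) := fun n => by
    have : Measurable fun r => φ (Real.exp (u - δ n * q r)) :=
      hφm.measurable.comp (measurable_const.sub (hqm.const_mul _))
    exact ((measurable_const.sub this).div_const _).ennreal_ofReal
  have hflim : ∀ r, Tendsto (fun n => f n r) atTop (𝓝 (ENNReal.ofReal (s * q r))) := fun r =>
    (ENNReal.continuous_ofReal.tendsto _).comp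
      (tendsto_slope_of_hasDerivAt (hφ.hasDerivAt_exp u) hδ hδlim)
  have hbound : ∀ n, ∫⁻ r, f n r ∂F ≤
      ENNReal.ofReal ((φ (K - a) - φ (K - a - δ n * 1)) / δ n) := by
    intro n
    set t := levels a x n
    have hat : a < t := lt_levels hax n
    have htx : t < x := levels_lt hax n
    have htK : (t : ℝ) < K := htx.trans hxK
    have h1 := (isEquilibrium_iff hφ.strictMonoOn measurableSet_Icc).1 h t
      (fun h => absurd h.2 (not_le.2 hat)) (htx.trans hxK)
    rw [J_Icc_eq ha hat haK, put_of_le (htx.trans hxK).le, extendPhi_of_pos (by linarith)] at h1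
    have hm : Measurable fun r => (φ (Real.exp (u + logHit D r a t)) : EReal) :=
      (hφm.measurable.comp (measurable_const.add (measurable_logHit a t))).coe_real_ereal
    have h2 := lintegral_sub_le_of_le_erealIntegral F hm (c := φ (Real.exp u)) (fun r =>
      EReal.coe_le_coe_iff.2 (hφm (by linarith [logHit_nonpos (D := D) r a t]))) h1
    -- By convexity `logHit D r a t ≤ -δ n * q r`, so the true loss at `t` dominates the loss
    -- computed from the chord.
    have h3 : ∀ r, f n r ≤ ENNReal.ofReal (δ n)⁻¹ *
        ((φ (Real.exp u) : EReal) - (φ (Real.exp (u + logHit D r a t)) : EReal)).toENNReal := by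
      intro r
      rw [← EReal.coe_sub, EReal.real_coe_toENNReal,
        ← ENNReal.ofReal_mul (inv_nonneg.2 (hδ n).le), hf]
      refine ENNReal.ofReal_le_ofReal ?_
      rw [div_eq_inv_mul]
      refine mul_le_mul_of_nonneg_left (sub_le_sub_left (hφm ?_) _) (inv_nonneg.2 (hδ n).le)
      have h4 := hL.chord ha hat htx hxK r
      have h5 : δ n * q r = -(logHit D r a x * ((t : ℝ) - a)) / (x - a) := by
        simp only [q, δ]
        ring
      have h6 : logHit D r a t ≤ logHit D r a x * ((t : ℝ) - a) / (x - a) := by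
        rwa [le_div_iff₀ hxa]
      rw [h5, neg_div, sub_neg_eq_add]
      linarith
    refine (lintegral_mono h3).trans ?_
    rw [lintegral_const_mul' _ _ ENNReal.ofReal_ne_top]
    refine (mul_le_mul_right h2 _).trans ?_
    rw [← ENNReal.ofReal_mul (inv_nonneg.2 (hδ n).le), hu]
    refine ENNReal.ofReal_le_ofReal (le_of_eq ?_)
    have : (K : ℝ) - a - δ n * 1 = K - t := by
      simp only [δ, t]
      ring
    rw [this, div_eq_inv_mul]
  have hrhs : Tendsto (fun n => ENNReal.ofReal ((φ (K - a) - φ (K - a - δ n * 1)) / δ n)) atTop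
      (𝓝 (ENNReal.ofReal (deriv φ (K - a) * 1))) :=
    (ENNReal.continuous_ofReal.tendsto _).comp (tendsto_slope_of_hasDerivAt
      (hφ.differentiableAt (sub_pos.2 haK')).hasDerivAt hδ hδlim)
  have hfatou : ∫⁻ r, ENNReal.ofReal (s * q r) ∂F ≤ ENNReal.ofReal (deriv φ (K - a) * 1) := by
    calc ∫⁻ r, ENNReal.ofReal (s * q r) ∂F = ∫⁻ r, liminf (fun n => f n r) atTop ∂F :=
          lintegral_congr fun r => (hflim r).liminf_eq.symm
      _ ≤ liminf (fun n => ∫⁻ r, f n r ∂F) atTop := lintegral_liminf_le hfm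
      _ ≤ liminf (fun n => ENNReal.ofReal ((φ (K - a) - φ (K - a - δ n * 1)) / δ n)) atTop :=
          liminf_le_liminf (Eventually.of_forall hbound)
      _ = _ := hrhs.liminf_eq
  -- Undoing the normalization: `s = φ'(K - a) (K - a)`, so the factor `φ'(K - a)` cancels and only
  -- `1 / (K - a)` remains.
  have hfac : ∀ r, ENNReal.ofReal (-logHit D r a x) =
      ENNReal.ofReal ((x - a) / s) * ENNReal.ofReal (s * q r) := fun r => by
    rw [← ENNReal.ofReal_mul (div_nonneg hxa.le hs.le)]
    congr 1
    simp only [q]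
    field_simp
  simp only [hfac]
  rw [lintegral_const_mul' _ _ ENNReal.ofReal_ne_top]
  refine (mul_le_mul_right hfatou _).trans ?_
  rw [← ENNReal.ofReal_mul (div_nonneg hxa.le hs.le)]
  refine ENNReal.ofReal_le_ofReal (le_of_eq ?_)
  have hd : deriv φ (K - a) ≠ 0 := by
    intro h0
    rw [hs_def, hu, h0, zero_mul] at hs
    exact lt_irrefl _ hs
  have hKa : (K : ℝ) - a ≠ 0 := by linarith
  rw [hs_def, hu]
  field_simp

end Core

/-! ### Existence of the threshold and optimality -/

section Threshold

variable {Ω : Type*} [MeasurableSpace Ω] {D : RegularDiffusion Ω} {F : Measure ℝ≥0} {φ : ℝ → ℝ}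
  {K : ℝ≥0}

/-- Convexity bounds the decrease of `logHit` over `(b, x)` by the decrease over `(a, b)`, scaled by
the lengths. The fit at `a` then gives `(x - b) / (K - a)`, even better than the required `(x - b) /
(K - b)`. -/
theorem SmoothFit.mono (hL : LogConvex D K) {a b : ℝ≥0} (hab : a < b) (h : SmoothFit D F K a) :
    SmoothFit D F K b := by
  refine ⟨D.accessible_of_pos (pos_of_gt hab), fun x hbx hxK => ?_⟩
  have hab' : (0 : ℝ) < b - a := sub_pos.2 hab
  have hbx' : (0 : ℝ) < x - b := sub_pos.2 hbx
  have hxK' : (0 : ℝ) < K - x := sub_pos.2 hxK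
  have h1 : ∀ r, ENNReal.ofReal (-logHit D r b x) ≤
      ENNReal.ofReal ((x - b) / (b - a)) * ENNReal.ofReal (-logHit D r a b) := fun r => by
    rw [← ENNReal.ofReal_mul (div_nonneg hbx'.le hab'.le)]
    refine ENNReal.ofReal_le_ofReal ?_
    rw [div_mul_eq_mul_div, le_div_iff₀ hab']
    have := hL.slope h.1 hab hbx hxK r
    linarith
  refine (lintegral_mono h1).trans ?_
  rw [lintegral_const_mul' _ _ ENNReal.ofReal_ne_top]
  refine (mul_le_mul_right (h.2 b hab (hbx.trans hxK)) _).trans ?_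
  rw [← ENNReal.ofReal_mul (div_nonneg hbx'.le hab'.le)]
  refine ENNReal.ofReal_le_ofReal ?_
  have h2 : ((x : ℝ) - b) / (b - a) * ((b - a) / (K - a)) = (x - b) / (K - a) := by
    field_simp
  rw [h2]
  exact div_le_div_of_nonneg_left hbx'.le (by linarith) (by linarith)

theorem tendsto_levels_ratio {a x : ℝ≥0} (hax : a < x) (hxK : x < K) :
    Tendsto (fun n => ENNReal.ofReal (((x : ℝ) - levels a x n) / (K - levels a x n))) atTop
      (𝓝 (ENNReal.ofReal (((x : ℝ) - a) / (K - a)))) := by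
  have h : Tendsto (fun n => (levels a x n : ℝ)) atTop (𝓝 (a : ℝ)) :=
    NNReal.tendsto_coe.2 (tendsto_levels a x)
  have hne : (K : ℝ) - a ≠ 0 := (sub_pos.2 (NNReal.coe_lt_coe.2 (hax.trans hxK))).ne'
  exact (ENNReal.continuous_ofReal.tendsto _).comp ((h.const_sub _).div (h.const_sub _) hne)

/-- If `0` were inaccessible, the transforms of levels decreasing to `0` would tend to `0` for every
`r > 0`, so `-logHit` would blow up on a set of positive `F`-measure. By Fatou's lemma this
contradicts the uniform smooth-fit bounds. -/
theorem accessible_of_forall_smoothFit (hF : 0 < F (Ioi 0)) {a : ℝ≥0} (haK : a < K)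
    (h : ∀ b, a < b → b < K → SmoothFit D F K b) : D.Accessible a := by
  rcases eq_or_ne a 0 with rfl | ha
  swap
  · exact D.accessible_of_pos (pos_iff_ne_zero.2 ha)
  by_contra hacc
  simp only [RegularDiffusion.Accessible, not_forall] at hacc
  obtain ⟨y, hy, hy0⟩ := hacc
  obtain ⟨x, hx0, hxK, hx⟩ : ∃ x : ℝ≥0, 0 < x ∧ x < K ∧ hitLaplace D 0 0 x = 0 := by
    have hy0' : hitLaplace D 0 0 y = 0 := le_antisymm (not_lt.1 hy0) (D.hitLaplace_nonneg _ _ _)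
    rcases lt_or_ge y K with hyK | hyK
    · exact ⟨y, hy, hyK, hy0'⟩
    · have hK2 : K / 2 < K := half_lt_self haK
      refine ⟨K / 2, half_pos haK, hK2, ?_⟩
      rw [D.hitLaplace_mul 0 (half_pos haK) (hK2.trans_le hyK)] at hy0'
      exact (mul_eq_zero.1 hy0').resolve_left
        (D.hitLaplace_pos 0 (half_pos haK) (hK2.trans_le hyK)).ne'
  have hzero : ∀ r, hitLaplace D r 0 x = 0 := fun r =>
    le_antisymm ((D.hitLaplace_anti 0 x zero_le).trans hx.le) (D.hitLaplace_nonneg _ _ _)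
  have hlim : ∀ r ∈ Ioi (0 : ℝ≥0), Tendsto (fun n => ENNReal.ofReal (-logHit D r (levels 0 x n) x))
      atTop (𝓝 ⊤) := by
    intro r hr
    have h1 := D.tendsto_hitLaplace_level_of_pos hr (levels_anti 0 x)
      (fun n => (lt_levels hx0 n).le) (levels_lt hx0) (tendsto_levels 0 x)
    rw [hzero r] at h1
    have h2 : Tendsto (fun n => logHit D r (levels 0 x n) x) atTop atBot :=
      Real.tendsto_log_nhdsGT_zero.comp (tendsto_nhdsWithin_iff.2 ⟨h1, Eventually.of_forall fun n =>
        D.hitLaplace_pos r (lt_levels hx0 n) (levels_lt hx0 n)⟩)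
    exact ENNReal.tendsto_ofReal_atTop.comp (tendsto_neg_atBot_atTop.comp h2)
  have hfatou : ∫⁻ r, liminf (fun n => ENNReal.ofReal (-logHit D r (levels 0 x n) x)) atTop ∂F ≤
      ENNReal.ofReal (((x : ℝ) - (0 : ℝ≥0)) / (K - (0 : ℝ≥0))) := by
    refine (lintegral_liminf_le fun n => (measurable_logHit _ x).neg.ennreal_ofReal).trans ?_
    refine (liminf_le_liminf (Eventually.of_forall fun n =>
      (h _ (lt_levels hx0 n) ((levels_lt hx0 n).trans hxK)).2 x (levels_lt hx0 n) hxK)).trans_eq ?_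
    exact (tendsto_levels_ratio hx0 hxK).liminf_eq
  have htop : ∫⁻ r, liminf (fun n => ENNReal.ofReal (-logHit D r (levels 0 x n) x)) atTop ∂F = ⊤ := by
    refine top_le_iff.1 (le_trans ?_ (setLIntegral_le_lintegral (Ioi 0) _))
    rw [setLIntegral_congr_fun measurableSet_Ioi (g := fun _ => ⊤)
      fun r hr => (hlim r hr).liminf_eq, setLIntegral_const, ENNReal.top_mul hF.ne']
  rw [htop] at hfatou
  exact absurd hfatou (not_le.2 ENNReal.ofReal_lt_top)

/-- The admissible levels are closed under decreasing limits, by Fatou's lemma; this makes the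
infimum of the admissible levels below `K` itself admissible. -/
theorem smoothFit_of_forall (hF : 0 < F (Ioi 0)) {a : ℝ≥0} (haK : a < K)
    (h : ∀ b, a < b → b < K → SmoothFit D F K b) : SmoothFit D F K a := by
  have ha := accessible_of_forall_smoothFit hF haK h
  refine ⟨ha, fun x hax hxK => ?_⟩
  have hlim : ∀ r, Tendsto (fun n => ENNReal.ofReal (-logHit D r (levels a x n) x)) atTop
      (𝓝 (ENNReal.ofReal (-logHit D r a x))) := fun r =>
    (ENNReal.continuous_ofReal.tendsto _).comp (tendsto_logHit r ha (levels_anti a x)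
      (lt_levels hax) (levels_lt hax) (tendsto_levels a x)).neg
  calc ∫⁻ r, ENNReal.ofReal (-logHit D r a x) ∂F
      = ∫⁻ r, liminf (fun n => ENNReal.ofReal (-logHit D r (levels a x n) x)) atTop ∂F :=
        lintegral_congr fun r => (hlim r).liminf_eq.symm
    _ ≤ liminf (fun n => ∫⁻ r, ENNReal.ofReal (-logHit D r (levels a x n) x) ∂F) atTop :=
        lintegral_liminf_le fun n => (measurable_logHit _ x).neg.ennreal_ofReal
    _ ≤ liminf (fun n => ENNReal.ofReal (((x : ℝ) - levels a x n) / (K - levels a x n))) atTop :=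
        liminf_le_liminf (Eventually.of_forall fun n =>
          (h _ (lt_levels hax n) ((levels_lt hax n).trans hxK)).2 x (levels_lt hax n) hxK)
    _ = _ := (tendsto_levels_ratio hax hxK).liminf_eq

/-- A form of Chebyshev's integral inequality. -/
theorem integral_mul_nonneg_of_antitone {w p : ℝ≥0 → ℝ} (hw : Antitone w) (hp : Antitone p)
    (hw0 : ∀ r, 0 ≤ w r) (hpi : Integrable p F) (hwpi : Integrable (fun r => w r * p r) F)
    (h : 0 ≤ ∫ r, p r ∂F) : 0 ≤ ∫ r, w r * p r ∂F := by
  by_cases hall : ∀ r, 0 ≤ p r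
  · exact integral_nonneg fun r => mul_nonneg (hw0 r) (hall r)
  push Not at hall
  obtain ⟨r₁, hr₁⟩ := hall
  set r₀ := sInf {r | p r < 0}
  -- The factor `p` changes sign from plus to minus at `r₀`, and `w` is larger before `r₀` and
  -- smaller after it, so freezing the weight at `r₀` only lowers the product.
  have hkey : ∀ r, w r₀ * p r ≤ w r * p r := by
    intro r
    rcases lt_trichotomy r r₀ with hr | rfl | hr
    · have hpr : 0 ≤ p r := by
        by_contra hn
        have hmem : r ∈ {r | p r < 0} := not_le.1 hn
        exact absurd (csInf_le (OrderBot.bddBelow _) hmem) (not_le.2 hr)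
      exact mul_le_mul_of_nonneg_right (hw hr.le) hpr
    · exact le_rfl
    · obtain ⟨r₂, hr₂, hr₂r⟩ := exists_lt_of_csInf_lt ⟨r₁, hr₁⟩ hr
      have hpr : p r ≤ 0 := (hp hr₂r.le).trans (le_of_lt hr₂)
      exact mul_le_mul_of_nonpos_right (hw hr.le) hpr
  calc 0 ≤ w r₀ * ∫ r, p r ∂F := mul_nonneg (hw0 _) h
    _ = ∫ r, w r₀ * p r ∂F := (integral_const_mul _ _).symm
    _ ≤ _ := integral_mono (hpi.const_mul _) hwpi hkey

variable [IsProbabilityMeasure F]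

/-- Going on from `b` down to `a` changes the log-payoff from `q r` to `q r + p r`, with `p`
decreasing in `r` and of nonnegative mean by the fit at `a`. Convexity bounds the gain below by `w r
* p r`, where the slope `w` at `q r` also decreases in `r`; Chebyshev's inequality shows that this
has nonnegative mean. -/
theorem J_Icc_le (hφ : CondIII φ) {a b x : ℝ≥0} (h : SmoothFit D F K a) (hab : a < b) (hbx : b < x)
    (hbK : b < K) : J D F φ K x (Icc 0 b) ≤ J D F φ K x (Icc 0 a) := by
  have hb : D.Accessible b := D.accessible_of_pos (pos_of_gt hab)
  rw [J_Icc_eq hb hbx hbK, J_Icc_eq h.1 (hab.trans hbx) (hab.trans hbK)]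
  set p : ℝ≥0 → ℝ := fun r => Real.log (K - a) - Real.log (K - b) + logHit D r a b with hp
  set q : ℝ≥0 → ℝ := fun r => Real.log (K - b) + logHit D r b x with hq
  have hpq : ∀ r, Real.log (K - a) + logHit D r a x = q r + p r := fun r => by
    simp only [hp, hq, logHit_add h.1 hab hbx]
    ring
  have hint := h.integrable hab hbK
  have hpi : Integrable p F := (integrable_const _).add hint
  have hp0 : 0 ≤ ∫ r, p r ∂F := by
    rw [hp, integral_add (integrable_const _) hint]
    simp only [integral_const, probReal_univ, one_smul]
    linarith [h.integral_ge hab hbK]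
  have hpa : Antitone p := fun r s hrs => by
    simp only [hp]
    linarith [logHit_anti h.1 hab hrs]
  have hqa : Antitone q := fun r s hrs => by
    simp only [hq]
    linarith [logHit_anti hb hbx hrs]
  set w : ℝ≥0 → ℝ := fun r => deriv φ (Real.exp (q r)) * Real.exp (q r) with hw
  have hwa : Antitone w := hφ.monotone_slope.comp_antitone hqa
  have hw0 : ∀ r, 0 ≤ w r := fun r => (hφ.slope_pos (q r)).le
  have hwpi : Integrable (fun r => w r * p r) F := by
    refine hpi.bdd_mul (c := w 0) hwa.measurable.aestronglyMeasurable
      (Eventually.of_forall fun r => ?_)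
    rw [Real.norm_of_nonneg (hw0 r)]
    exact hwa zero_le
  have hφm : Monotone fun v => φ (Real.exp v) := hφ.strictMono_exp.monotone
  have hΦm : Measurable fun r => φ (Real.exp (q r)) := (hφm.comp_antitone hqa).measurable
  set c := φ (Real.exp (q 0))
  have hc : ∀ r, φ (Real.exp (q r)) ≤ c := fun r => hφm (hqa zero_le)
  have hle : ∀ r, φ (Real.exp (q r)) + w r * p r ≤
      φ (Real.exp (Real.log (K - a) + logHit D r a x)) := fun r => by
    rw [hpq]
    simpa using hφ.tangent_le (q r) (q r + p r)
  -- In this case the payoff of `[0, b]` is `-∞` and there is nothing to compare; otherwise `φ (exp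
  -- (q r))` is integrable.
  by_cases hA : ∫⁻ r, ((c : EReal) - (φ (Real.exp (q r)) : EReal)).toENNReal ∂F = ⊤
  · rw [erealIntegral_eq_sub F hΦm.coe_real_ereal c fun r => EReal.coe_le_coe_iff.2 (hc r), hA]
    simp
  · have hci : Integrable (fun r => c - φ (Real.exp (q r))) F := by
      refine ⟨(measurable_const.sub hΦm).aestronglyMeasurable, ?_⟩
      rw [HasFiniteIntegral]
      refine lt_of_le_of_lt (le_of_eq (lintegral_congr fun r => ?_)) (lt_top_iff_ne_top.2 hA)
      rw [← EReal.coe_sub, EReal.real_coe_toENNReal, Real.enorm_of_nonneg (sub_nonneg.2 (hc r))]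
    have hΦi : Integrable (fun r => φ (Real.exp (q r))) F := by
      have := (integrable_const c).sub hci
      refine this.congr (Eventually.of_forall fun r => ?_)
      simp
    rw [erealIntegral_coe F hΦi]
    have h1 : ∫ r, φ (Real.exp (q r)) ∂F ≤ ∫ r, φ (Real.exp (q r)) + w r * p r ∂F := by
      rw [integral_add hΦi hwpi]
      linarith [integral_mul_nonneg_of_antitone hwa hpa hw0 hpi hwpi hp0]
    refine (EReal.coe_le_coe_iff.2 h1).trans ?_
    rw [← erealIntegral_coe F (g := fun r => φ (Real.exp (q r)) + w r * p r) (hΦi.add hwpi)]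
    exact erealIntegral_mono F fun r => EReal.coe_le_coe_iff.2 (hle r)

theorem isEquilibrium_Icc_iff (hφ : CondIII φ) (hL : LogConvex D K) {a : ℝ≥0} (haK : a < K) :
    IsEquilibrium D F φ K (Icc 0 a) ↔ SmoothFit D F K a :=
  ⟨smoothFit_of_isEquilibrium hφ hL haK, fun h => h.isEquilibrium hφ haK⟩

omit [IsProbabilityMeasure F] in
theorem exists_smoothFit_threshold (hF : 0 < F (Ioi 0)) (hL : LogConvex D K) :
    ∃ aStar ≤ K, ∀ a < K, SmoothFit D F K a ↔ aStar ≤ a := by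
  -- Inserting `K` makes the set nonempty, and gives the threshold `K` when no level below `K`
  -- satisfies the fit.
  set S : Set ℝ≥0 := insert K {a | a < K ∧ SmoothFit D F K a}
  have hbdd : BddBelow S := OrderBot.bddBelow _
  have hK : sInf S ≤ K := csInf_le hbdd (mem_insert _ _)
  have hgt : ∀ b, sInf S < b → b < K → SmoothFit D F K b := by
    intro b hb hbK
    obtain ⟨s, hs, hsb⟩ := exists_lt_of_csInf_lt (insert_nonempty K _) hb
    rcases hs with rfl | hs
    · exact absurd hbK (not_lt.2 hsb.le)
    · exact hs.2.mono hL hsb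
  refine ⟨sInf S, hK, fun a haK => ⟨fun h => csInf_le hbdd (Or.inr ⟨haK, h⟩), fun h => ?_⟩⟩
  rcases h.eq_or_lt with h | h
  · rw [← h]
    exact smoothFit_of_forall hF (h ▸ haK) hgt
  · exact hgt a h haK

/-- The threshold theorem: only the log-convexity of the hitting times and condition C-(i) on the
diffusion are used. -/
theorem isOptimalThreshold_of_smoothFit_iff (hφ : CondIII φ) (hI : CondI D F φ K)
    (hL : LogConvex D K) {aStar : ℝ≥0} (hK : aStar ≤ K)
    (hstar : ∀ a < K, SmoothFit D F K a ↔ aStar ≤ a) : IsOptimalThreshold D F φ K aStar := by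
  have hmono := hφ.strictMonoOn
  have hiff : ∀ a : ℝ≥0, IsEquilibrium D F φ K (Icc 0 a) ↔ aStar ≤ a := by
    intro a
    rcases lt_or_ge a K with haK | haK
    · rw [isEquilibrium_Icc_iff hφ hL haK, hstar a haK]
    · exact iff_of_true (isEquilibrium_Icc_of_le hmono haK) (hK.trans haK)
  -- Every equilibrium is dominated by an interval equilibrium `[0, a]`, through its closure below
  -- `K` and C-(i).
  have hred : ∀ R, IsEquilibrium D F φ K R → ∃ a, aStar ≤ a ∧ a ≤ K ∧
      closure R ∩ Icc 0 K = Icc 0 a := by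
    intro R hR
    have h1 := hR.closure_inter hmono
    obtain ⟨a, haK, ha⟩ := hI _ (isClosed_closure.inter isClosed_Icc) inter_subset_right h1
    rw [ha] at h1
    exact ⟨a, (hiff a).1 h1, haK, ha⟩
  refine ⟨hiff, fun R hR => ?_, (hiff aStar).2 le_rfl, fun R hR x => ?_⟩
  · obtain ⟨a, ha, -, hRa⟩ := hred R hR
    exact (Icc_subset_Icc le_rfl ha).trans (hRa ▸ inter_subset_left)
  · obtain ⟨a, ha, haK, hRa⟩ := hred R hR
    refine max_le (le_max_left _ _) ?_
    have h1 := J_le_closure (D := D) (F := F) (K := K) hmono x R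
    rw [hRa] at h1
    refine h1.trans ?_
    rcases le_or_gt x a with hxa | hxa
    · have hx : x ∈ Icc 0 a := ⟨zero_le, hxa⟩
      exact (J_le_of_mem hmono hx).trans (le_max_left _ _)
    -- For `a = K` and `x > K` the policy `[0, K]` stops at `K` with zero payoff, so it yields only
    -- the minimal value `φ(0)`.
    rcases haK.lt_or_eq with haK | rfl
    · refine le_trans ?_ (le_max_right _ _)
      rcases ha.eq_or_lt with rfl | ha
      · exact le_rfl
      · exact J_Icc_le hφ ((hstar aStar (ha.trans haK)).2 le_rfl) ha hxa haK
    · refine le_trans ?_ (le_max_left _ _)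
      rw [J_eq]
      simp only [D.expectedPayoff_Icc a _ hxa, put_of_ge le_rfl, zero_mul, erealIntegral_const]
      exact extendPhi_zero_le (put a x)

end Threshold

/-! ### Condition C-(ii) implies log-convexity -/

section GeneralConditions

variable {Ω : Type*} [MeasurableSpace Ω] {D : RegularDiffusion Ω} {K : ℝ≥0}

theorem H_coe (D : RegularDiffusion Ω) (r a x : ℝ≥0) : H D r a x = logHit D r a x := by
  simp [H, logHit]

theorem H_add {r : ℝ≥0} {a b x : ℝ} (ha : 0 < a) (hab : a < b) (hbx : b < x) :
    H D r a x = H D r b x + H D r a b := by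
  lift a to ℝ≥0 using ha.le
  lift b to ℝ≥0 using (ha.trans hab).le
  lift x to ℝ≥0 using ((ha.trans hab).trans hbx).le
  rw [H_coe, H_coe, H_coe]
  exact logHit_add (D.accessible_of_pos ha) hab hbx r

/-- By additivity, `y ↦ H D r c y` with a fixed low level `c` has the same derivative above `y` as
`H D r y`. The limit in part (a) is therefore the right limit of this derivative at `y`, hence its
value there. Monotonicity in the level becomes monotonicity of the derivative, that is, convexity.
-/
theorem CondII.logConvex (h : CondII D K) : LogConvex D K := by
  intro r a b x ha hab hbx hxK
  have ha' : (0 : ℝ) < a := ha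
  have hab' : (a : ℝ) < b := hab
  have hbx' : (b : ℝ) < x := hbx
  have hxK' : (x : ℝ) < K := hxK
  obtain ⟨m, hm, hmono⟩ := h.monotone_a r
  -- Any base level in `(0, a)` would do; differences of `f` do not depend on it.
  set c : ℝ := a / 2
  have hc0 : 0 < c := half_pos ha'
  have hca : c < a := half_lt_self ha'
  have hcK : c ∈ Ioc (0 : ℝ) K := ⟨hc0, by linarith⟩
  set f : ℝ → ℝ := fun y => H D r c y
  have hdiff : ∀ y, c < y → DifferentiableAt ℝ f y := h.differentiable_x r c hcK
  have hderiv : ∀ y ∈ Ioo c (K : ℝ), deriv f y = m y := by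
    intro y hy
    have hyK : y ∈ Ioc (0 : ℝ) K := ⟨hc0.trans hy.1, hy.2.le⟩
    have hlim : Tendsto (fun z => deriv f z) (𝓝[>] y) (𝓝 (m y)) := by
      refine (hm y hyK).congr' ?_
      filter_upwards [self_mem_nhdsWithin] with z hz
      have hev : f =ᶠ[𝓝 z] fun z => H D r y z + H D r c y := by
        filter_upwards [lt_mem_nhds hz] with v hv
        exact H_add hc0 hy.1 hv
      rw [hev.deriv_eq, deriv_add_const]
    -- A right limit of the derivative is the right derivative. Since `f` is differentiable at `y`,
    -- this identifies the two-sided derivative.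
    have h1 : HasDerivWithinAt f (m y) (Ici y) y :=
      hasDerivWithinAt_Ici_of_tendsto_deriv (s := Ioi c)
        (fun z hz => (hdiff z hz).differentiableWithinAt)
        (hdiff y hy.1).continuousAt.continuousWithinAt
        (mem_nhdsWithin_of_mem_nhds (Ioi_mem_nhds hy.1)) hlim
    exact (uniqueDiffOn_Ici y y self_mem_Ici).eq_deriv _
      (hdiff y hy.1).hasDerivAt.hasDerivWithinAt h1
  have hconv : ConvexOn ℝ (Ioo c K) f := by
    refine MonotoneOn.convexOn_of_deriv (convex_Ioo c K)
      (fun y hy => (hdiff y hy.1).continuousAt.continuousWithinAt)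
      (fun y hy => ?_) ?_
    · rw [interior_Ioo] at hy
      exact (hdiff y hy.1).differentiableWithinAt
    · rw [interior_Ioo]
      intro y hy z hz hyz
      rw [hderiv y hy, hderiv z hz]
      exact hmono ⟨hc0.trans hy.1, hy.2.le⟩ ⟨hc0.trans hz.1, hz.2.le⟩ hyz
  have hs := hconv.slope_mono_adjacent (⟨hca, by linarith⟩ : (a : ℝ) ∈ Ioo c K)
    (⟨by linarith, hxK'⟩ : (x : ℝ) ∈ Ioo c K) hab' hbx'
  have e1 : f b - f a = logHit D r a b := by
    rw [← H_coe]
    simp only [f, H_add hc0 hca hab']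
    ring
  have e2 : f x - f b = logHit D r b x := by
    rw [← H_coe]
    simp only [f, H_add hc0 (hca.trans hab') hbx']
    ring
  rw [e1, e2, div_le_div_iff₀ (by linarith) (by linarith)] at hs
  exact hs

end GeneralConditions

/-! ### Thresholds from decay rates -/

section Rate

variable {Ω : Type*} [MeasurableSpace Ω] {D : RegularDiffusion Ω} {F : Measure ℝ≥0} {φ : ℝ → ℝ}
  {K : ℝ≥0}

/-- `rate r` is minus the derivative of the convex function `x ↦ logHit D r a x`, in terms of
difference quotients. -/
def HasDecayRate (D : RegularDiffusion Ω) (rate : ℝ≥0 → ℝ≥0 → ℝ) : Prop :=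
  ∀ r a x : ℝ≥0, 0 < a → a < x → ((x : ℝ) - a) * rate r x ≤ -logHit D r a x ∧
    -logHit D r a x ≤ ((x : ℝ) - a) * rate r a

namespace HasDecayRate

variable {rate : ℝ≥0 → ℝ≥0 → ℝ}

theorem nonneg (h : HasDecayRate D rate) (r : ℝ≥0) {a : ℝ≥0} (ha : 0 < a) : 0 ≤ rate r a := by
  have h1 := (h r a (a + 1) ha (lt_add_one a)).2
  have h2 := logHit_nonpos (D := D) r a (a + 1)
  push_cast at h1
  linarith

theorem anti (h : HasDecayRate D rate) (r : ℝ≥0) {a x : ℝ≥0} (ha : 0 < a) (hax : a ≤ x) :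
    rate r x ≤ rate r a := by
  rcases hax.eq_or_lt with rfl | hax
  · exact le_rfl
  · have h1 := h r a x ha hax
    exact le_of_mul_le_mul_left (h1.1.trans h1.2) (sub_pos.2 (NNReal.coe_lt_coe.2 hax))

theorem logConvex (h : HasDecayRate D rate) : LogConvex D K := by
  intro r a b x ha hab hbx _
  have h1 := (h r a b ha hab).1
  have h2 := (h r b x (ha.trans hab) hbx).2
  have hab' : (0 : ℝ) < b - a := sub_pos.2 hab
  have hbx' : (0 : ℝ) < x - b := sub_pos.2 hbx
  nlinarith [mul_le_mul_of_nonneg_left h1 hbx'.le, mul_le_mul_of_nonneg_left h2 hab'.le]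

theorem integral_anti (h : HasDecayRate D rate)
    (hint : ∀ a : ℝ≥0, 0 < a → a < K → Integrable (fun r => rate r a) F) {a x : ℝ≥0} (ha : 0 < a)
    (hax : a ≤ x) (hx : x < K) : ∫ r, rate r x ∂F ≤ ∫ r, rate r a ∂F :=
  integral_mono (hint x (ha.trans_le hax) hx) (hint a ha (hax.trans_lt hx)) fun r => h.anti r ha hax

/-- The integrated rate decreases in the level and `1 / (K - a)` strictly increases, so the fit
holds to the right of the crossing point and fails to the left of it. -/
theorem smoothFit_iff (h : HasDecayRate D rate)
    (hint : ∀ a : ℝ≥0, 0 < a → a < K → Integrable (fun r => rate r a) F) {aStar : ℝ≥0}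
    (h0 : 0 < aStar) (hK : aStar < K) (hstar : ∫ r, rate r aStar ∂F = 1 / ((K : ℝ) - aStar))
    (a : ℝ≥0) (haK : a < K) : SmoothFit D F K a ↔ aStar ≤ a := by
  have hK' : (0 : ℝ) < K - aStar := sub_pos.2 hK
  have haK' : (0 : ℝ) < K - a := sub_pos.2 haK
  have hpos : ∀ b : ℝ≥0, 0 < b → b < aStar → ¬ SmoothFit D F K b := by
    intro b hb hbs hsf
    have hbs' : (b : ℝ) < aStar := hbs
    -- Testing the fit at `x` between `b` and `aStar` keeps the average rate over `(b, x)` at least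
    -- the rate at `aStar`, which exceeds `1 / (K - b)` after integration.
    obtain ⟨x, hbx, hxs⟩ := exists_between hbs
    have hbx' : (0 : ℝ) < x - b := sub_pos.2 hbx
    have hxK : x < K := hxs.trans hK
    have h1 : ∫ r, ((x : ℝ) - b) * rate r x ∂F ≤ ∫ r, -logHit D r b x ∂F :=
      integral_mono ((hint x (hb.trans hbx) hxK).const_mul _) (hsf.integrable hbx hxK).neg
        fun r => (h r b x hb hbx).1
    have h2 : ∫ r, -logHit D r b x ∂F ≤ (x - b) / (K - b) := by
      rw [integral_eq_lintegral_of_nonneg_ae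
        (Eventually.of_forall fun r => neg_nonneg.2 (logHit_nonpos r b x))
        (measurable_logHit b x).neg.aestronglyMeasurable]
      exact ENNReal.toReal_le_of_le_ofReal (div_nonneg hbx'.le (by linarith)) (hsf.2 x hbx hxK)
    have h3 := h.integral_anti hint (hb.trans hbx) hxs.le hK
    rw [integral_const_mul] at h1
    rw [hstar] at h3
    have h4 : 1 / ((K : ℝ) - b) < 1 / (K - aStar) :=
      one_div_lt_one_div_of_lt hK' (by linarith)
    have h5 : ((x : ℝ) - b) * (1 / (K - aStar)) ≤ (x - b) * (1 / (K - b)) :=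
      (mul_le_mul_of_nonneg_left h3 hbx'.le).trans ((h1.trans h2).trans_eq (by ring))
    exact absurd (le_of_mul_le_mul_left h5 hbx') (not_le.2 h4)
  constructor
  · intro hsf
    by_contra hlt
    rw [not_le] at hlt
    -- The level `a` may be `0`, where the rate is not controlled; the fit is first moved up to a
    -- positive level still below `aStar`.
    obtain ⟨b, hab, hbs⟩ := exists_between hlt
    exact hpos b (pos_of_gt hab) hbs (hsf.mono h.logConvex hab)
  · intro hle
    have ha : 0 < a := h0.trans_le hle
    refine ⟨D.accessible_of_pos ha, fun x hax hxK => ?_⟩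
    have hax' : (0 : ℝ) < x - a := sub_pos.2 hax
    have hle' : (aStar : ℝ) ≤ a := hle
    calc ∫⁻ r, ENNReal.ofReal (-logHit D r a x) ∂F
        ≤ ∫⁻ r, ENNReal.ofReal (((x : ℝ) - a) * rate r a) ∂F :=
          lintegral_mono fun r => ENNReal.ofReal_le_ofReal (h r a x ha hax).2
      _ = ENNReal.ofReal (∫ r, ((x : ℝ) - a) * rate r a ∂F) :=
          (ofReal_integral_eq_lintegral_ofReal ((hint a ha haK).const_mul _)
            (Eventually.of_forall fun r => mul_nonneg hax'.le (h.nonneg r ha))).symm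
      _ ≤ _ := by
          refine ENNReal.ofReal_le_ofReal ?_
          rw [integral_const_mul]
          have h1 := h.integral_anti hint h0 hle haK
          rw [hstar] at h1
          have h2 : 1 / ((K : ℝ) - aStar) ≤ 1 / (K - a) :=
            one_div_le_one_div_of_le haK' (by linarith)
          calc ((x : ℝ) - a) * ∫ r, rate r a ∂F ≤ (x - a) * (1 / (K - a)) :=
                mul_le_mul_of_nonneg_left (h1.trans h2) hax'.le
            _ = _ := by ring

/-- The threshold determined by the smooth-fit equation. -/
theorem isOptimalThreshold [IsProbabilityMeasure F] (h : HasDecayRate D rate) (hφ : CondIII φ)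
    (hI : CondI D F φ K) (hint : ∀ a : ℝ≥0, 0 < a → a < K → Integrable (fun r => rate r a) F)
    {aStar : ℝ≥0} (h0 : 0 < aStar) (hK : aStar < K)
    (hstar : ∫ r, rate r aStar ∂F = 1 / ((K : ℝ) - aStar)) : IsOptimalThreshold D F φ K aStar :=
  isOptimalThreshold_of_smoothFit_iff hφ hI h.logConvex hK.le (h.smoothFit_iff hint h0 hK hstar)

end HasDecayRate

end Rate

/-! ### Optional stopping for bounded continuous martingales -/

section OptionalStopping

variable {Ω : Type*} {m : MeasurableSpace Ω} {P : Measure Ω} [IsProbabilityMeasure P]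
  {𝓕 : Filtration ℝ≥0 m} {M : ℝ≥0 → Ω → ℝ}

/-- The index of the first point after `s` of the grid `k T / (n + 1)`, capped at `n + 1`. -/
noncomputable def gridIndex (T : ℝ≥0) (n : ℕ) (s : ℝ≥0) : ℕ :=
  min (n + 1) (⌊s * (n + 1) / T⌋₊ + 1)

/-- The points of the grid. -/
noncomputable def gridPoint (T : ℝ≥0) (n k : ℕ) : ℝ≥0 := k * T / (n + 1)

theorem gridPoint_mono (T : ℝ≥0) (n : ℕ) : Monotone (gridPoint T n) := by
  intro k l hkl
  have : (k : ℝ≥0) ≤ l := by exact_mod_cast hkl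
  unfold gridPoint
  gcongr

theorem gridPoint_last (T : ℝ≥0) (n : ℕ) : gridPoint T n (n + 1) = T := by
  unfold gridPoint
  push_cast
  field_simp

theorem gridPoint_le (T : ℝ≥0) {n k : ℕ} (hk : k ≤ n + 1) : gridPoint T n k ≤ T :=
  (gridPoint_mono T n hk).trans_eq (gridPoint_last T n)

theorem gridPoint_le_iff {T : ℝ≥0} (hT : 0 < T) {n k : ℕ} (hk : k < n + 1) (s : ℝ≥0) :
    gridPoint T n k ≤ s ↔ k < gridIndex T n s := by
  rw [gridIndex, lt_min_iff, and_iff_right hk, Nat.lt_succ_iff, Nat.le_floor_iff zero_le, gridPoint,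
    div_le_iff₀ (by positivity), le_div_iff₀ hT]

theorem tendsto_gridPoint {T : ℝ≥0} (hT : 0 < T) {s : ℝ≥0} (hs : s ≤ T) :
    Tendsto (fun n => gridPoint T n (gridIndex T n s)) atTop (𝓝 s) := by
  have h : Tendsto (fun n : ℕ => s + T * ((n : ℝ≥0) + 1)⁻¹) atTop (𝓝 s) := by
    have h1 := (tendsto_inv_atTop_nhds_zero_nat (𝕜 := ℝ≥0)).comp (tendsto_add_atTop_nat 1)
    have h2 : Tendsto (fun n : ℕ => ((n : ℝ≥0) + 1)⁻¹) atTop (𝓝 0) := by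
      simpa [Function.comp_def] using h1
    simpa using (h2.const_mul T).const_add s
  refine tendsto_of_tendsto_of_tendsto_of_le_of_le tendsto_const_nhds h (fun n => ?_) fun n => ?_
  · rcases le_total (n + 1) (⌊s * (n + 1) / T⌋₊ + 1) with hle | hle
    · rw [gridIndex, min_eq_left hle, gridPoint_last]
      exact hs
    · rw [gridIndex, min_eq_right hle, gridPoint, le_div_iff₀ (by positivity), ← div_le_iff₀ hT]
      push_cast
      exact (Nat.lt_floor_add_one _).le
  · have h1 : ((gridIndex T n s : ℕ) : ℝ≥0) ≤ s * (n + 1) / T + 1 := by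
      refine (Nat.cast_le.2 (min_le_right _ _)).trans ?_
      push_cast
      gcongr
      exact Nat.floor_le zero_le
    calc gridPoint T n (gridIndex T n s) ≤ (s * (n + 1) / T + 1) * T / (n + 1) := by
          unfold gridPoint
          gcongr
      _ = s + T * ((n : ℝ≥0) + 1)⁻¹ := by
          field_simp

/-- Optional stopping at a bounded time for a continuous martingale. -/
theorem integral_stopped_eq (hM : Martingale M 𝓕 P) (hc : ∀ ω, Continuous fun t => M t ω)
    (T : ℝ≥0) {C : ℝ} (hC : ∀ t ≤ T, ∀ ω, |M t ω| ≤ C) {τ : Ω → ℝ≥0∞}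
    (hτ : ∀ t : ℝ≥0, MeasurableSet[𝓕 t] {ω | τ ω < t}) :
    ∫ ω, M (min (τ ω) T).toNNReal ω ∂P = ∫ ω, M 0 ω ∂P := by
  rcases eq_or_ne T 0 with rfl | hT0
  · simp
  have hT : 0 < T := pos_iff_ne_zero.2 hT0
  set S : Ω → ℝ≥0 := fun ω => (min (τ ω) T).toNNReal
  have hSle : ∀ ω, S ω ≤ T := fun ω => by
    rw [← ENNReal.coe_le_coe, ENNReal.coe_toNNReal
      (ne_top_of_le_ne_top ENNReal.coe_ne_top (min_le_right _ _))]
    exact min_le_right _ _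
  have hMm : ∀ t, Measurable (M t) := fun t => ((hM.1 t).mono (𝓕.le t)).measurable
  -- The grid point strictly after `S` is used so that continuing past `t_k` means `τ < t_k` fails;
  -- this event is in `𝓕 (t_k)` by `hτ`.
  have hmem : ∀ (n k : ℕ), k < n + 1 → ∀ ω,
      k < gridIndex T n (S ω) ↔ ¬ τ ω < gridPoint T n k := by
    intro n k hk ω
    rw [← gridPoint_le_iff hT hk, not_lt]
    have hle := gridPoint_le T hk.le
    have htop : min (τ ω) T ≠ ⊤ := ne_top_of_le_ne_top ENNReal.coe_ne_top (min_le_right _ _)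
    rw [← ENNReal.coe_le_coe, ENNReal.coe_toNNReal htop, le_min_iff]
    simp [hle]
  -- Telescoping along the grid: each increment is multiplied by the indicator of an event known at
  -- its left end, so it has mean zero.
  have hsum : ∀ (n : ℕ) ω, M (gridPoint T n (gridIndex T n (S ω))) ω = M 0 ω +
      ∑ k ∈ Finset.range (n + 1), {ω | ¬ τ ω < gridPoint T n k}.indicator
        (fun ω => M (gridPoint T n (k + 1)) ω - M (gridPoint T n k) ω) ω := by
    intro n ω
    have h1 : ∑ k ∈ Finset.range (n + 1), {ω | ¬ τ ω < gridPoint T n k}.indicator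
        (fun ω => M (gridPoint T n (k + 1)) ω - M (gridPoint T n k) ω) ω =
        ∑ k ∈ Finset.range (gridIndex T n (S ω)),
          (M (gridPoint T n (k + 1)) ω - M (gridPoint T n k) ω) := by
      have hsub : Finset.range (gridIndex T n (S ω)) ⊆ Finset.range (n + 1) :=
        Finset.range_subset_range.2 (min_le_left _ _)
      rw [← Finset.sum_subset_zero_on_sdiff hsub]
      · intro k hk
        rw [Finset.mem_sdiff, Finset.mem_range, Finset.mem_range] at hk
        refine indicator_of_notMem (fun h => hk.2 ((hmem n k hk.1 ω).2 h)) _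
      · intro k hk
        have hk' := Finset.mem_range.1 (hsub hk)
        have hmk : ω ∈ {ω | ¬ τ ω < gridPoint T n k} :=
          (hmem n k hk' ω).1 (Finset.mem_range.1 hk)
        rw [indicator_of_mem hmk]
    rw [h1, Finset.sum_range_sub (fun k => M (gridPoint T n k) ω)]
    simp [gridPoint]
  have hA : ∀ n k, MeasurableSet[𝓕 (gridPoint T n k)] {ω | ¬ τ ω < gridPoint T n k} := fun n k =>
    (hτ _).compl
  have hexp : ∀ n, ∫ ω, M (gridPoint T n (gridIndex T n (S ω))) ω ∂P = ∫ ω, M 0 ω ∂P := by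
    intro n
    have hi : ∀ k, Integrable (fun ω => {ω | ¬ τ ω < gridPoint T n k}.indicator
        (fun ω => M (gridPoint T n (k + 1)) ω - M (gridPoint T n k) ω) ω) P := fun k =>
      ((hM.integrable _).sub (hM.integrable _)).indicator (𝓕.le _ _ (hA n k))
    simp only [hsum]
    rw [integral_add (hM.integrable 0) (integrable_finsetSum _ fun k _ => hi k),
      integral_finsetSum _ fun k _ => hi k]
    rw [Finset.sum_eq_zero, add_zero]
    intro k _
    rw [integral_indicator (𝓕.le _ _ (hA n k)), integral_sub (hM.integrable _).integrableOn
      (hM.integrable _).integrableOn,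
      hM.setIntegral_eq (gridPoint_mono T n (Nat.le_succ k)) (hA n k), sub_self]
  -- Grid points converge to `S` from the right; continuity of the paths and the bound `C` allow
  -- dominated convergence.
  have hlim : Tendsto (fun n => ∫ ω, M (gridPoint T n (gridIndex T n (S ω))) ω ∂P) atTop
      (𝓝 (∫ ω, M (S ω) ω ∂P)) := by
    refine tendsto_integral_of_dominated_convergence (fun _ => C) (fun n => ?_) (integrable_const _)
      (fun n => Eventually.of_forall fun ω => ?_) (Eventually.of_forall fun ω => ?_)
    · simp only [hsum]
      refine ((hMm 0).add (Finset.measurable_sum _ fun k _ => ?_)).aestronglyMeasurable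
      exact ((hMm _).sub (hMm _)).indicator (𝓕.le _ _ (hA n k))
    · exact hC _ (gridPoint_le T (min_le_left _ _)) ω
    · exact ((hc ω).tendsto _).comp (tendsto_gridPoint hT (hSle ω))
  simp only [hexp] at hlim
  exact tendsto_nhds_unique hlim tendsto_const_nhds

end OptionalStopping

/-! ### Discounting a stopped path -/

section Discounting

/-- Integration by parts for a path stopped at `S`. -/
theorem discounted_stopped_eq {y L : ℝ → ℝ} (hy : Continuous y) {r S T : ℝ} (hS : 0 ≤ S)
    (hST : S ≤ T) (hL : ∀ u ∈ Icc 0 T, L u = y (min u S) - ∫ s in (0 : ℝ)..min u S, r * y s) :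
    Real.exp (-r * T) * L T + ∫ u in (0 : ℝ)..T, r * Real.exp (-r * u) * L u =
      Real.exp (-r * S) * y S := by
  set Y : ℝ → ℝ := fun u => ∫ s in (0 : ℝ)..u, r * y s
  have hry : Continuous fun s => r * y s := hy.const_mul r
  have hY : ∀ u, HasDerivAt Y (r * y u) u := fun u =>
    intervalIntegral.integral_hasDerivAt_right (hry.intervalIntegrable _ _)
      hry.aestronglyMeasurable.stronglyMeasurableAtFilter hry.continuousAt
  have hYc : Continuous Y := continuous_iff_continuousAt.2 fun u => (hY u).continuousAt
  have hE : ∀ u, HasDerivAt (fun u => Real.exp (-r * u)) (-r * Real.exp (-r * u)) u := fun u => by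
    have := ((hasDerivAt_id u).const_mul (-r)).exp
    simpa [mul_comm] using this
  have hEc : Continuous fun u => Real.exp (-r * u) := by fun_prop
  -- Before `S` the integrand is the derivative of `exp (-r u) * Y u`, because `Y' = r y`.
  have h1 : ∫ u in (0 : ℝ)..S, r * Real.exp (-r * u) * L u = Real.exp (-r * S) * Y S := by
    have hcongr : ∫ u in (0 : ℝ)..S, r * Real.exp (-r * u) * L u =
        ∫ u in (0 : ℝ)..S, (-r * Real.exp (-r * u) * Y u + Real.exp (-r * u) * (r * y u)) := by
      refine intervalIntegral.integral_congr fun u hu => ?_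
      rw [uIcc_of_le hS] at hu
      rw [hL u ⟨hu.1, hu.2.trans hST⟩, min_eq_left hu.2]
      ring
    rw [hcongr, intervalIntegral.integral_eq_sub_of_hasDerivAt
      (f := fun u => Real.exp (-r * u) * Y u) (fun u _ => (hE u).mul (hY u))]
    · simp [Y]
    · exact Continuous.intervalIntegrable (by fun_prop) _ _
  -- After `S` the stopped process is frozen at `y S - Y S`.
  have h2 : ∫ u in S..T, r * Real.exp (-r * u) * L u =
      (Real.exp (-r * S) - Real.exp (-r * T)) * (y S - Y S) := by
    have hcongr : ∫ u in S..T, r * Real.exp (-r * u) * L u =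
        ∫ u in S..T, r * Real.exp (-r * u) * (y S - Y S) := by
      refine intervalIntegral.integral_congr fun u hu => ?_
      rw [uIcc_of_le hST] at hu
      rw [hL u ⟨hS.trans hu.1, hu.2⟩, min_eq_right hu.1]
    rw [hcongr, intervalIntegral.integral_mul_const]
    congr 1
    rw [intervalIntegral.integral_eq_sub_of_hasDerivAt (f := fun u => -Real.exp (-r * u))
      (fun u _ => by simpa using (hE u).fun_neg) (Continuous.intervalIntegrable (by fun_prop) _ _)]
    ring
  have hi1 : IntervalIntegrable (fun u => r * Real.exp (-r * u) * L u) volume 0 S := by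
    refine (Continuous.intervalIntegrable (u := fun u => r * Real.exp (-r * u) * (y u - Y u))
      (by fun_prop) 0 S).congr fun u hu => ?_
    rw [uIoc_of_le hS] at hu
    rw [hL u ⟨hu.1.le, hu.2.trans hST⟩, min_eq_left hu.2]
  have hi2 : IntervalIntegrable (fun u => r * Real.exp (-r * u) * L u) volume S T := by
    refine (Continuous.intervalIntegrable (u := fun u => r * Real.exp (-r * u) * (y S - Y S))
      (by fun_prop) S T).congr fun u hu => ?_
    rw [uIoc_of_le hST] at hu
    rw [hL u ⟨hS.trans hu.1.le, hu.2⟩, min_eq_right hu.1.le]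
  rw [← intervalIntegral.integral_add_adjacent_intervals hi1 hi2, h1, h2,
    hL T ⟨hS.trans hST, le_rfl⟩, min_eq_right hST]
  simp only [Y]
  ring

end Discounting

/-! ### Dynkin's formula, plain and discounted -/

section Dynkin

/-- The generator `(1/2) α f'' + β f'`. -/
noncomputable def generator (α β f : ℝ → ℝ) (y : ℝ) : ℝ :=
  1 / 2 * α y * deriv (deriv f) y + β y * deriv f y

theorem continuous_generator {α β f : ℝ → ℝ} (hα : Continuous α) (hβ : Continuous β)
    (hf : ContDiff ℝ (⊤ : ℕ∞) f) : Continuous (generator α β f) := by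
  have h1 : ContDiff ℝ (⊤ : ℕ∞) (deriv f) := (contDiff_infty_iff_deriv.1 hf).2
  have h2 : Continuous (deriv (deriv f)) := h1.continuous_deriv (by simp)
  have h3 := h1.continuous
  unfold generator
  fun_prop

theorem hasCompactSupport_generator {α β f : ℝ → ℝ} (hf : HasCompactSupport f) :
    HasCompactSupport (generator α β f) :=
  (hf.deriv.deriv.mul_left (f := fun y => 1 / 2 * α y)).add (hf.deriv.mul_left (f := β))

variable {Ω : Type*} [MeasurableSpace Ω] {D : RegularDiffusion Ω} {h α β f : ℝ → ℝ}

/-- The martingale `f (Y t) - ∫₀ᵗ A f (Y s) ds`. -/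
noncomputable def dynkinMartingale (D : RegularDiffusion Ω) (h α β f : ℝ → ℝ) (x t : ℝ≥0) (ω : Ω) : ℝ :=
  f (h (D.path x ω t)) - ∫ s in (0 : ℝ)..t, generator α β f (h (D.path x ω s.toNNReal))

theorem continuous_dynkinMartingale (hh : Continuous h) (hα : Continuous α) (hβ : Continuous β)
    (hf : ContDiff ℝ (⊤ : ℕ∞) f) (x : ℝ≥0) (ω : Ω) :
    Continuous fun t => dynkinMartingale D h α β f x t ω := by
  have hp := D.continuous_path' x ω
  have hg := continuous_generator hα hβ hf
  have hfc := hf.continuous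
  have h1 : Continuous fun s : ℝ => generator α β f (h (D.path x ω s.toNNReal)) := by fun_prop
  have h2 : Continuous fun t : ℝ => ∫ s in (0 : ℝ)..t, generator α β f (h (D.path x ω s.toNNReal)) :=
    intervalIntegral.continuous_primitive (fun a b => h1.intervalIntegrable a b) 0
  unfold dynkinMartingale
  fun_prop

theorem exists_bound_dynkinMartingale (hα : Continuous α) (hβ : Continuous β)
    (hf : ContDiff ℝ (⊤ : ℕ∞) f) (hfs : HasCompactSupport f) (x T : ℝ≥0) :
    ∃ C, ∀ t ≤ T, ∀ ω, |dynkinMartingale D h α β f x t ω| ≤ C := by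
  obtain ⟨A, hA⟩ := hfs.exists_bound_of_continuous hf.continuous
  obtain ⟨B, hB⟩ := (hasCompactSupport_generator (α := α) (β := β) hfs).exists_bound_of_continuous
    (continuous_generator hα hβ hf)
  refine ⟨A + B * T, fun t ht ω => (abs_sub _ _).trans (add_le_add (hA _) ?_)⟩
  refine (intervalIntegral.norm_integral_le_of_norm_le_const fun s _ => hB _).trans ?_
  rw [sub_zero, abs_of_nonneg t.coe_nonneg]
  exact mul_le_mul_of_nonneg_left ht ((norm_nonneg _).trans (hB 0))

/-- The hitting time of `C`, capped at `T`. -/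
noncomputable def cappedHit (D : RegularDiffusion Ω) (C : Set ℝ≥0) (x T : ℝ≥0) (ω : Ω) : ℝ≥0 :=
  (min (hitTime (D.path x ω) C) T).toNNReal

theorem coe_cappedHit (C : Set ℝ≥0) (x T : ℝ≥0) (ω : Ω) :
    (cappedHit D C x T ω : ℝ≥0∞) = min (hitTime (D.path x ω) C) T :=
  ENNReal.coe_toNNReal (ne_top_of_le_ne_top ENNReal.coe_ne_top (min_le_right _ _))

theorem cappedHit_le (C : Set ℝ≥0) (x T : ℝ≥0) (ω : Ω) : cappedHit D C x T ω ≤ T := by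
  rw [← ENNReal.coe_le_coe, coe_cappedHit]
  exact min_le_right _ _

theorem cappedHit_le_hitTime (C : Set ℝ≥0) (x T : ℝ≥0) (ω : Ω) :
    (cappedHit D C x T ω : ℝ≥0∞) ≤ hitTime (D.path x ω) C := by
  rw [coe_cappedHit]
  exact min_le_left _ _

theorem cappedHit_of_le (C : Set ℝ≥0) (x : ℝ≥0) {u T : ℝ≥0} (huT : u ≤ T) (ω : Ω) :
    cappedHit D C x u ω = min u (cappedHit D C x T ω) := by
  rw [← ENNReal.coe_inj, ENNReal.coe_min, coe_cappedHit, coe_cappedHit, min_comm (u : ℝ≥0∞),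
    min_assoc, min_eq_right (ENNReal.coe_le_coe.2 huT)]

theorem measurable_cappedHit {C : Set ℝ≥0} (hC : IsClosed C) (x T : ℝ≥0) :
    Measurable (cappedHit D C x T) :=
  ((D.measurable_hitTime hC x).min measurable_const).ennreal_toNNReal

/-- Dynkin's formula up to a capped hitting time. -/
theorem integral_dynkinMartingale_cappedHit (hsol : SolvesMartingaleProblem D h α β)
    (hh : Continuous h) (hα : Continuous α) (hβ : Continuous β) (hf : ContDiff ℝ (⊤ : ℕ∞) f)
    (hfs : HasCompactSupport f) {C : Set ℝ≥0} (hC : IsClosed C) (x T : ℝ≥0) :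
    ∫ ω, dynkinMartingale D h α β f x (cappedHit D C x T ω) ω ∂D.P = f (h x) := by
  have hM : Martingale (dynkinMartingale D h α β f x) (D.filtration x) D.P := hsol x f hf hfs
  obtain ⟨B, hB⟩ := exists_bound_dynkinMartingale (D := D) (h := h) hα hβ hf hfs x T
  have h1 := integral_stopped_eq hM (continuous_dynkinMartingale hh hα hβ hf x) T hB
    (τ := fun ω => hitTime (D.path x ω) C) fun t =>
      measurableSet_hitTime_lt (m := D.filtration x t) (D.continuous_path x) hC t
        fun s hs => D.measurable_filtration x hs
  unfold cappedHit
  rw [h1]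
  simp [dynkinMartingale]

theorem measurable_uncurry_dynkinMartingale (hsol : SolvesMartingaleProblem D h α β)
    (hh : Continuous h) (hα : Continuous α) (hβ : Continuous β) (hf : ContDiff ℝ (⊤ : ℕ∞) f)
    (hfs : HasCompactSupport f) (x : ℝ≥0) :
    Measurable (Function.uncurry (dynkinMartingale D h α β f x)) := by
  have hM : Martingale (dynkinMartingale D h α β f x) (D.filtration x) D.P := hsol x f hf hfs
  exact measurable_uncurry_of_continuous_of_measurable (continuous_dynkinMartingale hh hα hβ hf x)
    fun t => ((hM.1 t).mono ((D.filtration x).le t)).measurable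

theorem integrable_comp_cappedHit (hh : Continuous h) (hf : Continuous f)
    (hfs : HasCompactSupport f) {C : Set ℝ≥0} (hC : IsClosed C) (x T : ℝ≥0) :
    Integrable (fun ω => f (h (D.path x ω (cappedHit D C x T ω)))) D.P := by
  obtain ⟨A, hA⟩ := hfs.exists_bound_of_continuous hf
  have h1 : Measurable fun ω => D.path x ω (cappedHit D C x T ω) :=
    measurable_apply_random_time (D.measurable_X x) (D.continuous_path x)
      (measurable_cappedHit hC x T)
  have h2 : Continuous fun y : ℝ≥0 => f (h y) := by fun_prop
  exact Integrable.of_bound (h2.measurable.comp h1).aestronglyMeasurable A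
    (Eventually.of_forall fun ω => hA _)

/-- The submartingale inequality for functions that are subharmonic along the stopped path. -/
theorem le_integral_comp_cappedHit (hsol : SolvesMartingaleProblem D h α β)
    (hh : Continuous h) (hα : Continuous α) (hβ : Continuous β) (hf : ContDiff ℝ (⊤ : ℕ∞) f)
    (hfs : HasCompactSupport f) {C : Set ℝ≥0} (hC : IsClosed C) (x T : ℝ≥0)
    (hgen : ∀ ω (s : ℝ≥0), (s : ℝ≥0∞) ≤ hitTime (D.path x ω) C →
      0 ≤ generator α β f (h (D.path x ω s))) :
    f (h x) ≤ ∫ ω, f (h (D.path x ω (cappedHit D C x T ω))) ∂D.P := by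
  rw [← integral_dynkinMartingale_cappedHit hsol hh hα hβ hf hfs hC x T]
  obtain ⟨B, hB⟩ := exists_bound_dynkinMartingale (D := D) (h := h) hα hβ hf hfs x T
  refine integral_mono (Integrable.of_bound ?_ B ?_)
    (integrable_comp_cappedHit hh hf.continuous hfs hC x T) fun ω => ?_
  · exact ((measurable_uncurry_dynkinMartingale hsol hh hα hβ hf hfs x).comp
      ((measurable_cappedHit hC x T).prodMk measurable_id)).aestronglyMeasurable
  · exact Eventually.of_forall fun ω => hB _ (cappedHit_le C x T ω) ω
  · refine sub_le_self _ (intervalIntegral.integral_nonneg (NNReal.coe_nonneg _) fun s hs => ?_)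
    refine hgen ω _ (le_trans ?_ (cappedHit_le_hitTime C x T ω))
    exact ENNReal.coe_le_coe.2 (Real.toNNReal_le_iff_le_coe.2 hs.2)

/-- The discounted version of Dynkin's formula, for functions with `A f = r f` along the stopped
path. -/
theorem integral_discounted_comp_cappedHit (hsol : SolvesMartingaleProblem D h α β)
    (hh : Continuous h) (hα : Continuous α) (hβ : Continuous β) (hf : ContDiff ℝ (⊤ : ℕ∞) f)
    (hfs : HasCompactSupport f) {C : Set ℝ≥0} (hC : IsClosed C) (x T : ℝ≥0) {r : ℝ}
    (hgen : ∀ ω (s : ℝ≥0), (s : ℝ≥0∞) ≤ hitTime (D.path x ω) C →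
      generator α β f (h (D.path x ω s)) = r * f (h (D.path x ω s))) :
    ∫ ω, Real.exp (-r * cappedHit D C x T ω) * f (h (D.path x ω (cappedHit D C x T ω))) ∂D.P =
      f (h x) := by
  set M := dynkinMartingale D h α β f x
  set S := cappedHit D C x T
  have hS : Measurable S := measurable_cappedHit hC x T
  have hMm : Measurable (Function.uncurry M) :=
    measurable_uncurry_dynkinMartingale hsol hh hα hβ hf hfs x
  obtain ⟨B, hB⟩ := exists_bound_dynkinMartingale (D := D) (h := h) hα hβ hf hfs x T
  -- The stopped martingale. The discounted stopped value is a linear functional of its path, and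
  -- its mean does not depend on the time.
  set L : ℝ → Ω → ℝ := fun u ω => M (min u.toNNReal (S ω)) ω
  have hLm : Measurable (Function.uncurry L) :=
    hMm.comp (((measurable_real_toNNReal.comp measurable_fst).min (hS.comp measurable_snd)).prodMk
      measurable_snd)
  have hLb : ∀ u ω, |L u ω| ≤ B := fun u ω =>
    hB _ ((min_le_right _ _).trans (cappedHit_le C x T ω)) ω
  have hLi : ∀ u, Integrable (L u) D.P := fun u =>
    Integrable.of_bound (hLm.comp measurable_prodMk_left).aestronglyMeasurable B
      (Eventually.of_forall fun ω => hLb u ω)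
  have hLe : ∀ u ∈ Icc (0 : ℝ) T, ∫ ω, L u ω ∂D.P = f (h x) := by
    intro u hu
    rw [← integral_dynkinMartingale_cappedHit hsol hh hα hβ hf hfs hC x u.toNNReal]
    refine integral_congr_ae (Eventually.of_forall fun ω => ?_)
    simp only [L, M, S]
    rw [cappedHit_of_le C x (Real.toNNReal_le_iff_le_coe.2 hu.2)]
  have hpath : ∀ ω, Real.exp (-r * T) * L T ω + ∫ u in (0 : ℝ)..T, r * Real.exp (-r * u) * L u ω =
      Real.exp (-r * S ω) * f (h (D.path x ω (S ω))) := by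
    intro ω
    have hp := D.continuous_path' x ω
    have hfc := hf.continuous
    have hy : Continuous fun s : ℝ => f (h (D.path x ω s.toNNReal)) := by fun_prop
    have h1 := discounted_stopped_eq (L := fun u => L u ω) hy (r := r) (S ω).coe_nonneg
      (NNReal.coe_le_coe.2 (cappedHit_le C x T ω)) fun u hu => ?_
    · simpa only [Real.toNNReal_coe] using h1
    · have hmin : ((min u.toNNReal (S ω) : ℝ≥0) : ℝ) = min u (S ω) := by
        rw [NNReal.coe_min, Real.coe_toNNReal u hu.1]
      have hmin' : min u.toNNReal (S ω) = (min u (S ω)).toNNReal := by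
        rw [← hmin, Real.toNNReal_coe]
      simp only [L, M, dynkinMartingale]
      rw [hmin, hmin']
      congr 1
      refine intervalIntegral.integral_congr fun s hs => ?_
      rw [uIcc_of_le (le_min hu.1 (NNReal.coe_nonneg _))] at hs
      refine hgen ω _ (le_trans ?_ (cappedHit_le_hitTime C x T ω))
      exact ENNReal.coe_le_coe.2 (Real.toNNReal_le_iff_le_coe.2 (hs.2.trans (min_le_right _ _)))
  have hT : (0 : ℝ) ≤ T := T.coe_nonneg
  -- Fubini's theorem lets the mean pass inside the time integral. As every `L u` has mean `f (h
  -- x)`, the total weight is `exp (-r T) + ∫ r exp (-r u) du = 1`.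
  have hprod : Integrable (Function.uncurry fun (u : ℝ) (ω : Ω) => r * Real.exp (-r * u) * L u ω)
      ((volume.restrict (Ioc (0 : ℝ) T)).prod D.P) := by
    have hE : Integrable (fun u => r * Real.exp (-r * u)) (volume.restrict (Ioc (0 : ℝ) T)) :=
      (Continuous.integrableOn_Icc (by fun_prop)).mono_set Ioc_subset_Icc_self
    exact (hE.comp_fst D.P).mul_bdd (c := B) hLm.aestronglyMeasurable
      (Eventually.of_forall fun z => hLb z.1 z.2)
  simp only [← hpath, intervalIntegral.integral_of_le hT]
  have hi2 : Integrable (fun ω => ∫ u in Ioc (0 : ℝ) T, r * Real.exp (-r * u) * L u ω) D.P :=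
    hprod.integral_prod_right
  rw [integral_add ((hLi T).const_mul _) hi2, integral_const_mul,
    hLe T ⟨hT, le_rfl⟩, ← integral_integral_swap hprod, ← intervalIntegral.integral_of_le hT]
  have h2 : ∫ u in (0 : ℝ)..T, ∫ ω, r * Real.exp (-r * u) * L u ω ∂D.P =
      ∫ u in (0 : ℝ)..T, r * Real.exp (-r * u) * f (h x) := by
    refine intervalIntegral.integral_congr fun u hu => ?_
    rw [uIcc_of_le hT] at hu
    rw [integral_const_mul, hLe u hu]
  have h3 : ∀ u : ℝ, HasDerivAt (fun u => -Real.exp (-r * u)) (r * Real.exp (-r * u)) u := by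
    intro u
    have := (((hasDerivAt_id u).const_mul (-r)).exp).fun_neg
    simpa [mul_comm] using this
  rw [h2, intervalIntegral.integral_mul_const, intervalIntegral.integral_eq_sub_of_hasDerivAt
    (fun u _ => h3 u) (Continuous.intervalIntegrable (by fun_prop) _ _)]
  simp
  ring

end Dynkin

/-! ### Confinement of paths before a hitting time, and localization -/

section Confinement

theorem exists_apply_eq_of_gt {w : ℝ≥0 → ℝ≥0} (hw : Continuous w) {b s : ℝ≥0} (h0 : w 0 < b)
    (hs : b ≤ w s) : ∃ u, 0 < u ∧ u ≤ s ∧ w u = b := by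
  obtain ⟨u, hu, hub⟩ := intermediate_value_Icc (zero_le : 0 ≤ s) hw.continuousOn ⟨h0.le, hs⟩
  refine ⟨u, pos_iff_ne_zero.2 ?_, hu.2, hub⟩
  rintro rfl
  exact h0.ne hub

/-- To exceed `b` the path would have to cross `b` earlier, and that crossing is already a hit of
`C`. -/
theorem apply_le_of_le_hitTime {w : ℝ≥0 → ℝ≥0} (hw : Continuous w) {C : Set ℝ≥0} {b s : ℝ≥0}
    (h0 : w 0 < b) (hb : b ∈ C) (hs : (s : ℝ≥0∞) ≤ hitTime w C) : w s ≤ b := by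
  by_contra hlt
  rw [not_le] at hlt
  obtain ⟨u, hu0, hus, hub⟩ := exists_apply_eq_of_gt hw h0 hlt.le
  have hne : u ≠ s := fun h => hlt.ne (by rw [← hub, h])
  have h1 := hs.trans (hitTime_le hu0 (hub ▸ hb))
  exact absurd (ENNReal.coe_le_coe.1 h1) (not_le.2 (lt_of_le_of_ne hus hne))

theorem le_apply_of_le_hitTime {w : ℝ≥0 → ℝ≥0} (hw : Continuous w) {C : Set ℝ≥0} {b s : ℝ≥0}
    (h0 : b < w 0) (hb : b ∈ C) (hs : (s : ℝ≥0∞) ≤ hitTime w C) : b ≤ w s := by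
  by_contra hlt
  rw [not_le] at hlt
  obtain ⟨u, hu0, hus, hub⟩ := exists_apply_eq_of_lt hw h0 hlt.le
  have hne : u ≠ s := fun h => hlt.ne (by rw [← hub, h])
  have h1 := hs.trans (hitTime_le hu0 (hub ▸ hb))
  exact absurd (ENNReal.coe_le_coe.1 h1) (not_le.2 (lt_of_le_of_ne hus hne))

theorem le_hitTime_exit {w : ℝ≥0 → ℝ≥0} (hw : Continuous w) {a T b : ℝ≥0} (ha : a < w 0)
    (hT : (T : ℝ≥0∞) ≤ hitTime w {a}) (hb : ∀ s ≤ T, w s < b) :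
    (T : ℝ≥0∞) ≤ hitTime w (Iic a ∪ Ici b) := by
  refine le_hitTime fun s _ hs => ?_
  rcases hs with hs | hs
  · obtain ⟨u, hu0, hus, hua⟩ := exists_apply_eq_of_lt hw ha hs
    exact hT.trans ((hitTime_le hu0 hua).trans (ENNReal.coe_le_coe.2 hus))
  · by_contra hlt
    exact absurd (hb s (ENNReal.coe_lt_coe.1 (not_le.1 hlt)).le) (not_lt.2 hs)

/-- Localization of a smooth function to a compactly supported one. -/
theorem exists_compactSupport_eventuallyEq {U : ℝ → ℝ} {l p q : ℝ}
    (hU : ContDiffOn ℝ (⊤ : ℕ∞) U (Ioi l)) (hlp : l < p) :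
    ∃ f : ℝ → ℝ, ContDiff ℝ (⊤ : ℕ∞) f ∧ HasCompactSupport f ∧ ∀ y ∈ Icc p q, f =ᶠ[𝓝 y] U := by
  rcases lt_or_ge q p with hqp | hpq
  · exact ⟨0, contDiff_zero_fun, HasCompactSupport.zero, fun y hy =>
      absurd (hy.1.trans hy.2) (not_le.2 hqp)⟩
  -- The inner radius exceeds `(q - p) / 2`, so the bump equals `1` near every point of `[p, q]`;
  -- the outer ball ends on the left at `(p + l) / 2`, inside the domain of smoothness.
  let b : ContDiffBump ((p + q) / 2) := ⟨(q - p) / 2 + (p - l) / 4, (q - p) / 2 + (p - l) / 2,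
    by linarith, by linarith⟩
  refine ⟨fun y => b y * U y, contDiff_iff_contDiffAt.2 fun y => ?_,
    b.hasCompactSupport.mul_right, fun y hy => ?_⟩
  · by_cases h1 : y ∈ tsupport b
    swap
    · have h2 : (fun y => b y * U y) =ᶠ[𝓝 y] fun _ => 0 := by
        filter_upwards [notMem_tsupport_iff_eventuallyEq.1 h1] with z hz
        simp [hz]
      exact contDiffAt_const.congr_of_eventuallyEq h2
    rw [b.tsupport_eq, Real.closedBall_eq_Icc] at h1
    have h2 : l < y := by
      have := h1.1
      simp only [b] at this
      linarith
    exact b.contDiff.contDiffAt.mul ((hU y h2).contDiffAt (Ioi_mem_nhds h2))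
  · have h1 : y ∈ Metric.ball ((p + q) / 2) b.rIn := by
      rw [Real.ball_eq_Ioo]
      simp only [b]
      exact ⟨by linarith [hy.1], by linarith [hy.2]⟩
    filter_upwards [Metric.isOpen_ball.mem_nhds h1] with z hz
    rw [b.one_of_mem_closedBall (Metric.ball_subset_closedBall hz), one_mul]

theorem generator_congr {α β f U : ℝ → ℝ} {y : ℝ} (h : f =ᶠ[𝓝 y] U) :
    generator α β f y = generator α β U y := by
  unfold generator
  rw [h.deriv_eq, h.deriv.deriv_eq]

end Confinement

/-! ### Laplace transforms from solutions of `A U = r U` -/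

section Laplace

variable {Ω : Type*} [MeasurableSpace Ω] {D : RegularDiffusion Ω} {h α β : ℝ → ℝ}

/-- The Laplace transform of the hitting time of a lower level, in terms of a bounded solution of
`A U = r U`. -/
theorem hitLaplace_mul_eq (hsol : SolvesMartingaleProblem D h α β) (hh : Continuous h)
    (hmono : MonotoneOn h (Ici 0)) (hα : Continuous α) (hβ : Continuous β) {U : ℝ → ℝ}
    (hU : ContDiffOn ℝ (⊤ : ℕ∞) U (Ioi 0)) {r a x : ℝ≥0} (hr : 0 < r)
    (hgen : ∀ y > 0, generator α β U y = r * U y) (hha : 0 < h a) (hax : a < x) {B : ℝ}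
    (hB : ∀ y : ℝ≥0, a ≤ y → |U (h y)| ≤ B) : hitLaplace D r a x * U (h a) = U (h x) := by
  -- Stopping also at the high level `n` confines the process to a compact interval, on which `U`
  -- can be replaced by a compactly supported function.
  set C : ℕ → Set ℝ≥0 := fun n => Iic a ∪ Ici (n : ℝ≥0)
  have hC : ∀ n, IsClosed (C n) := fun n => isClosed_Iic.union isClosed_Ici
  set S : ℕ → Ω → ℝ≥0 := fun n ω => cappedHit D (C n) x n ω
  set Z : ℕ → Ω → ℝ := fun n ω => Real.exp (-r * S n ω) * U (h (D.path x ω (S n ω)))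
  have hw := D.continuous_path' x
  have hlow : ∀ n ω (s : ℝ≥0), (s : ℝ≥0∞) ≤ hitTime (D.path x ω) (C n) → a ≤ D.path x ω s :=
    fun n ω s hs => le_apply_of_le_hitTime (hw ω) (by simpa using hax) (show a ∈ C n from Or.inl self_mem_Iic) hs
  have hS : ∀ n ω, a ≤ D.path x ω (S n ω) := fun n ω =>
    hlow n ω _ (cappedHit_le_hitTime (C n) x n ω)
  have hZ : ∀ᶠ n : ℕ in atTop, ∫ ω, Z n ω ∂D.P = U (h x) ∧
      AEStronglyMeasurable (Z n) D.P := by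
    obtain ⟨N, hN⟩ := exists_nat_gt x
    filter_upwards [eventually_ge_atTop N] with n hn
    have hxn : x < n := hN.trans_le (by exact_mod_cast hn)
    obtain ⟨f, hf, hfs, hfU⟩ := exists_compactSupport_eventuallyEq (q := h n) hU hha
    have hmem : ∀ ω (s : ℝ≥0), (s : ℝ≥0∞) ≤ hitTime (D.path x ω) (C n) →
        h (D.path x ω s) ∈ Icc (h a) (h n) := fun ω s hs =>
      ⟨hmono a.coe_nonneg (NNReal.coe_nonneg _) (NNReal.coe_le_coe.2 (hlow n ω s hs)),
        hmono (NNReal.coe_nonneg _) (mem_Ici.2 (Nat.cast_nonneg n)) (by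
          have := apply_le_of_le_hitTime (hw ω) (by simpa using hxn) (show (n : ℝ≥0) ∈ C n from
            Or.inr self_mem_Ici) hs
          exact_mod_cast this)⟩
    have hZf : Z n = fun ω => Real.exp (-r * S n ω) * f (h (D.path x ω (S n ω))) := by
      funext ω
      rw [(hfU _ (hmem ω _ (cappedHit_le_hitTime (C n) x n ω))).eq_of_nhds]
    rw [hZf]
    constructor
    · refine (integral_discounted_comp_cappedHit hsol hh hα hβ hf hfs (hC n) x n
        fun ω s hs => ?_).trans (hfU _ ?_).eq_of_nhds
      · have hm := hmem ω s hs
        rw [generator_congr (hfU _ hm), (hfU _ hm).eq_of_nhds]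
        exact hgen _ (hha.trans_le hm.1)
      · exact ⟨hmono a.coe_nonneg x.coe_nonneg (NNReal.coe_le_coe.2 hax.le),
          hmono x.coe_nonneg (mem_Ici.2 (Nat.cast_nonneg n)) (by exact_mod_cast hxn.le)⟩
    · have hSm : Measurable (S n) := measurable_cappedHit (hC n) x n
      have h1 : Measurable fun ω => Real.exp (-r * S n ω) :=
        Real.measurable_exp.comp (hSm.coe_nnreal_real.const_mul _)
      exact h1.aestronglyMeasurable.mul
        (integrable_comp_cappedHit hh hf.continuous hfs (hC n) x n).aestronglyMeasurable
  -- A path is bounded on `[0, T]`, so for large `n` neither the level `n` nor the time cap `n`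
  -- interferes before `T`.
  have hSlim : ∀ ω (T : ℝ≥0), (T : ℝ≥0∞) ≤ hitTime (D.path x ω) {a} →
      ∀ᶠ n in atTop, T ≤ S n ω := by
    intro ω T hT
    obtain ⟨b, hb⟩ := (isCompact_Icc (a := (0 : ℝ≥0)) (b := T)).bddAbove_image (hw ω).continuousOn
    obtain ⟨N, hN⟩ := exists_nat_gt (max b T)
    filter_upwards [eventually_ge_atTop N] with n hn
    have hn' : max b T < (n : ℝ≥0) := hN.trans_le (by exact_mod_cast hn)
    rw [← ENNReal.coe_le_coe, coe_cappedHit, le_min_iff]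
    refine ⟨le_hitTime_exit (hw ω) (by simpa using hax) hT fun s hs => ?_, ?_⟩
    · exact (hb (mem_image_of_mem _ ⟨zero_le, hs⟩)).trans_lt ((le_max_left _ _).trans_lt hn')
    · exact ENNReal.coe_le_coe.2 ((le_max_right _ _).trans hn'.le)
  have hlim : Tendsto (fun n => ∫ ω, Z n ω ∂D.P) atTop
      (𝓝 (∫ ω, discount r (hitTime (D.path x ω) {a}) * U (h a) ∂D.P)) := by
    refine tendsto_integral_filter_of_dominated_convergence (fun _ => B)
      (hZ.mono fun n hn => hn.2) (Eventually.of_forall fun n => Eventually.of_forall fun ω => ?_)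
      (integrable_const _) (Eventually.of_forall fun ω => ?_)
    · rw [norm_mul, Real.norm_of_nonneg (Real.exp_pos _).le]
      refine (mul_le_of_le_one_left (norm_nonneg _) ?_).trans (hB _ (hS n ω))
      rw [Real.exp_le_one_iff]
      have := mul_nonneg r.coe_nonneg (S n ω).coe_nonneg
      linarith
    -- If `a` is never reached, the stopping times tend to infinity and the discount kills the
    -- bounded `U`; here `r > 0` is essential. Otherwise the stopping times are eventually equal to
    -- the hitting time of `a`.
    · rcases eq_or_ne (hitTime (D.path x ω) {a}) ⊤ with htop | htop
      · rw [htop]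
        have h0 : discount r ⊤ * U (h a) = 0 := by simp [discount]
        rw [h0]
        have hSinf : Tendsto (fun n => (S n ω : ℝ)) atTop atTop := by
          refine tendsto_atTop.2 fun c => ?_
          filter_upwards [hSlim ω c.toNNReal (by rw [htop]; exact le_top)] with n hn
          exact Real.toNNReal_le_iff_le_coe.1 hn
        have hexp : Tendsto (fun n => Real.exp (-r * S n ω)) atTop (𝓝 0) := by
          refine Real.tendsto_exp_atBot.comp ?_
          exact hSinf.const_mul_atTop_of_neg (neg_lt_zero.2 hr)
        refine hexp.zero_mul_isBoundedUnder_le ⟨B, ?_⟩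
        exact eventually_map.2 (Eventually.of_forall fun n => hB _ (hS n ω))
      · set T := (hitTime (D.path x ω) {a}).toNNReal with hTdef
        have hT : hitTime (D.path x ω) {a} = T := (ENNReal.coe_toNNReal htop).symm
        have hTa : D.path x ω T = a := apply_hitTime_mem (hw ω) isClosed_singleton htop
        refine tendsto_const_nhds.congr' ?_
        filter_upwards [hSlim ω T hT.ge] with n hn
        have hST : S n ω = T := by
          refine le_antisymm ?_ hn
          rw [← ENNReal.coe_le_coe, ← hT]
          exact (cappedHit_le_hitTime (C n) x n ω).trans
            (hitTime_anti _ (singleton_subset_iff.2 (show a ∈ C n from Or.inl self_mem_Iic)))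
        simp only [Z]
        rw [hST, hTa, discount_of_ne_top r htop]
        rfl
  rw [integral_mul_const, ← RegularDiffusion.hitLaplace_eq] at hlim
  refine tendsto_nhds_unique hlim (tendsto_const_nhds.congr' ?_)
  filter_upwards [hZ] with n hn
  exact hn.1.symm

end Laplace

/-! ### Condition C-(i) from the submartingale property -/

section Submartingale

variable {Ω : Type*} [MeasurableSpace Ω] {D : RegularDiffusion Ω} {F : Measure ℝ≥0}
  [IsProbabilityMeasure F] {φ : ℝ → ℝ} {K : ℝ≥0}

/-- A closed set not containing `x` is hit after a positive time, so discounting strictly lowers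
every nonzero payoff. Equality would force the payoff to vanish almost surely, against `K - x > 0`.
-/
theorem expectedPayoff_lt {R : Set ℝ≥0} (hR : IsClosed R) {x : ℝ≥0} (hx : x ∉ R) (hxK : x < K)
    (h : D.expectedPayoff K 0 x R ≤ K - x) {r : ℝ≥0} (hr : 0 < r) :
    D.expectedPayoff K r x R < K - x := by
  refine lt_of_le_of_ne ((D.expectedPayoff_anti K x hR zero_le).trans h) fun heq => ?_
  have hi := fun r => D.integrable_discountedPayoff (measurable_put K) (put_nonneg K) (put_le K)
    r x hR
  have hle : ∀ ω, discountedPayoff (put K) r R (D.path x ω) ≤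
      discountedPayoff (put K) 0 R (D.path x ω) := fun ω =>
    discountedPayoff_anti (put_nonneg K) _ _ zero_le
  have h0 : D.expectedPayoff K 0 x R = D.expectedPayoff K r x R :=
    le_antisymm (h.trans heq.ge) (D.expectedPayoff_anti K x hR zero_le)
  have hae := (integral_eq_iff_of_ae_le (hi r) (hi 0) (Eventually.of_forall hle)).1 h0.symm
  have hz : D.expectedPayoff K 0 x R = 0 := by
    refine integral_eq_zero_of_ae ?_
    filter_upwards [hae] with ω hω
    rcases eq_or_ne (hitTime (D.path x ω) R) ⊤ with htop | htop
    · exact discountedPayoff_of_top htop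
    · have hpos : 0 < (hitTime (D.path x ω) R).toReal := by
        refine ENNReal.toReal_pos (fun hz => hx ?_) htop
        have := apply_hitTime_mem (D.continuous_path' x ω) hR htop
        rwa [hz, ENNReal.toNNReal_zero, RegularDiffusion.path_zero] at this
      rw [discountedPayoff_zero_rate htop, discountedPayoff_of_ne_top htop] at hω
      rw [discountedPayoff_zero_rate htop]
      have hlt : Real.exp (-(r : ℝ) * (hitTime (D.path x ω) R).toReal) < 1 := by
        rw [Real.exp_lt_one_iff]
        have := mul_pos (NNReal.coe_pos.2 hr) hpos
        linarith
      have h2 : (1 - Real.exp (-(r : ℝ) * (hitTime (D.path x ω) R).toReal)) *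
          put K (D.path x ω (hitTime (D.path x ω) R).toNNReal) = 0 := by linarith
      exact (mul_eq_zero.1 h2).resolve_left (by linarith)
  rw [h0, heq] at hz
  have : (x : ℝ) < K := hxK
  linarith

/-- At every positive rate waiting is strictly worse than stopping, and positive rates have positive
mass, so `x` strictly prefers to stop although it lies outside `R`. -/
theorem not_isEquilibrium_of_expectedPayoff_le (hφ : StrictMonoOn φ (Ioi 0)) (hF : 0 < F (Ioi 0))
    {R : Set ℝ≥0} (hR : IsClosed R) {x : ℝ≥0} (hx : x ∉ R) (hxK : x < K)
    (h : D.expectedPayoff K 0 x R ≤ K - x) : ¬ IsEquilibrium D F φ K R := by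
  intro heq
  have hpos : (0 : ℝ) < K - x := sub_pos.2 hxK
  have h1 := (isEquilibrium_iff hφ hR.measurableSet).1 heq x hx hxK
  rw [put_of_le hxK.le, extendPhi_of_pos hpos, J_eq] at h1
  refine absurd h1 (not_le.2 (erealIntegral_lt F ?_ (fun r => ?_) (hF.trans_le ?_)))
  · exact (extendPhi_mono hφ).measurable.comp (D.expectedPayoff_anti K x hR).measurable
  · rw [← extendPhi_of_pos (φ := φ) hpos]
    exact extendPhi_mono hφ ((D.expectedPayoff_anti K x hR zero_le).trans h)
  · refine measure_mono fun r hr => ?_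
    rw [mem_ofPred_eq, ← extendPhi_of_pos (φ := φ) hpos]
    exact extendPhi_lt hφ (expectedPayoff_lt hR hx hxK h hr) hpos

/-- The stopped process is a submartingale as long as it is bounded by a stopping level. -/
def StoppedSubmartingale (D : RegularDiffusion Ω) : Prop :=
  ∀ (C : Set ℝ≥0) (x u T : ℝ≥0), IsClosed C → x < u → u ∈ C →
    (x : ℝ) ≤ ∫ ω, (D.path x ω (cappedHit D C x T ω) : ℝ) ∂D.P

/-- Before `R` is hit the process stays below `u ≤ K`, so the put payoff is `K - X` without
truncation. The payoff collected by time `n` is thus at most the stopped value of `K - X`, whose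
mean is at most `K - x`; then `n → ∞`. -/
theorem StoppedSubmartingale.expectedPayoff_le (h : StoppedSubmartingale D) {R : Set ℝ≥0}
    (hR : IsClosed R) {x u : ℝ≥0} (hxu : x < u) (hu : u ∈ R) (huK : u ≤ K) :
    D.expectedPayoff K 0 x R ≤ K - x := by
  have hw := D.continuous_path' x
  have hbd : ∀ ω (s : ℝ≥0), (s : ℝ≥0∞) ≤ hitTime (D.path x ω) R → D.path x ω s ≤ K :=
    fun ω s hs => (apply_le_of_le_hitTime (hw ω) (by simpa using hxu) hu hs).trans huK
  have hτ := D.measurable_hitTime hR x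
  have hmeas : Measurable fun ω => discountedPayoff (put K) 0 R (D.path x ω) :=
    measurable_discountedPayoff (D.measurable_X x) (D.continuous_path x) hR (measurable_put K) 0
  have hlim : Tendsto (fun n : ℕ => ∫ ω, {ω | hitTime (D.path x ω) R ≤ (n : ℝ≥0)}.indicator
      (fun ω => discountedPayoff (put K) 0 R (D.path x ω)) ω ∂D.P) atTop
      (𝓝 (D.expectedPayoff K 0 x R)) := by
    refine tendsto_integral_of_dominated_convergence (fun _ => (K : ℝ)) (fun n => ?_)
      (integrable_const _) (fun n => Eventually.of_forall fun ω => ?_)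
      (Eventually.of_forall fun ω => ?_)
    · exact (hmeas.indicator (hτ measurableSet_Iic)).aestronglyMeasurable
    · refine (norm_indicator_le_norm_self _ _).trans ?_
      rw [Real.norm_of_nonneg (discountedPayoff_nonneg (put_nonneg K) _ _ _)]
      exact discountedPayoff_le (put_nonneg K) (put_le K) _ _ _
    · rcases eq_or_ne (hitTime (D.path x ω) R) ⊤ with htop | htop
      · have h0 := discountedPayoff_of_top (g := put K) (r := 0) htop
        simp [indicator_apply, h0]
      · obtain ⟨N, hN⟩ := ENNReal.exists_nat_gt htop
        refine tendsto_const_nhds.congr' ?_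
        filter_upwards [eventually_ge_atTop N] with n hn
        have hmem : ω ∈ {ω | hitTime (D.path x ω) R ≤ (n : ℝ≥0)} :=
          hN.le.trans (by exact_mod_cast hn)
        rw [indicator_of_mem hmem]
  refine le_of_tendsto hlim (Eventually.of_forall fun n => ?_)
  have hSm : Measurable fun ω => (D.path x ω (cappedHit D R x n ω) : ℝ) :=
    (measurable_apply_random_time (D.measurable_X x) (D.continuous_path x)
      (measurable_cappedHit hR x n)).coe_nnreal_real
  have hSK : ∀ ω, (D.path x ω (cappedHit D R x n ω) : ℝ) ≤ K := fun ω =>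
    NNReal.coe_le_coe.2 (hbd ω _ (cappedHit_le_hitTime R x n ω))
  have hSi : Integrable (fun ω => (D.path x ω (cappedHit D R x n ω) : ℝ)) D.P :=
    Integrable.of_bound hSm.aestronglyMeasurable K (Eventually.of_forall fun ω => by
      rw [Real.norm_of_nonneg (NNReal.coe_nonneg _)]
      exact hSK ω)
  have hsub := h R x u n hR hxu hu
  calc ∫ ω, {ω | hitTime (D.path x ω) R ≤ (n : ℝ≥0)}.indicator
        (fun ω => discountedPayoff (put K) 0 R (D.path x ω)) ω ∂D.P
      ≤ ∫ ω, ((K : ℝ) - D.path x ω (cappedHit D R x n ω)) ∂D.P := by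
        refine integral_mono_of_nonneg (Eventually.of_forall fun ω => ?_)
          ((integrable_const _).sub hSi) (Eventually.of_forall fun ω => ?_)
        · exact indicator_nonneg (fun ω _ => discountedPayoff_nonneg (put_nonneg K) _ _ _) ω
        · simp only [indicator_apply, mem_ofPred_eq]
          split_ifs with hle
          · have hne : hitTime (D.path x ω) R ≠ ⊤ := ne_top_of_le_ne_top ENNReal.coe_ne_top hle
            have hS : cappedHit D R x n ω = (hitTime (D.path x ω) R).toNNReal := by
              rw [cappedHit, min_eq_left hle]
            rw [discountedPayoff_zero_rate hne, ← hS, put_of_le (NNReal.coe_le_coe.1 (hSK ω))]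
          · exact sub_nonneg.2 (hSK ω)
    _ = K - ∫ ω, (D.path x ω (cappedHit D R x n ω) : ℝ) ∂D.P := by
        rw [integral_sub (integrable_const _) hSi]
        simp
    _ ≤ K - x := by linarith

/-- An equilibrium must contain `0`, where the payoff `K` cannot be improved by waiting, and cannot
have a gap below its supremum, since from inside the gap waiting pays at most `K - x` without
discounting. -/
theorem StoppedSubmartingale.condI (h : StoppedSubmartingale D) (hφ : CondIII φ)
    (hF : 0 < F (Ioi 0)) (hK : 0 < K) : CondI D F φ K := by
  intro R hR hRK heq
  have h0 : 0 ∈ R := by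
    by_contra h0
    exact not_isEquilibrium_of_expectedPayoff_le hφ.strictMonoOn hF hR h0 hK
      (by simpa using D.expectedPayoff_le K 0 0 R) heq
  have hbdd : BddAbove R := ⟨K, fun y hy => (hRK hy).2⟩
  have hmem : sSup R ∈ R := hR.csSup_mem ⟨0, h0⟩ hbdd
  refine ⟨sSup R, (hRK hmem).2, Subset.antisymm (fun y hy => ⟨zero_le, le_csSup hbdd hy⟩) ?_⟩
  rintro x ⟨-, hx⟩
  by_contra hxR
  have hlt : x < sSup R := lt_of_le_of_ne hx fun h => hxR (h ▸ hmem)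
  exact not_isEquilibrium_of_expectedPayoff_le hφ.strictMonoOn hF hR hxR
    (hlt.trans_le (hRK hmem).2) (h.expectedPayoff_le hR hlt hmem (hRK hmem).2) heq

/-- A criterion for the submartingale property: the identity is approximated by functions of
`h` that are subharmonic. -/
theorem stoppedSubmartingale_of_generator_nonneg {h α β : ℝ → ℝ}
    (hsol : SolvesMartingaleProblem D h α β) (hh : Continuous h) (hα : Continuous α)
    (hβ : Continuous β)
    (happrox : ∀ (u : ℝ≥0) (ε : ℝ), 0 < ε → ∃ f : ℝ → ℝ, ContDiff ℝ (⊤ : ℕ∞) f ∧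
      HasCompactSupport f ∧ ∀ y : ℝ≥0, y ≤ u → |f (h y) - y| ≤ ε ∧ 0 ≤ generator α β f (h y)) :
    StoppedSubmartingale D := by
  intro C x u T hC hxu hu
  refine le_of_forall_pos_le_add fun ε hε => ?_
  obtain ⟨f, hf, hfs, hfu⟩ := happrox u (ε / 2) (half_pos hε)
  have hbd : ∀ ω (s : ℝ≥0), (s : ℝ≥0∞) ≤ hitTime (D.path x ω) C → D.path x ω s ≤ u :=
    fun ω s hs => apply_le_of_le_hitTime (D.continuous_path' x ω) (by simpa using hxu) hu hs
  have hS : ∀ ω, D.path x ω (cappedHit D C x T ω) ≤ u := fun ω =>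
    hbd ω _ (cappedHit_le_hitTime C x T ω)
  have h1 := le_integral_comp_cappedHit hsol hh hα hβ hf hfs hC x T fun ω s hs =>
    (hfu _ (hbd ω s hs)).2
  have hSm : Measurable fun ω => (D.path x ω (cappedHit D C x T ω) : ℝ) :=
    (measurable_apply_random_time (D.measurable_X x) (D.continuous_path x)
      (measurable_cappedHit hC x T)).coe_nnreal_real
  have hSi : Integrable (fun ω => (D.path x ω (cappedHit D C x T ω) : ℝ)) D.P :=
    Integrable.of_bound hSm.aestronglyMeasurable u (Eventually.of_forall fun ω => by
      rw [Real.norm_of_nonneg (NNReal.coe_nonneg _)]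
      exact NNReal.coe_le_coe.2 (hS ω))
  have h2 : ∫ ω, f (h (D.path x ω (cappedHit D C x T ω))) ∂D.P ≤
      ∫ ω, ((D.path x ω (cappedHit D C x T ω) : ℝ) + ε / 2) ∂D.P :=
    integral_mono (integrable_comp_cappedHit hh hf.continuous hfs hC x T)
      (hSi.add (integrable_const _)) fun ω => by
        have := (abs_le.1 (hfu _ (hS ω)).1).2
        simp only
        linarith
  rw [integral_add hSi (integrable_const _)] at h2
  have h3 := (abs_le.1 (hfu x hxu.le).1).1
  simp only [integral_const, probReal_univ, smul_eq_mul, one_mul] at h2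
  linarith

end Submartingale

/-! ### Geometric Brownian motion -/

section GeometricBrownianMotion

variable {μ σ : ℝ}

/-- The quadratic equation for which `y ^ (-p)` is an eigenfunction of the generator with eigenvalue
`r`. -/
theorem gbmExponent_quadratic (μ : ℝ) (hσ : 0 < σ) (r : ℝ≥0) :
    1 / 2 * σ ^ 2 * (gbmExponent μ σ r * (gbmExponent μ σ r + 1)) - μ * gbmExponent μ σ r = r := by
  have h1 : (0 : ℝ) ≤ (μ / σ ^ 2 - 1 / 2) ^ 2 + 2 * r / σ ^ 2 := by positivity
  have h2 := Real.sq_sqrt h1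
  unfold gbmExponent
  set s := √((μ / σ ^ 2 - 1 / 2) ^ 2 + 2 * r / σ ^ 2)
  field_simp at h2 ⊢
  linear_combination h2

theorem gbmExponent_nonneg (μ σ : ℝ) (r : ℝ≥0) : 0 ≤ gbmExponent μ σ r := by
  have h1 : |μ / σ ^ 2 - 1 / 2| ≤ √((μ / σ ^ 2 - 1 / 2) ^ 2 + 2 * r / σ ^ 2) := by
    refine Real.abs_le_sqrt (le_add_of_nonneg_right (by positivity))
  unfold gbmExponent
  linarith [neg_abs_le (μ / σ ^ 2 - 1 / 2)]

theorem gbmExponent_pos (μ : ℝ) (hσ : 0 < σ) {r : ℝ≥0} (hr : 0 < r) : 0 < gbmExponent μ σ r := by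
  refine lt_of_le_of_ne (gbmExponent_nonneg μ σ r) fun h => hr.ne' ?_
  have := gbmExponent_quadratic μ hσ r
  rw [← h] at this
  simpa using this.symm

theorem continuous_gbmExponent (μ σ : ℝ) : Continuous (gbmExponent μ σ) := by
  unfold gbmExponent
  fun_prop

variable {Ω : Type*} [MeasurableSpace Ω] {D : RegularDiffusion Ω}

/-- The identity has generator `μ y ≥ 0`. It needs only a cutoff far away, so the approximation is
exact on `[0, u]`. -/
theorem stoppedSubmartingale_of_gbm (hμ : 0 < μ) (h : IsGeometricBrownianMotion D μ σ) :
    StoppedSubmartingale D := by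
  refine stoppedSubmartingale_of_generator_nonneg h continuous_id (by fun_prop) (by fun_prop)
    fun u ε hε => ?_
  obtain ⟨f, hf, hfs, hfU⟩ := exists_compactSupport_eventuallyEq (U := id) (q := u)
    contDiffOn_id (neg_one_lt_zero (R := ℝ))
  refine ⟨f, hf, hfs, fun y hy => ?_⟩
  have hmem : (y : ℝ) ∈ Icc (0 : ℝ) u := ⟨y.coe_nonneg, NNReal.coe_le_coe.2 hy⟩
  have h1 : deriv (id : ℝ → ℝ) = fun _ => 1 := by
    funext z
    simp
  constructor
  · rw [id, (hfU _ hmem).eq_of_nhds]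
    simpa using hε.le
  · rw [id, generator_congr (hfU _ hmem), generator, h1]
    simp only [deriv_const, mul_zero, zero_add, mul_one]
    positivity

theorem generator_rpow_neg (p : ℝ) {y : ℝ} (hy : 0 < y) :
    generator (fun y => σ ^ 2 * y ^ 2) (fun y => μ * y) (fun y => y ^ (-p)) y =
      (1 / 2 * σ ^ 2 * (p * (p + 1)) - μ * p) * y ^ (-p) := by
  have h1 : ∀ᶠ z in 𝓝 y, deriv (fun y : ℝ => y ^ (-p)) z = -p * z ^ (-p - 1) := by
    filter_upwards [Ioi_mem_nhds hy] with z hz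
    exact (Real.hasDerivAt_rpow_const (Or.inl (ne_of_gt hz))).deriv
  have h2 : deriv (fun z : ℝ => -p * z ^ (-p - 1)) y = -p * ((-p - 1) * y ^ (-p - 1 - 1)) :=
    ((Real.hasDerivAt_rpow_const (Or.inl hy.ne')).const_mul _).deriv
  rw [generator, EventuallyEq.deriv_eq h1, h1.self_of_nhds, h2]
  have h3 : y ^ (-p - 1) = y ^ (-p) / y := Real.rpow_sub_one hy.ne' _
  have h4 : y ^ (-p - 1 - 1) = y ^ (-p) / y / y := by rw [Real.rpow_sub_one hy.ne', h3]
  rw [h4, h3]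
  field_simp
  ring

/-- For positive rates the power `y ^ (-p)` with `p = gbmExponent μ σ r` is a solution bounded above
the level `a`. The rate `0` follows by continuity in `r`. -/
theorem hitLaplace_gbm (hσ : 0 < σ) (h : IsGeometricBrownianMotion D μ σ) (r : ℝ≥0) {a x : ℝ≥0}
    (ha : 0 < a) (hax : a < x) :
    hitLaplace D r a x = ((x : ℝ) / a) ^ (-gbmExponent μ σ r) := by
  have ha' : (0 : ℝ) < a := ha
  have hx' : (0 : ℝ) < x := ha.trans hax
  have hpos : ∀ s : ℝ≥0, 0 < s → hitLaplace D s a x = ((x : ℝ) / a) ^ (-gbmExponent μ σ s) := by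
    intro s hs
    have h1 := hitLaplace_mul_eq (U := fun y => y ^ (-gbmExponent μ σ s))
      (B := (a : ℝ) ^ (-gbmExponent μ σ s)) h continuous_id
      monotoneOn_id (by fun_prop) (by fun_prop)
      (fun y hy => (Real.contDiffAt_rpow_const_of_ne (ne_of_gt hy)).contDiffWithinAt) hs
      (fun y hy => by rw [generator_rpow_neg _ hy, gbmExponent_quadratic μ hσ]) ha' hax
      (fun y hy => by
        have hy' : (a : ℝ) ≤ y := hy
        rw [id, abs_of_nonneg (Real.rpow_nonneg y.coe_nonneg _)]
        exact Real.rpow_le_rpow_of_nonpos ha' hy' (neg_nonpos.2 (gbmExponent_nonneg μ σ s)))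
    rw [Real.div_rpow hx'.le ha'.le, eq_div_iff (Real.rpow_pos_of_pos ha' _).ne']
    exact h1
  rcases eq_or_ne r 0 with rfl | hr
  · have hlim : Tendsto (fun n : ℕ => ((n : ℝ≥0) + 1)⁻¹) atTop (𝓝 0) := by
      have h1 := (tendsto_inv_atTop_nhds_zero_nat (𝕜 := ℝ≥0)).comp (tendsto_add_atTop_nat 1)
      simpa [Function.comp_def] using h1
    have h1 := D.tendsto_hitLaplace_rate a x hlim
    refine tendsto_nhds_unique h1 ?_
    simp only [fun n : ℕ => hpos ((n : ℝ≥0) + 1)⁻¹ (by positivity)]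
    exact ((Real.continuous_const_rpow (div_pos hx' ha').ne').tendsto _).comp
      (((continuous_gbmExponent μ σ).tendsto 0).comp hlim).neg
  · exact hpos r (pos_iff_ne_zero.2 hr)

/-- The two bounds are `1 - 1 / y ≤ log y ≤ y - 1` at `y = x / a`. -/
theorem hasDecayRate_gbm (hσ : 0 < σ) (h : IsGeometricBrownianMotion D μ σ) :
    HasDecayRate D fun r a => gbmExponent μ σ r / a := by
  intro r a x ha hax
  have ha' : (0 : ℝ) < a := ha
  have hx' : (0 : ℝ) < x := ha.trans hax
  have hp := gbmExponent_nonneg μ σ r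
  have hlog : -logHit D r a x = gbmExponent μ σ r * Real.log (x / a) := by
    rw [logHit, hitLaplace_gbm hσ h r ha hax, Real.log_rpow (div_pos hx' ha')]
    ring
  rw [hlog]
  have h1 := Real.one_sub_inv_le_log_of_pos (div_pos hx' ha')
  have h2 := Real.log_le_sub_one_of_pos (div_pos hx' ha')
  constructor
  · calc ((x : ℝ) - a) * (gbmExponent μ σ r / x) = gbmExponent μ σ r * (1 - (x / a : ℝ)⁻¹) := by
          field_simp
      _ ≤ _ := mul_le_mul_of_nonneg_left h1 hp
  · calc gbmExponent μ σ r * Real.log (x / a) ≤ gbmExponent μ σ r * (x / a - 1) :=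
          mul_le_mul_of_nonneg_left h2 hp
      _ = _ := by field_simp

theorem gbm_threshold {F : Measure ℝ≥0} [IsProbabilityMeasure F] (hF : 0 < F (Ioi 0)) {K : ℝ≥0}
    (hK : 0 < K) (hμ : 0 < μ) (hσ : 0 < σ) (h : IsGeometricBrownianMotion D μ σ)
    (hint : Integrable (gbmExponent μ σ) F) :
    ∃ aStar : ℝ≥0, 0 < aStar ∧ aStar < K ∧
      (aStar : ℝ) = (∫ r, gbmExponent μ σ r ∂F) / (1 + ∫ r, gbmExponent μ σ r ∂F) * K ∧
      ∀ φ : ℝ → ℝ, CondIII φ → IsOptimalThreshold D F φ K aStar := by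
  set M := ∫ r, gbmExponent μ σ r ∂F with hM
  have hMpos : 0 < M := by
    refine (integral_pos_iff_support_of_nonneg (gbmExponent_nonneg μ σ) hint).2
      (hF.trans_le (measure_mono fun r hr => ?_))
    exact (gbmExponent_pos μ hσ hr).ne'
  have hK' : (0 : ℝ) < K := hK
  have hapos : 0 < M / (1 + M) * K := by positivity
  have haK : M / (1 + M) * K < K := by
    refine mul_lt_of_lt_one_left hK' ((div_lt_one (by positivity)).2 (by linarith))
  obtain ⟨a, ha⟩ : ∃ a : ℝ≥0, (a : ℝ) = M / (1 + M) * K := ⟨_, Real.coe_toNNReal _ hapos.le⟩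
  rw [← ha] at hapos haK
  refine ⟨a, hapos, haK, ha, fun φ hφ => ?_⟩
  -- The smooth-fit equation is `M / a = 1 / (K - a)`, with solution `a = M K / (1 + M)`.
  refine (hasDecayRate_gbm hσ h).isOptimalThreshold hφ
    ((stoppedSubmartingale_of_gbm hμ h).condI hφ hF hK) (fun a _ _ => hint.div_const _) hapos haK ?_
  rw [integral_div, ← hM, ha]
  have h1 : (K : ℝ) - M / (1 + M) * K = K / (1 + M) := by
    field_simp
    ring
  rw [h1]
  field_simp

end GeometricBrownianMotion

/-! ### Modified Bessel functions: integrability, derivatives, recurrence -/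

section BesselFunctions

/-- The integrand of the modified Bessel function of the second kind. -/
noncomputable def besselKernel (ν z t : ℝ) : ℝ := Real.exp (-z * Real.cosh t) * Real.cosh (ν * t)

theorem besselK_eq (ν z : ℝ) : besselK ν z = ∫ t in Ioi (0 : ℝ), besselKernel ν z t := rfl

theorem continuous_besselKernel (ν : ℝ) :
    Continuous fun p : ℝ × ℝ => besselKernel ν p.1 p.2 := by
  unfold besselKernel
  fun_prop

theorem continuous_besselKernel_right (ν z : ℝ) : Continuous (besselKernel ν z) := by
  unfold besselKernel
  fun_prop

theorem besselKernel_pos (ν z t : ℝ) : 0 < besselKernel ν z t :=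
  mul_pos (Real.exp_pos _) (Real.cosh_pos _)

theorem cosh_le_exp_abs (x : ℝ) : Real.cosh x ≤ Real.exp |x| := by
  rw [← Real.cosh_abs, Real.cosh_eq]
  have : Real.exp (-|x|) ≤ Real.exp |x| := Real.exp_le_exp.2 (by linarith [abs_nonneg x])
  linarith

theorem sq_div_four_le_cosh {t : ℝ} (ht : 0 ≤ t) : t ^ 2 / 4 ≤ Real.cosh t := by
  rw [Real.cosh_eq]
  have := Real.quadratic_le_exp_of_nonneg ht
  have := Real.exp_pos (-t)
  linarith

/-- From `cosh t ≥ t² / 4`, completing the square absorbs `(|ν| + 1) t` into `z t² / 4` and leaves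
the spare decay `exp (-t)`. -/
theorem besselKernel_le (ν : ℝ) {z t : ℝ} (hz : 0 < z) (ht : 0 ≤ t) :
    besselKernel ν z t ≤ Real.exp ((|ν| + 1) ^ 2 / z) * Real.exp (-t) := by
  have h1 : Real.cosh (ν * t) ≤ Real.exp (|ν| * t) := by
    simpa [abs_mul, abs_of_nonneg ht] using cosh_le_exp_abs (ν * t)
  refine (mul_le_mul_of_nonneg_left h1 (Real.exp_pos _).le).trans ?_
  rw [← Real.exp_add, ← Real.exp_add, Real.exp_le_exp]
  have h2 : z * (t ^ 2 / 4) ≤ z * Real.cosh t :=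
    mul_le_mul_of_nonneg_left (sq_div_four_le_cosh ht) hz.le
  have h3 : (|ν| + 1) * t ≤ (|ν| + 1) ^ 2 / z + z * (t ^ 2 / 4) := by
    have h4 : (|ν| + 1) ^ 2 / z + z * (t ^ 2 / 4) - (|ν| + 1) * t =
        (|ν| + 1 - z * t / 2) ^ 2 / z := by
      field_simp
      ring
    have h5 : 0 ≤ (|ν| + 1 - z * t / 2) ^ 2 / z := by positivity
    linarith
  linarith

theorem integrableOn_besselKernel (ν : ℝ) {z : ℝ} (hz : 0 < z) :
    IntegrableOn (besselKernel ν z) (Ioi 0) := by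
  have h1 : IntegrableOn (fun t : ℝ => Real.exp ((|ν| + 1) ^ 2 / z) * Real.exp (-t)) (Ioi 0) :=
    (integrableOn_exp_neg_Ioi 0).const_mul _
  refine h1.mono' (continuous_besselKernel_right ν z).aestronglyMeasurable ?_
  refine (ae_restrict_iff' measurableSet_Ioi).2 (Eventually.of_forall fun t ht => ?_)
  rw [Real.norm_of_nonneg (besselKernel_pos ν z t).le]
  exact besselKernel_le ν hz (le_of_lt ht)

theorem tendsto_besselKernel (ν : ℝ) {z : ℝ} (hz : 0 < z) :
    Tendsto (besselKernel ν z) atTop (𝓝 0) := by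
  have h1 : Tendsto (fun t : ℝ => Real.exp ((|ν| + 1) ^ 2 / z) * Real.exp (-t)) atTop (𝓝 0) := by
    simpa using (Real.tendsto_exp_neg_atTop_nhds_zero).const_mul (Real.exp ((|ν| + 1) ^ 2 / z))
  refine squeeze_zero' (Eventually.of_forall fun t => (besselKernel_pos ν z t).le) ?_ h1
  filter_upwards [eventually_ge_atTop 0] with t ht
  exact besselKernel_le ν hz ht

theorem besselK_pos (ν : ℝ) {z : ℝ} (hz : 0 < z) : 0 < besselK ν z := by
  rw [besselK_eq, setIntegral_pos_iff_support_of_nonneg_ae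
    (Eventually.of_forall fun t => (besselKernel_pos ν z t).le) (integrableOn_besselKernel ν hz)]
  have : Function.support (besselKernel ν z) = univ :=
    eq_univ_of_forall fun t => (besselKernel_pos ν z t).ne'
  simp [this]

theorem besselK_neg (ν z : ℝ) : besselK (-ν) z = besselK ν z := by
  simp [besselK]

theorem besselK_le_of_abs_le {ν μ z : ℝ} (hz : 0 < z) (h : |ν| ≤ |μ|) :
    besselK ν z ≤ besselK μ z := by
  refine setIntegral_mono_on (integrableOn_besselKernel ν hz) (integrableOn_besselKernel μ hz)
    measurableSet_Ioi fun t _ => mul_le_mul_of_nonneg_left ?_ (Real.exp_pos _).le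
  rw [Real.cosh_le_cosh, abs_mul, abs_mul]
  exact mul_le_mul_of_nonneg_right h (abs_nonneg _)

theorem cosh_mul_besselKernel (ν z t : ℝ) : Real.cosh t * besselKernel ν z t =
    (besselKernel (ν + 1) z t + besselKernel (ν - 1) z t) / 2 := by
  unfold besselKernel
  rw [add_mul, sub_mul, one_mul, Real.cosh_add, Real.cosh_sub]
  ring

/-- Differentiation under the integral brings down `-cosh t`; on `y > z / 2` the kernel at `z / 2`
dominates. -/
theorem hasDerivAt_besselK (ν : ℝ) {z : ℝ} (hz : 0 < z) :
    HasDerivAt (besselK ν) (-(besselK (ν + 1) z + besselK (ν - 1) z) / 2) z := by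
  have hi : ∀ {y : ℝ}, 0 < y → IntegrableOn (fun t => Real.cosh t * besselKernel ν y t) (Ioi 0) := by
    intro y hy
    simp only [cosh_mul_besselKernel]
    exact ((integrableOn_besselKernel _ hy).add (integrableOn_besselKernel _ hy)).div_const 2
  have h1 := (hasDerivAt_integral_of_dominated_loc_of_deriv_le (μ := volume.restrict (Ioi (0 : ℝ)))
    (F := besselKernel ν) (F' := fun y t => -(Real.cosh t * besselKernel ν y t))
    (bound := fun t => Real.cosh t * besselKernel ν (z / 2) t) (Ioi_mem_nhds (half_lt_self hz))
    (Eventually.of_forall fun y => (continuous_besselKernel_right ν y).aestronglyMeasurable)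
    (integrableOn_besselKernel ν hz) (hi hz).neg.aestronglyMeasurable
    (Eventually.of_forall fun t y hy => ?_) (hi (half_pos hz))
    (Eventually.of_forall fun t y _ => ?_)).2
  · have h2 : ∫ t in Ioi (0 : ℝ), -(Real.cosh t * besselKernel ν z t) =
        -(besselK (ν + 1) z + besselK (ν - 1) z) / 2 := by
      simp only [cosh_mul_besselKernel]
      rw [integral_neg, integral_div, integral_add (integrableOn_besselKernel _ hz)
        (integrableOn_besselKernel _ hz), neg_div]
      rfl
    rwa [h2] at h1
  · rw [norm_neg, Real.norm_of_nonneg (mul_pos (Real.cosh_pos t) (besselKernel_pos ν y t)).le]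
    refine mul_le_mul_of_nonneg_left (mul_le_mul_of_nonneg_right ?_ (Real.cosh_pos _).le)
      (Real.cosh_pos t).le
    rw [Real.exp_le_exp]
    have := mul_le_mul_of_nonneg_right (le_of_lt (mem_Ioi.1 hy)) (Real.cosh_pos t).le
    linarith
  · have h3 : HasDerivAt (fun y : ℝ => Real.exp (-y * Real.cosh t))
        (Real.exp (-y * Real.cosh t) * (-Real.cosh t)) y := by
      have := ((hasDerivAt_id y).neg.mul_const (Real.cosh t)).exp
      simpa using this
    have h4 := h3.mul_const (Real.cosh (ν * t))
    refine h4.congr_deriv ?_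
    unfold besselKernel
    ring

/-- Integration by parts: the combination of kernels is the derivative of `-2 exp (-z cosh t) sinh
(ν t)`, which vanishes at `0` and at infinity. -/
theorem besselK_recurrence (ν : ℝ) {z : ℝ} (hz : 0 < z) :
    z * besselK (ν + 1) z = z * besselK (ν - 1) z + 2 * ν * besselK ν z := by
  have hd : ∀ t : ℝ, HasDerivAt (fun t => -(2 * Real.exp (-z * Real.cosh t) * Real.sinh (ν * t)))
      (z * besselKernel (ν + 1) z t - z * besselKernel (ν - 1) z t -
        2 * ν * besselKernel ν z t) t := by
    intro t
    have h1 : HasDerivAt (fun t : ℝ => Real.exp (-z * Real.cosh t))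
        (Real.exp (-z * Real.cosh t) * (-z * Real.sinh t)) t :=
      ((Real.hasDerivAt_cosh t).const_mul (-z)).exp
    have h2 : HasDerivAt (fun t : ℝ => Real.sinh (ν * t)) (Real.cosh (ν * t) * ν) t := by
      have := ((hasDerivAt_id t).const_mul ν).sinh
      simpa using this
    refine ((h1.const_mul 2).mul h2).fun_neg.congr_deriv ?_
    unfold besselKernel
    rw [add_mul, sub_mul, one_mul, Real.cosh_add, Real.cosh_sub]
    ring
  have hi := (integrableOn_besselKernel (ν + 1) hz).const_mul z
  have hi' := (integrableOn_besselKernel (ν - 1) hz).const_mul z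
  have hi'' := (integrableOn_besselKernel ν hz).const_mul (2 * ν)
  have hlim : Tendsto (fun t => -(2 * Real.exp (-z * Real.cosh t) * Real.sinh (ν * t))) atTop
      (𝓝 0) := by
    refine squeeze_zero_norm (a := fun t => 2 * besselKernel ν z t) (fun t => ?_) ?_
    · rw [norm_neg, norm_mul, Real.norm_of_nonneg (by positivity), mul_assoc]
      refine mul_le_mul_of_nonneg_left (mul_le_mul_of_nonneg_left ?_ (Real.exp_pos _).le) two_pos.le
      rw [Real.norm_eq_abs, Real.abs_sinh, ← Real.cosh_abs (ν * t)]
      exact (Real.sinh_lt_cosh _).le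
    · simpa using (tendsto_besselKernel ν hz).const_mul 2
  have hi3 : Integrable (fun t => z * besselKernel (ν + 1) z t - z * besselKernel (ν - 1) z t)
      (volume.restrict (Ioi 0)) := hi.sub hi'
  have h := integral_Ioi_of_hasDerivAt_of_tendsto' (a := 0) (fun t _ => hd t)
    (hi3.sub hi'') hlim
  rw [integral_sub hi3 hi'', integral_sub hi hi', integral_const_mul, integral_const_mul,
    integral_const_mul, ← besselK_eq, ← besselK_eq, ← besselK_eq] at h
  simp only [mul_zero, Real.sinh_zero, neg_zero, sub_zero] at h
  linarith

theorem hasDerivAt_besselK' (ν : ℝ) {z : ℝ} (hz : 0 < z) :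
    HasDerivAt (besselK ν) (-besselK (ν + 1) z + ν / z * besselK ν z) z := by
  refine (hasDerivAt_besselK ν hz).congr_deriv ?_
  have := besselK_recurrence ν hz
  field_simp
  linarith

theorem measurable_besselK (ν : ℝ) : Measurable (besselK ν) :=
  (StronglyMeasurable.integral_prod_right
    (continuous_besselKernel ν).stronglyMeasurable).measurable

/-- `K_{ν+1}² ≤ K_ν K_{ν+2}`. -/
theorem besselK_sq_le (ν : ℝ) {z : ℝ} (hz : 0 < z) :
    besselK (ν + 1) z / besselK ν z ≤ besselK (ν + 2) z / besselK (ν + 1) z := by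
  have h0 := besselK_pos ν hz
  have h1 := besselK_pos (ν + 1) hz
  have h2 := besselK_pos (ν + 2) hz
  -- Cauchy–Schwarz through `2 s K_{ν+1} ≤ K_ν + s² K_{ν+2}`, which holds pointwise for the kernels;
  -- this `s` is the optimal choice.
  set s := besselK (ν + 1) z / besselK (ν + 2) z with hs
  have hs0 : 0 < s := div_pos h1 h2
  have hpt : ∀ t, 2 * s * besselKernel (ν + 1) z t ≤
      besselKernel ν z t + s ^ 2 * besselKernel (ν + 2) z t := by
    intro t
    have hsq : Real.cosh ((ν + 1) * t) ^ 2 ≤ Real.cosh (ν * t) * Real.cosh ((ν + 2) * t) := by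
      have e1 : ν * t = (ν + 1) * t - t := by ring
      have e2 : (ν + 2) * t = (ν + 1) * t + t := by ring
      rw [e1, e2, Real.cosh_add, Real.cosh_sub]
      have e3 := Real.cosh_sq ((ν + 1) * t)
      have e4 := Real.cosh_sq t
      nlinarith [sq_nonneg (Real.sinh t)]
    have hc0 := Real.cosh_pos (ν * t)
    have hc1 := Real.cosh_pos ((ν + 1) * t)
    have hc2 := Real.cosh_pos ((ν + 2) * t)
    have hmain : 2 * s * Real.cosh ((ν + 1) * t) ≤
        Real.cosh (ν * t) + s ^ 2 * Real.cosh ((ν + 2) * t) := by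
      refine abs_le_of_sq_le_sq' ?_ (by positivity) |>.2
      nlinarith [sq_nonneg (Real.cosh (ν * t) - s ^ 2 * Real.cosh ((ν + 2) * t)),
        mul_le_mul_of_nonneg_left hsq (sq_nonneg s)]
    unfold besselKernel
    have := mul_le_mul_of_nonneg_left hmain (Real.exp_pos (-z * Real.cosh t)).le
    linarith
  have hint : 2 * s * besselK (ν + 1) z ≤ besselK ν z + s ^ 2 * besselK (ν + 2) z := by
    simp only [besselK_eq]
    rw [← integral_const_mul, ← integral_const_mul, ← integral_add (integrableOn_besselKernel ν hz)
      ((integrableOn_besselKernel _ hz).const_mul _)]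
    exact integral_mono ((integrableOn_besselKernel _ hz).const_mul _)
      ((integrableOn_besselKernel ν hz).add ((integrableOn_besselKernel _ hz).const_mul _)) hpt
  rw [div_le_div_iff₀ h0 h1]
  have e : s * besselK (ν + 2) z = besselK (ν + 1) z := div_mul_cancel₀ _ h2.ne'
  have h3 : s * besselK (ν + 1) z ≤ besselK ν z := by nlinarith
  calc besselK (ν + 1) z * besselK (ν + 1) z = s * besselK (ν + 1) z * besselK (ν + 2) z := by
        rw [← e]
        ring
    _ ≤ besselK ν z * besselK (ν + 2) z := mul_le_mul_of_nonneg_right h3 h2.le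
    _ = _ := mul_comm _ _

/-- The ratio `K_{ν+1} / K_ν`. -/
noncomputable def besselRatio (ν z : ℝ) : ℝ := besselK (ν + 1) z / besselK ν z

theorem besselRatio_pos (ν : ℝ) {z : ℝ} (hz : 0 < z) : 0 < besselRatio ν z :=
  div_pos (besselK_pos _ hz) (besselK_pos _ hz)

theorem besselRatio_mul (ν : ℝ) {z : ℝ} (hz : 0 < z) :
    besselRatio ν z * besselK ν z = besselK (ν + 1) z :=
  div_mul_cancel₀ _ (besselK_pos ν hz).ne'

theorem abs_le_add_one {ν : ℝ} (hν : -1 / 2 < ν) : |ν| ≤ |ν + 1| := by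
  rw [abs_of_pos (by linarith : 0 < ν + 1), abs_le]
  constructor <;> linarith

theorem one_le_besselRatio {ν z : ℝ} (hν : -1 / 2 < ν) (hz : 0 < z) : 1 ≤ besselRatio ν z :=
  (one_le_div (besselK_pos ν hz)).2 (besselK_le_of_abs_le hz (abs_le_add_one hν))

/-- The ratio increases in `ν`, and by the recurrence the next ratio is `K_ν / K_{ν+1} + 2 (ν + 1) /
z`, whose first term is at most `1`. -/
theorem besselRatio_le {ν z : ℝ} (hν : -1 / 2 < ν) (hz : 0 < z) :
    besselRatio ν z ≤ 1 + 2 * (ν + 1) / z := by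
  refine (besselK_sq_le ν hz).trans ?_
  have h1 := besselK_pos (ν + 1) hz
  have h2 := besselK_recurrence (ν + 1) hz
  have h3 := besselK_le_of_abs_le hz (abs_le_add_one hν)
  rw [add_assoc, one_add_one_eq_two, add_sub_cancel_right] at h2
  have h4 : besselK (ν + 2) z = besselK ν z + 2 * (ν + 1) / z * besselK (ν + 1) z := by
    field_simp
    linarith
  rw [div_le_iff₀ h1, h4, add_mul, one_mul]
  linarith

theorem continuousAt_besselRatio (ν : ℝ) {z : ℝ} (hz : 0 < z) : ContinuousAt (besselRatio ν) z :=
  (hasDerivAt_besselK (ν + 1) hz).continuousAt.div (hasDerivAt_besselK ν hz).continuousAt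
    (besselK_pos ν hz).ne'

end BesselFunctions

/-! ### Monotonicity and behaviour at zero of `K_{ν+1} / K_ν` -/

section BesselRatio

variable {ν : ℝ}

/-- That is, `cosh ((ν + 1) t) / cosh (ν t)` increases for `t ≥ 0`. The product-to-sum formula
reduces it to comparing arguments of `cosh`. -/
theorem cosh_mul_cosh_le (hν : -1 / 2 < ν) {s t : ℝ} (hs : 0 ≤ s) (hst : s ≤ t) :
    Real.cosh ((ν + 1) * s) * Real.cosh (ν * t) ≤ Real.cosh ((ν + 1) * t) * Real.cosh (ν * s) := by
  have key : ∀ x y : ℝ, Real.cosh x * Real.cosh y =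
      (Real.cosh (x + y) + Real.cosh (x - y)) / 2 := fun x y => by
    rw [Real.cosh_add, Real.cosh_sub]
    ring
  rw [key, key]
  have h1 : Real.cosh ((ν + 1) * s + ν * t) ≤ Real.cosh ((ν + 1) * t + ν * s) := by
    rw [Real.cosh_le_cosh]
    refine (abs_le.2 ⟨?_, ?_⟩).trans (le_abs_self _) <;> nlinarith
  have h2 : Real.cosh ((ν + 1) * s - ν * t) ≤ Real.cosh ((ν + 1) * t - ν * s) := by
    rw [Real.cosh_le_cosh]
    refine (abs_le.2 ⟨?_, ?_⟩).trans (le_abs_self _) <;> nlinarith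
  linarith

theorem exp_mul_cosh_le (ν : ℝ) {t : ℝ} (ht : 0 ≤ t) :
    Real.exp ((ν + 1 - |ν|) * t) / 2 * Real.cosh (ν * t) ≤ Real.cosh ((ν + 1) * t) := by
  have h1 : Real.cosh (ν * t) ≤ Real.exp (|ν| * t) := by
    simpa [abs_mul, abs_of_nonneg ht] using cosh_le_exp_abs (ν * t)
  have h2 : Real.exp ((ν + 1) * t) / 2 ≤ Real.cosh ((ν + 1) * t) := by
    rw [Real.cosh_eq]
    have := Real.exp_pos (-((ν + 1) * t))
    linarith
  refine (mul_le_mul_of_nonneg_left h1 (by positivity)).trans (le_trans (le_of_eq ?_) h2)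
  rw [div_mul_eq_mul_div, ← Real.exp_add]
  ring_nf

theorem exponent_gap_pos (hν : -1 / 2 < ν) : 0 < ν + 1 - |ν| := by
  rcases abs_cases ν with ⟨h, _⟩ | ⟨h, _⟩ <;> rw [h] <;> linarith

theorem exists_growth (hν : -1 / 2 < ν) (b : ℝ) :
    ∃ T : ℝ, 0 ≤ T ∧ b ≤ Real.exp ((ν + 1 - |ν|) * T) / 2 := by
  have hδ := exponent_gap_pos hν
  refine ⟨2 * |b| / (ν + 1 - |ν|), by positivity, ?_⟩
  rw [mul_div_cancel₀ _ hδ.ne']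
  have := Real.add_one_le_exp (2 * |b|)
  linarith [le_abs_self b]

theorem exists_crossing (hν : -1 / 2 < ν) {q : ℝ} (hq : 1 ≤ q) :
    ∃ t₀ : ℝ, 0 ≤ t₀ ∧ Real.cosh ((ν + 1) * t₀) = q * Real.cosh (ν * t₀) := by
  obtain ⟨T, hT, hqT⟩ := exists_growth hν q
  have hcont : ContinuousOn (fun t => Real.cosh ((ν + 1) * t) - q * Real.cosh (ν * t)) (Icc 0 T) := by
    fun_prop
  have h0 : (0 : ℝ) ∈ Icc (Real.cosh ((ν + 1) * 0) - q * Real.cosh (ν * 0))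
      (Real.cosh ((ν + 1) * T) - q * Real.cosh (ν * T)) := by
    constructor
    · simpa using hq
    · have h1 := exp_mul_cosh_le ν hT
      have h2 := mul_le_mul_of_nonneg_right hqT (Real.cosh_pos (ν * T)).le
      linarith
  obtain ⟨t₀, ht₀, h⟩ := intermediate_value_Icc hT hcont h0
  exact ⟨t₀, ht₀.1, sub_eq_zero.1 h⟩

/-- The ratio at `z` is the mean `q` of the increasing function `cosh ((ν + 1) t) / cosh (ν t)`
under the kernel at `z`. Passing to `y ≥ z` multiplies the kernel by the decreasing weight `exp (-(y
- z) cosh t)`. Since `cosh ((ν + 1) t) - q cosh (ν t)` changes sign from minus to plus at `t₀`, this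
weight may be replaced by its value there, and the remaining integral vanishes by the choice of `q`.
-/
theorem antitoneOn_besselRatio (hν : -1 / 2 < ν) : AntitoneOn (besselRatio ν) (Ioi 0) := by
  intro z hz y hy hzy
  rw [mem_Ioi] at hz hy
  set q := besselRatio ν z
  obtain ⟨t₀, ht₀, hq⟩ := exists_crossing hν (one_le_besselRatio hν hz)
  set E := Real.exp (-(y - z) * Real.cosh t₀)
  have hpt : ∀ t ∈ Ioi (0 : ℝ), besselKernel (ν + 1) y t - q * besselKernel ν y t ≤
      E * (besselKernel (ν + 1) z t - q * besselKernel ν z t) := by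
    intro t ht
    have e : Real.exp (-y * Real.cosh t) =
        Real.exp (-(y - z) * Real.cosh t) * Real.exp (-z * Real.cosh t) := by
      rw [← Real.exp_add]
      ring_nf
    unfold besselKernel
    rw [e]
    set p := Real.cosh ((ν + 1) * t) - q * Real.cosh (ν * t) with hp
    have hmain : Real.exp (-(y - z) * Real.cosh t) * p ≤ E * p := by
      have hc := Real.cosh_pos (ν * t₀)
      rcases le_total t t₀ with h | h
      · have hp0 : p ≤ 0 := by
          have h1 := cosh_mul_cosh_le hν (le_of_lt ht) h
          rw [hq] at h1
          have h2 : Real.cosh ((ν + 1) * t) * Real.cosh (ν * t₀) ≤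
              q * Real.cosh (ν * t) * Real.cosh (ν * t₀) := by linarith
          linarith [le_of_mul_le_mul_right h2 hc]
        refine mul_le_mul_of_nonpos_right (Real.exp_le_exp.2 ?_) hp0
        have h3 : Real.cosh t ≤ Real.cosh t₀ := by
          rw [Real.cosh_le_cosh, abs_of_nonneg (le_of_lt ht), abs_of_nonneg ht₀]
          exact h
        nlinarith
      · have hp0 : 0 ≤ p := by
          have h1 := cosh_mul_cosh_le hν ht₀ h
          rw [hq] at h1
          have h2 : q * Real.cosh (ν * t) * Real.cosh (ν * t₀) ≤
              Real.cosh ((ν + 1) * t) * Real.cosh (ν * t₀) := by linarith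
          linarith [le_of_mul_le_mul_right h2 hc]
        refine mul_le_mul_of_nonneg_right (Real.exp_le_exp.2 ?_) hp0
        have h3 : Real.cosh t₀ ≤ Real.cosh t := by
          rw [Real.cosh_le_cosh, abs_of_nonneg ht₀, abs_of_nonneg (le_of_lt ht)]
          exact h
        nlinarith
    have := mul_le_mul_of_nonneg_right hmain (Real.exp_pos (-z * Real.cosh t)).le
    rw [hp] at this
    linarith
  have hi1 := integrableOn_besselKernel (ν + 1) hy
  have hi2 := (integrableOn_besselKernel ν hy).const_mul q
  have hi3 := integrableOn_besselKernel (ν + 1) hz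
  have hi4 := (integrableOn_besselKernel ν hz).const_mul q
  have hint := setIntegral_mono_on (hi1.sub hi2) ((hi3.sub hi4).const_mul E) measurableSet_Ioi hpt
  simp only [Pi.sub_apply] at hint
  rw [integral_const_mul, integral_sub hi1 hi2, integral_sub hi3 hi4, integral_const_mul,
    integral_const_mul, ← besselK_eq, ← besselK_eq, ← besselK_eq, ← besselK_eq,
    besselRatio_mul ν hz, sub_self, mul_zero] at hint
  exact (div_le_iff₀ (besselK_pos ν hy)).2 (by linarith)

theorem tendsto_besselK_zero (ν : ℝ) : Tendsto (besselK ν) (𝓝[>] 0) atTop := by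
  refine tendsto_atTop.2 fun b => ?_
  -- Once `z cosh T ≤ 1`, the kernel is at least `exp (-1)` on `(0, T]`, which contributes at least
  -- `T / e = |b|`.
  set T := |b| * Real.exp 1
  have hT : 0 ≤ T := by positivity
  have hc := Real.cosh_pos T
  filter_upwards [Ioo_mem_nhdsGT (inv_pos.2 hc)] with z hz
  have hi := integrableOn_besselKernel ν hz.1
  calc b ≤ ∫ _ in Ioc 0 T, Real.exp (-1) := by
        rw [setIntegral_const, measureReal_def, Real.volume_Ioc, sub_zero, ENNReal.toReal_ofReal hT,
          smul_eq_mul, mul_assoc, ← Real.exp_add]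
        simpa using le_abs_self b
    _ ≤ ∫ t in Ioc 0 T, besselKernel ν z t := by
        refine setIntegral_mono_on (by simp) (hi.mono_set Ioc_subset_Ioi_self) measurableSet_Ioc
          fun t ht => ?_
        have h1 : Real.cosh t ≤ Real.cosh T := by
          rw [Real.cosh_le_cosh, abs_of_pos ht.1, abs_of_nonneg hT]
          exact ht.2
        have h2 : z * Real.cosh t ≤ 1 := by
          calc z * Real.cosh t ≤ (Real.cosh T)⁻¹ * Real.cosh T :=
                mul_le_mul hz.2.le h1 (Real.cosh_pos _).le (inv_pos.2 hc).le
            _ = 1 := inv_mul_cancel₀ hc.ne'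
        calc Real.exp (-1) ≤ Real.exp (-z * Real.cosh t) := Real.exp_le_exp.2 (by linarith)
          _ ≤ _ := le_mul_of_one_le_right (Real.exp_pos _).le (Real.one_le_cosh _)
    _ ≤ besselK ν z :=
        setIntegral_mono_set hi (Eventually.of_forall fun t => (besselKernel_pos ν z t).le)
          Ioc_subset_Ioi_self.eventuallyLE

theorem tendsto_besselRatio_zero (hν : -1 / 2 < ν) : Tendsto (besselRatio ν) (𝓝[>] 0) atTop := by
  refine tendsto_atTop.2 fun b => ?_
  -- Beyond `T` the kernels have ratio at least `A ≥ b + 1`. The part before `T` costs a bounded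
  -- amount, at most one multiple of `K_ν` near `z = 0`, which the extra `1` pays for.
  obtain ⟨T, hT, hA⟩ := exists_growth hν (b + 1)
  set A := Real.exp ((ν + 1 - |ν|) * T) / 2 with hAdef
  have hA0 : 0 < A := by positivity
  filter_upwards [self_mem_nhdsWithin,
    (tendsto_besselK_zero ν).eventually_ge_atTop (A * Real.cosh (ν * T) * T)] with z hz hK
  rw [mem_Ioi] at hz
  have hpt : ∀ t ∈ Ioi (0 : ℝ), A * besselKernel ν z t ≤ besselKernel (ν + 1) z t +
      (Iic T).indicator (fun _ => A * Real.cosh (ν * T)) t := by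
    intro t ht
    rw [mem_Ioi] at ht
    rcases le_total t T with h | h
    · rw [indicator_of_mem (mem_Iic.2 h)]
      have h1 : besselKernel ν z t ≤ Real.cosh (ν * T) := by
        have h2 : Real.cosh (ν * t) ≤ Real.cosh (ν * T) := by
          rw [Real.cosh_le_cosh, abs_mul, abs_mul, abs_of_pos ht, abs_of_nonneg hT]
          exact mul_le_mul_of_nonneg_left h (abs_nonneg _)
        refine (mul_le_of_le_one_left (Real.cosh_pos _).le ?_).trans h2
        rw [Real.exp_le_one_iff]
        have := mul_pos hz (Real.cosh_pos t)
        linarith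
      have := mul_le_mul_of_nonneg_left h1 hA0.le
      linarith [besselKernel_pos (ν + 1) z t]
    · refine le_add_of_le_of_nonneg ?_ (indicator_nonneg
        (fun _ _ => mul_nonneg hA0.le (Real.cosh_pos _).le) _)
      have h1 : A ≤ Real.exp ((ν + 1 - |ν|) * t) / 2 := by
        refine div_le_div_of_nonneg_right (Real.exp_le_exp.2 ?_) two_pos.le
        exact mul_le_mul_of_nonneg_left h (exponent_gap_pos hν).le
      have h2 : A * Real.cosh (ν * t) ≤ Real.cosh ((ν + 1) * t) :=
        (mul_le_mul_of_nonneg_right h1 (Real.cosh_pos _).le).trans (exp_mul_cosh_le ν ht.le)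
      have := mul_le_mul_of_nonneg_left h2 (Real.exp_pos (-z * Real.cosh t)).le
      unfold besselKernel
      linarith
  have hi := integrableOn_besselKernel ν hz
  have hi1 := integrableOn_besselKernel (ν + 1) hz
  have hi2 : IntegrableOn ((Iic T).indicator fun _ => A * Real.cosh (ν * T)) (Ioi 0) := by
    rw [IntegrableOn, integrable_indicator_iff measurableSet_Iic, IntegrableOn,
      Measure.restrict_restrict measurableSet_Iic, Iic_inter_Ioi]
    exact integrable_const _
  have hint := setIntegral_mono_on (hi.const_mul A) (hi1.add hi2) measurableSet_Ioi hpt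
  simp only [Pi.add_apply] at hint
  rw [integral_const_mul, integral_add hi1 hi2, setIntegral_indicator measurableSet_Iic,
    Ioi_inter_Iic, setIntegral_const, measureReal_def, Real.volume_Ioc, sub_zero,
    ENNReal.toReal_ofReal hT, smul_eq_mul, ← besselK_eq, ← besselK_eq] at hint
  rw [besselRatio, le_div_iff₀ (besselK_pos ν hz)]
  have := mul_le_mul_of_nonneg_right hA (besselK_pos ν hz).le
  linarith

/-- For `t ≥ 0` one has `cosh t ≤ sinh t + 1`, and `z exp (-z cosh t) sinh t` integrates exactly to
`exp (-z) ≤ 1`. -/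
theorem mul_besselK_one_le {z : ℝ} (hz : 0 < z) : z * besselK 1 z ≤ 1 + z * besselK 0 z := by
  have hd : ∀ t : ℝ, HasDerivAt (fun t : ℝ => -Real.exp (-z * Real.cosh t))
      (z * (Real.exp (-z * Real.cosh t) * Real.sinh t)) t := fun t =>
    (((Real.hasDerivAt_cosh t).const_mul (-z)).exp).fun_neg.congr_deriv (by ring)
  have hi : IntegrableOn (fun t => z * (Real.exp (-z * Real.cosh t) * Real.sinh t)) (Ioi 0) := by
    refine ((integrableOn_besselKernel 1 hz).mono'
      (Continuous.aestronglyMeasurable (by fun_prop)) ?_).const_mul z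
    refine Eventually.of_forall fun t => ?_
    rw [norm_mul, Real.norm_of_nonneg (Real.exp_pos _).le, Real.norm_eq_abs, Real.abs_sinh]
    unfold besselKernel
    rw [one_mul, ← Real.cosh_abs t]
    exact mul_le_mul_of_nonneg_left (Real.sinh_lt_cosh _).le (Real.exp_pos _).le
  have hlim : Tendsto (fun t : ℝ => -Real.exp (-z * Real.cosh t)) atTop (𝓝 0) := by
    have h1 := (tendsto_besselKernel 0 hz).neg
    simpa [besselKernel] using h1
  have h := integral_Ioi_of_hasDerivAt_of_tendsto' (a := 0) (fun t _ => hd t) hi hlim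
  have h0 := (integrableOn_besselKernel 0 hz).const_mul z
  have h1 := (integrableOn_besselKernel 1 hz).const_mul z
  have hmono := setIntegral_mono_on h1 (hi.add h0) measurableSet_Ioi fun t ht => by
    have h2 : Real.cosh t ≤ Real.sinh t + 1 := by
      have h3 := Real.cosh_sub_sinh t
      have h4 := Real.exp_le_one_iff.2 (neg_nonpos.2 (le_of_lt (mem_Ioi.1 ht)))
      linarith
    have h5 := mul_le_mul_of_nonneg_left h2 (mul_pos hz (Real.exp_pos (-z * Real.cosh t))).le
    simp only [besselKernel, Pi.add_apply, one_mul, zero_mul, Real.cosh_zero]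
    linarith
  simp only [Pi.add_apply] at hmono
  rw [integral_add hi h0, h, integral_const_mul, integral_const_mul, ← besselK_eq,
    ← besselK_eq] at hmono
  have h6 : Real.exp (-z * Real.cosh 0) ≤ 1 := by
    rw [Real.exp_le_one_iff, Real.cosh_zero]
    linarith
  linarith

/-- For these indices `z K_{ν+1} ≤ z K_1 ≤ 1 + z K_0 ≤ 1 + z K_ν`; divide by `K_ν`, which tends to
infinity. -/
theorem tendsto_mul_besselRatio_of_nonpos (hν : -1 / 2 < ν) (h0 : ν ≤ 0) :
    Tendsto (fun z => z * besselRatio ν z) (𝓝[>] 0) (𝓝 0) := by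
  have h1 : Tendsto (fun z => (besselK ν z)⁻¹ + z) (𝓝[>] 0) (𝓝 0) := by
    have h2 : Tendsto (fun z : ℝ => z) (𝓝[>] 0) (𝓝 0) := tendsto_id.mono_left nhdsWithin_le_nhds
    simpa using (tendsto_inv_atTop_zero.comp (tendsto_besselK_zero ν)).add h2
  refine tendsto_of_tendsto_of_tendsto_of_le_of_le' tendsto_const_nhds h1 ?_ ?_
  · filter_upwards [self_mem_nhdsWithin] with z hz
    exact mul_nonneg (le_of_lt hz) (besselRatio_pos ν hz).le
  · filter_upwards [self_mem_nhdsWithin] with z hz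
    rw [mem_Ioi] at hz
    have hK := besselK_pos ν hz
    have e1 : besselK (ν + 1) z ≤ besselK 1 z := besselK_le_of_abs_le hz (by
      rw [abs_of_pos (by linarith : 0 < ν + 1), abs_one]
      linarith)
    have e2 : besselK 0 z ≤ besselK ν z := besselK_le_of_abs_le hz (by simp)
    have e3 := mul_besselK_one_le hz
    have e4 := mul_le_mul_of_nonneg_left e1 hz.le
    have e5 := mul_le_mul_of_nonneg_left e2 hz.le
    rw [besselRatio, ← mul_div_assoc, div_le_iff₀ hK, add_mul, inv_mul_cancel₀ hK.ne']
    linarith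

/-- For `ν > 0` the recurrence isolates `2 ν` and leaves `z K_{ν-1} / K_ν`. For `ν ≥ 1/2` this is at
most `z`; for `ν < 1/2` evenness in the index turns it into the nonpositive case at `-ν`. -/
theorem tendsto_mul_besselRatio (hν : -1 / 2 < ν) :
    Tendsto (fun z => z * besselRatio ν z) (𝓝[>] 0) (𝓝 (2 * max ν 0)) := by
  rcases le_or_gt ν 0 with h0 | h0
  · rw [max_eq_right h0, mul_zero]
    exact tendsto_mul_besselRatio_of_nonpos hν h0
  · rw [max_eq_left h0.le]
    have hsplit : (fun z => 2 * ν + z * (besselK (ν - 1) z / besselK ν z)) =ᶠ[𝓝[>] 0]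
        fun z => z * besselRatio ν z := by
      filter_upwards [self_mem_nhdsWithin] with z hz
      have hK := besselK_pos ν hz
      have := besselK_recurrence ν hz
      rw [besselRatio, ← mul_div_assoc, ← mul_div_assoc, this]
      field_simp
      ring
    have hrest : Tendsto (fun z => z * (besselK (ν - 1) z / besselK ν z)) (𝓝[>] 0) (𝓝 0) := by
      rcases le_or_gt (1 / 2) ν with h | h
      · refine tendsto_of_tendsto_of_tendsto_of_le_of_le' tendsto_const_nhds
          (tendsto_id.mono_left nhdsWithin_le_nhds) ?_ ?_
        · filter_upwards [self_mem_nhdsWithin] with z hz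
          exact mul_nonneg (le_of_lt hz) (div_pos (besselK_pos _ hz) (besselK_pos _ hz)).le
        · filter_upwards [self_mem_nhdsWithin] with z hz
          refine mul_le_of_le_one_right (le_of_lt hz) ((div_le_one (besselK_pos ν hz)).2 ?_)
          refine besselK_le_of_abs_le hz ?_
          rw [abs_of_pos h0, abs_le]
          constructor <;> linarith
      · have h1 := tendsto_mul_besselRatio_of_nonpos (ν := -ν) (by linarith) (by linarith)
        have h2 : -ν + 1 = -(ν - 1) := by ring
        simpa only [besselRatio, h2, besselK_neg] using h1
    simpa using (hrest.const_add (2 * ν)).congr' hsplit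

end BesselRatio

/-! ### Eigenfunctions of the squared Bessel generator -/

section BesselSolutions

variable {ν c : ℝ}

/-- The decreasing solution `z^{-ν/2} K_ν(c √z)` of `2 z u'' + (2ν + 2) u' = (c² / 2) u`. -/
noncomputable def besselSolution (ν c z : ℝ) : ℝ := z ^ (-(ν / 2)) * besselK ν (c * √z)

theorem besselSolution_pos (ν : ℝ) (hc : 0 < c) {z : ℝ} (hz : 0 < z) : 0 < besselSolution ν c z :=
  mul_pos (Real.rpow_pos_of_pos hz _) (besselK_pos ν (mul_pos hc (Real.sqrt_pos.2 hz)))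

theorem rpow_neg_half_succ (ν : ℝ) {z : ℝ} (hz : 0 < z) :
    z ^ (-((ν + 1) / 2)) = z ^ (-(ν / 2)) / √z := by
  rw [Real.sqrt_eq_rpow, ← Real.rpow_sub hz]
  ring_nf

/-- The factor `z^{-ν/2}` is chosen so that the derivative stays in the family with `ν` raised by
one. Smoothness follows by induction, and the differential equation from the recurrence. -/
theorem hasDerivAt_besselSolution (ν : ℝ) (hc : 0 < c) {z : ℝ} (hz : 0 < z) :
    HasDerivAt (besselSolution ν c) (-(c / 2) * besselSolution (ν + 1) c z) z := by
  have hs := Real.sqrt_pos.2 hz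
  have h1 := (hasDerivAt_besselK' ν (mul_pos hc hs)).comp z
    ((Real.hasDerivAt_sqrt hz.ne').const_mul c)
  have h2 := Real.hasDerivAt_rpow_const (p := -(ν / 2)) (Or.inl hz.ne')
  refine (h2.mul h1).congr_deriv ?_
  have h3 : z ^ (-(ν / 2) - 1) = z ^ (-(ν / 2)) / (√z * √z) := by
    rw [Real.rpow_sub_one hz.ne', Real.mul_self_sqrt hz.le]
  simp only [besselSolution, Function.comp_apply]
  rw [rpow_neg_half_succ ν hz, h3]
  field_simp
  ring

theorem contDiffOn_besselSolution_nat (hc : 0 < c) (n : ℕ) :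
    ∀ ν : ℝ, ContDiffOn ℝ n (besselSolution ν c) (Ioi 0) := by
  induction n with
  | zero =>
    intro ν
    rw [Nat.cast_zero, contDiffOn_zero]
    exact fun z hz => (hasDerivAt_besselSolution ν hc hz).continuousAt.continuousWithinAt
  | succ n ih =>
    intro ν
    rw [Nat.cast_succ, contDiffOn_succ_iff_deriv_of_isOpen isOpen_Ioi]
    refine ⟨fun z hz =>
      (hasDerivAt_besselSolution ν hc hz).differentiableAt.differentiableWithinAt, by simp, ?_⟩
    exact ((ih (ν + 1)).const_smul (-(c / 2))).congr fun z hz =>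
      (hasDerivAt_besselSolution ν hc hz).deriv

theorem contDiffOn_besselSolution (ν : ℝ) (hc : 0 < c) :
    ContDiffOn ℝ (⊤ : ℕ∞) (besselSolution ν c) (Ioi 0) :=
  contDiffOn_infty.2 fun n => contDiffOn_besselSolution_nat hc n ν

theorem antitoneOn_besselSolution (ν : ℝ) (hc : 0 < c) :
    AntitoneOn (besselSolution ν c) (Ioi 0) := by
  refine antitoneOn_of_deriv_nonpos (convex_Ioi 0)
    (fun z hz => (hasDerivAt_besselSolution ν hc hz).continuousAt.continuousWithinAt)
    (fun z hz => ?_) fun z hz => ?_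
  · rw [interior_Ioi] at hz
    exact (hasDerivAt_besselSolution ν hc hz).differentiableAt.differentiableWithinAt
  · rw [interior_Ioi] at hz
    rw [(hasDerivAt_besselSolution ν hc hz).deriv]
    have := besselSolution_pos (ν + 1) hc hz
    nlinarith

theorem generator_besselSolution (ν : ℝ) (hc : 0 < c) {z : ℝ} (hz : 0 < z) :
    generator (fun z => 4 * z) (fun _ => 2 * ν + 2) (besselSolution ν c) z =
      c ^ 2 / 2 * besselSolution ν c z := by
  have h1 : ∀ᶠ y in 𝓝 z, deriv (besselSolution ν c) y = -(c / 2) * besselSolution (ν + 1) c y := by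
    filter_upwards [Ioi_mem_nhds hz] with y hy
    exact (hasDerivAt_besselSolution ν hc hy).deriv
  have h2 := ((hasDerivAt_besselSolution (ν + 1) hc hz).const_mul (-(c / 2))).deriv
  rw [generator, EventuallyEq.deriv_eq h1, h1.self_of_nhds, h2]
  have hs := Real.sqrt_pos.2 hz
  have hrec := besselK_recurrence (ν + 1) (mul_pos hc hs)
  rw [add_sub_cancel_right] at hrec
  have hsq : √z * √z = z := Real.mul_self_sqrt hz.le
  simp only [besselSolution]
  rw [rpow_neg_half_succ (ν + 1) hz, rpow_neg_half_succ ν hz]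
  set p := z ^ (-(ν / 2))
  set k := besselK ν (c * √z)
  set k1 := besselK (ν + 1) (c * √z)
  set k2 := besselK (ν + 1 + 1) (c * √z)
  have h3 : p / √z / √z * k2 * z = p * k2 := by
    rw [div_div, hsq]
    field_simp
  have h4 : c * k2 = c * k + 2 * (ν + 1) / √z * k1 := by
    field_simp
    linarith
  calc 1 / 2 * (4 * z) * (-(c / 2) * (-(c / 2) * (p / √z / √z * k2))) +
        (2 * ν + 2) * (-(c / 2) * (p / √z * k1))
      = c ^ 2 / 2 * (p / √z / √z * k2 * z) - c * p * (ν + 1) / √z * k1 := by ring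
    _ = c / 2 * p * (c * k2) - c * p * (ν + 1) / √z * k1 := by
        rw [h3]
        ring
    _ = _ := by
        rw [h4]
        ring

end BesselSolutions

/-! ### Bessel processes: submartingale property and decay rates -/

section BesselDiffusion

variable {Ω : Type*} [MeasurableSpace Ω] {D : RegularDiffusion Ω} {ν : ℝ}

theorem generator_sqrt_add (ν : ℝ) {e z : ℝ} (hz : 0 < z + e) :
    generator (fun z => 4 * z) (fun _ => 2 * ν + 2) (fun z => √(z + e)) z =
      ((2 * ν + 1) * z + (2 * ν + 2) * e) / (2 * (z + e) * √(z + e)) := by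
  have hd : ∀ y : ℝ, 0 < y + e → HasDerivAt (fun z => √(z + e)) (1 / (2 * √(y + e))) y :=
    fun y hy => ((hasDerivAt_id y).add_const e).sqrt hy.ne'
  have h1 : ∀ᶠ y in 𝓝 z, deriv (fun z => √(z + e)) y = 1 / (2 * √(y + e)) := by
    have : ∀ᶠ y in 𝓝 z, 0 < y + e := (continuous_id.add continuous_const).continuousAt.eventually
      (lt_mem_nhds hz)
    filter_upwards [this] with y hy
    exact (hd y hy).deriv
  have hs := Real.sqrt_pos.2 hz
  have h2 := (((hd z hz).const_mul 2).fun_inv (by positivity)).deriv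
  have h3 : deriv (fun y => 1 / (2 * √(y + e))) z =
      -(2 * (1 / (2 * √(z + e)))) / (2 * √(z + e)) ^ 2 := by
    simpa only [one_div] using h2
  rw [generator, EventuallyEq.deriv_eq h1, h1.self_of_nhds, h3]
  have hsq : √(z + e) ^ 2 = z + e := Real.sq_sqrt hz.le
  set s := √(z + e)
  rw [← hsq]
  have he : z = s ^ 2 - e := by linarith
  rw [he]
  field_simp
  ring

/-- In terms of the square the identity is `√z`, not smooth at `0`. The shift `√(z + ε²)` is smooth
there, differs by at most `ε`, and has nonnegative generator because `2 ν + 1 > 0`; no boundary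
behaviour at `0` enters. -/
theorem stoppedSubmartingale_of_bessel (hν : -1 / 2 < ν) (h : IsBesselProcess D ν) :
    StoppedSubmartingale D := by
  refine stoppedSubmartingale_of_generator_nonneg h (by fun_prop) (by fun_prop) (by fun_prop)
    fun u ε hε => ?_
  have he : 0 < ε ^ 2 := by positivity
  obtain ⟨f, hf, hfs, hfU⟩ := exists_compactSupport_eventuallyEq (U := fun z => √(z + ε ^ 2))
    (l := -ε ^ 2) (p := 0) (q := (u : ℝ) ^ 2)
    (fun z hz => ((contDiffAt_id.add contDiffAt_const).sqrt (by
      rw [mem_Ioi] at hz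
      simp only [id]
      linarith)).contDiffWithinAt) (by linarith)
  refine ⟨f, hf, hfs, fun y hy => ?_⟩
  have hmem : (y : ℝ) ^ 2 ∈ Icc (0 : ℝ) ((u : ℝ) ^ 2) :=
    ⟨sq_nonneg _, pow_le_pow_left₀ y.coe_nonneg (NNReal.coe_le_coe.2 hy) 2⟩
  have hpos : 0 < (y : ℝ) ^ 2 + ε ^ 2 := by positivity
  constructor
  · rw [(hfU _ hmem).eq_of_nhds]
    have h1 : (y : ℝ) ≤ √((y : ℝ) ^ 2 + ε ^ 2) := Real.le_sqrt_of_sq_le (by linarith)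
    have h2 : √((y : ℝ) ^ 2 + ε ^ 2) ≤ y + ε := by
      refine Real.sqrt_le_iff.2 ⟨add_nonneg y.coe_nonneg hε.le, ?_⟩
      nlinarith [mul_nonneg y.coe_nonneg hε.le]
    exact abs_le.2 ⟨by linarith, by linarith⟩
  · rw [generator_congr (hfU _ hmem), generator_sqrt_add ν hpos]
    have h3 : 0 < 2 * ν + 1 := by linarith
    have h4 : 0 < 2 * ν + 2 := by linarith
    positivity

theorem besselSolution_sq (ν c : ℝ) {y : ℝ} (hy : 0 < y) :
    besselSolution ν c (y ^ 2) = y ^ (-ν) * besselK ν (c * y) := by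
  rw [besselSolution, Real.sqrt_sq hy.le, ← Real.rpow_natCast, ← Real.rpow_mul hy.le]
  congr 2
  push_cast
  ring

theorem hitLaplace_bessel (h : IsBesselProcess D ν) {r a x : ℝ≥0} (hr : 0 < r) (ha : 0 < a)
    (hax : a < x) : hitLaplace D r a x * besselSolution ν (√(2 * r)) ((a : ℝ) ^ 2) =
      besselSolution ν (√(2 * r)) ((x : ℝ) ^ 2) := by
  have hr' : (0 : ℝ) < r := hr
  have ha' : (0 : ℝ) < a := ha
  have hc : 0 < √(2 * (r : ℝ)) := Real.sqrt_pos.2 (by positivity)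
  refine hitLaplace_mul_eq (U := besselSolution ν √(2 * r))
    (B := besselSolution ν √(2 * r) ((a : ℝ) ^ 2)) h (by fun_prop)
    (fun y hy z _ hyz => pow_le_pow_left₀ hy hyz 2) (by fun_prop) (by fun_prop)
    (contDiffOn_besselSolution ν hc) hr (fun y hy => ?_) (by positivity) hax fun y hy => ?_
  · rw [generator_besselSolution ν hc hy, Real.sq_sqrt (by positivity)]
    ring
  · have hy' : (0 : ℝ) < y := ha.trans_le hy
    rw [abs_of_pos (besselSolution_pos ν hc (by positivity))]
    exact antitoneOn_besselSolution ν hc (mem_Ioi.2 (by positivity)) (mem_Ioi.2 (by positivity))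
      (pow_le_pow_left₀ ha'.le (NNReal.coe_le_coe.2 hy) 2)

theorem besselRate_of_ne_zero (ν a : ℝ) {r : ℝ≥0} (hr : r ≠ 0) :
    besselRate ν a r = √(2 * r) * besselRatio ν (a * √(2 * r)) := by
  rw [besselRate, if_neg hr, besselRatio, mul_div_assoc]

theorem besselRate_zero (ν a : ℝ) : besselRate ν a 0 = 2 * max ν 0 / a := if_pos rfl

theorem hasDerivAt_log_besselSolution_sq (ν : ℝ) {c y : ℝ} (hc : 0 < c) (hy : 0 < y) :
    HasDerivAt (fun y => Real.log (besselSolution ν c (y ^ 2))) (-(c * besselRatio ν (y * c))) y := by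
  have hy2 : 0 < y ^ 2 := by positivity
  have h1 := HasDerivAt.comp (h := fun y => y ^ 2) y (hasDerivAt_besselSolution ν hc hy2)
    (hasDerivAt_pow 2 y)
  refine (h1.log (besselSolution_pos ν hc hy2).ne').congr_deriv ?_
  simp only [Function.comp_apply]
  have hK := besselK_pos ν (mul_pos hc hy)
  have hp := Real.rpow_pos_of_pos hy (-ν)
  rw [besselSolution_sq _ _ hy, besselSolution_sq _ _ hy, besselRatio, mul_comm y c, neg_add',
    Real.rpow_sub_one hy.ne']
  field_simp
  simp
  ring

/-- By the mean value theorem the mean decay over `(a, x)` is the rate at an intermediate point, and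
the rate decreases in the level since the Bessel ratio does. -/
theorem decay_bessel (hν : -1 / 2 < ν) (h : IsBesselProcess D ν) {r a x : ℝ≥0} (hr : 0 < r)
    (ha : 0 < a) (hax : a < x) : ((x : ℝ) - a) * besselRate ν x r ≤ -logHit D r a x ∧
      -logHit D r a x ≤ ((x : ℝ) - a) * besselRate ν a r := by
  have hr' : (0 : ℝ) < r := hr
  have ha' : (0 : ℝ) < a := ha
  have hax' : (a : ℝ) < x := hax
  set c := √(2 * (r : ℝ)) with hcdef
  have hc : 0 < c := Real.sqrt_pos.2 (by positivity)
  have hlog : logHit D r a x = Real.log (besselSolution ν c ((x : ℝ) ^ 2)) -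
      Real.log (besselSolution ν c ((a : ℝ) ^ 2)) := by
    have h1 := besselSolution_pos ν hc (pow_pos ha' 2)
    have h2 := besselSolution_pos ν hc (pow_pos (ha'.trans hax') 2)
    rw [logHit, ← Real.log_div h2.ne' h1.ne', ← hitLaplace_bessel h hr ha hax,
      mul_div_cancel_right₀ _ h1.ne']
  obtain ⟨ξ, hξ, hslope⟩ := exists_hasDerivAt_eq_slope
    (fun y => Real.log (besselSolution ν c (y ^ 2))) (fun y => -(c * besselRatio ν (y * c))) hax'
    (fun y hy => (hasDerivAt_log_besselSolution_sq ν hc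
      (ha'.trans_le hy.1)).continuousAt.continuousWithinAt)
    fun y hy => hasDerivAt_log_besselSolution_sq ν hc (ha'.trans hy.1)
  have hpos : (0 : ℝ) < x - a := sub_pos.2 hax'
  rw [eq_div_iff hpos.ne', ← hlog] at hslope
  have hξ0 : 0 < ξ := ha'.trans hξ.1
  have hx0 : (0 : ℝ) < x := ha'.trans hax'
  rw [← hslope, besselRate_of_ne_zero _ _ hr.ne', besselRate_of_ne_zero _ _ hr.ne', ← hcdef]
  have h1 : besselRatio ν (x * c) ≤ besselRatio ν (ξ * c) :=
    antitoneOn_besselRatio hν (mem_Ioi.2 (by positivity)) (mem_Ioi.2 (by positivity))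
      (mul_le_mul_of_nonneg_right hξ.2.le hc.le)
  have h2 : besselRatio ν (ξ * c) ≤ besselRatio ν (a * c) :=
    antitoneOn_besselRatio hν (mem_Ioi.2 (by positivity)) (mem_Ioi.2 (by positivity))
      (mul_le_mul_of_nonneg_right hξ.1.le hc.le)
  have h3 := mul_le_mul_of_nonneg_left h1 (mul_pos hpos hc).le
  have h4 := mul_le_mul_of_nonneg_left h2 (mul_pos hpos hc).le
  constructor <;> linarith

/-- With `z = a √(2r)` one has `a * besselRate ν a r = z * besselRatio ν z`, so the value assigned
at `r = 0` is indeed the limit. -/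
theorem tendsto_besselRate_zero (hν : -1 / 2 < ν) {a : ℝ} (ha : 0 < a) :
    Tendsto (fun n : ℕ => besselRate ν a ((n : ℝ≥0) + 1)⁻¹) atTop (𝓝 (besselRate ν a 0)) := by
  have hlim : Tendsto (fun n : ℕ => a * √(2 * (((n : ℝ≥0) + 1)⁻¹ : ℝ≥0))) atTop (𝓝[>] 0) := by
    refine tendsto_nhdsWithin_iff.2 ⟨?_, Eventually.of_forall fun n => ?_⟩
    · have h1 : Tendsto (fun n : ℕ => ((n : ℝ) + 1)⁻¹) atTop (𝓝 0) := by
        simpa only [one_div] using tendsto_one_div_add_atTop_nhds_zero_nat (𝕜 := ℝ)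
      have h2 : Continuous fun s : ℝ => a * √(2 * s) := by fun_prop
      simpa [Function.comp_def] using (h2.tendsto 0).comp h1
    · exact mul_pos ha (Real.sqrt_pos.2 (by positivity))
  have h2 := ((tendsto_mul_besselRatio hν).comp hlim).div_const a
  rw [besselRate_zero]
  refine h2.congr fun n => ?_
  rw [besselRate_of_ne_zero _ _ (by positivity), Function.comp_apply]
  field_simp

theorem hasDecayRate_bessel (hν : -1 / 2 < ν) (h : IsBesselProcess D ν) :
    HasDecayRate D fun r a => besselRate ν a r := by
  intro r a x ha hax
  rcases eq_or_ne r 0 with rfl | hr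
  · have hx : 0 < x := ha.trans hax
    have hlim : Tendsto (fun n : ℕ => ((n : ℝ≥0) + 1)⁻¹) atTop (𝓝 0) := by
      have h1 := (tendsto_inv_atTop_nhds_zero_nat (𝕜 := ℝ≥0)).comp (tendsto_add_atTop_nat 1)
      simpa [Function.comp_def] using h1
    have h1 : Tendsto (fun n : ℕ => -logHit D ((n : ℝ≥0) + 1)⁻¹ a x) atTop
        (𝓝 (-logHit D 0 a x)) :=
      ((Real.continuousAt_log (D.hitLaplace_pos 0 ha hax).ne').tendsto.comp
        (D.tendsto_hitLaplace_rate a x hlim)).neg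
    have hd := fun n : ℕ => decay_bessel hν h (r := ((n : ℝ≥0) + 1)⁻¹) (by positivity) ha hax
    exact ⟨le_of_tendsto_of_tendsto' ((tendsto_besselRate_zero hν hx).const_mul _) h1
        fun n => (hd n).1,
      le_of_tendsto_of_tendsto' h1 ((tendsto_besselRate_zero hν ha).const_mul _)
        fun n => (hd n).2⟩
  · exact decay_bessel hν h (pos_iff_ne_zero.2 hr) ha hax

end BesselDiffusion

/-! ### The smooth-fit equation for Bessel processes -/

section BesselThreshold

variable {ν : ℝ} {F : Measure ℝ≥0}

theorem measurable_besselRate (ν a : ℝ) : Measurable (besselRate ν a) := by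
  have hs : Measurable fun r : ℝ≥0 => √(2 * (r : ℝ)) := by fun_prop
  refine Measurable.ite (measurableSet_singleton 0) measurable_const ?_
  exact (hs.mul ((measurable_besselK _).comp (hs.const_mul a))).div
    ((measurable_besselK _).comp (hs.const_mul a))

theorem besselRate_nonneg (ν : ℝ) {a : ℝ} (ha : 0 < a) (r : ℝ≥0) : 0 ≤ besselRate ν a r := by
  rcases eq_or_ne r 0 with rfl | hr
  · rw [besselRate_zero]
    positivity
  · have hr' : (0 : ℝ) < r := NNReal.coe_pos.2 (pos_iff_ne_zero.2 hr)
    rw [besselRate_of_ne_zero _ _ hr]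
    exact mul_nonneg (Real.sqrt_nonneg _) (besselRatio_pos ν (by positivity)).le

theorem besselRate_le (hν : -1 / 2 < ν) {a : ℝ} (ha : 0 < a) (r : ℝ≥0) :
    besselRate ν a r ≤ √(2 * r) + 2 * (ν + 1) / a := by
  rcases eq_or_ne r 0 with rfl | hr
  · rw [besselRate_zero]
    have h1 : 2 * max ν 0 ≤ 2 * (ν + 1) := by
      have : max ν 0 ≤ ν + 1 := max_le (by linarith) (by linarith)
      linarith
    have h2 := div_le_div_of_nonneg_right h1 ha.le
    simpa using h2
  · have hr' : (0 : ℝ) < r := NNReal.coe_pos.2 (pos_iff_ne_zero.2 hr)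
    have hc : 0 < √(2 * (r : ℝ)) := Real.sqrt_pos.2 (by positivity)
    rw [besselRate_of_ne_zero _ _ hr]
    refine (mul_le_mul_of_nonneg_left (besselRatio_le hν (mul_pos ha hc)) hc.le).trans (le_of_eq ?_)
    field_simp

theorem besselRate_anti (hν : -1 / 2 < ν) {a b : ℝ} (ha : 0 < a) (hab : a ≤ b) (r : ℝ≥0) :
    besselRate ν b r ≤ besselRate ν a r := by
  rcases eq_or_ne r 0 with rfl | hr
  · rw [besselRate_zero, besselRate_zero]
    gcongr
  · have hr' : (0 : ℝ) < r := NNReal.coe_pos.2 (pos_iff_ne_zero.2 hr)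
    have hc : 0 < √(2 * (r : ℝ)) := Real.sqrt_pos.2 (by positivity)
    have hb : 0 < b := ha.trans_le hab
    rw [besselRate_of_ne_zero _ _ hr, besselRate_of_ne_zero _ _ hr]
    exact mul_le_mul_of_nonneg_left (antitoneOn_besselRatio hν (mem_Ioi.2 (by positivity))
      (mem_Ioi.2 (by positivity)) (mul_le_mul_of_nonneg_right hab hc.le)) hc.le

theorem integrable_besselRate [IsFiniteMeasure F] (hν : -1 / 2 < ν)
    (hF : Integrable (fun r : ℝ≥0 => √(2 * (r : ℝ))) F) {a : ℝ} (ha : 0 < a) :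
    Integrable (besselRate ν a) F := by
  refine (hF.add (integrable_const (2 * (ν + 1) / a))).mono'
    (measurable_besselRate ν a).aestronglyMeasurable (Eventually.of_forall fun r => ?_)
  rw [Real.norm_of_nonneg (besselRate_nonneg ν ha r)]
  exact besselRate_le hν ha r

theorem continuousAt_besselRate (ν : ℝ) {a : ℝ} (ha : 0 < a) (r : ℝ≥0) :
    ContinuousAt (fun a => besselRate ν a r) a := by
  rcases eq_or_ne r 0 with rfl | hr
  · simp only [besselRate_zero]
    exact continuousAt_const.div continuousAt_id ha.ne'
  · have hr' : (0 : ℝ) < r := NNReal.coe_pos.2 (pos_iff_ne_zero.2 hr)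
    simp only [besselRate_of_ne_zero _ _ hr]
    have h1 : ContinuousAt (besselRatio ν) (a * √(2 * r)) :=
      continuousAt_besselRatio ν (by positivity)
    exact continuousAt_const.mul
      (ContinuousAt.comp (f := fun a => a * √(2 * (r : ℝ))) h1 (by fun_prop))

theorem continuousAt_integral_besselRate [IsFiniteMeasure F] (hν : -1 / 2 < ν)
    (hF : Integrable (fun r : ℝ≥0 => √(2 * (r : ℝ))) F) {a : ℝ} (ha : 0 < a) :
    ContinuousAt (fun a => ∫ r, besselRate ν a r ∂F) a := by
  refine continuousAt_of_dominated (bound := besselRate ν (a / 2))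
    (Eventually.of_forall fun b => (measurable_besselRate ν b).aestronglyMeasurable) ?_
    (integrable_besselRate hν hF (half_pos ha))
    (Eventually.of_forall fun r => continuousAt_besselRate ν ha r)
  filter_upwards [Ioi_mem_nhds (half_lt_self ha)] with b hb
  refine Eventually.of_forall fun r => ?_
  rw [Real.norm_of_nonneg (besselRate_nonneg ν ((half_pos ha).trans hb) r)]
  exact besselRate_anti hν (half_pos ha) (le_of_lt hb) r

theorem integral_besselRate_anti [IsFiniteMeasure F] (hν : -1 / 2 < ν)
    (hF : Integrable (fun r : ℝ≥0 => √(2 * (r : ℝ))) F) {a b : ℝ} (ha : 0 < a) (hab : a ≤ b) :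
    ∫ r, besselRate ν b r ∂F ≤ ∫ r, besselRate ν a r ∂F :=
  integral_mono (integrable_besselRate hν hF (ha.trans_le hab)) (integrable_besselRate hν hF ha)
    (besselRate_anti hν ha hab)

theorem exists_measure_Icc_pos (h : 0 < F (Ioi 0)) :
    ∃ n : ℕ, 0 < F (Icc ((n : ℝ≥0) + 1)⁻¹ (n + 1)) := by
  by_contra hcon
  push Not at hcon
  refine h.ne' (measure_mono_null (fun r hr => ?_)
    (measure_iUnion_null fun n => nonpos_iff_eq_zero.1 (hcon n)))
  obtain ⟨n, hn⟩ := exists_nat_gt (max r r⁻¹)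
  refine mem_iUnion.2 ⟨n, ?_, ?_⟩
  · rw [inv_le_comm₀ (by positivity) hr]
    exact ((le_max_right _ _).trans hn.le).trans le_self_add
  · exact ((le_max_left _ _).trans hn.le).trans le_self_add

/-- Restrict to a set of rates bounded away from `0` and `∞` with positive mass. There the rate is
at least a constant times `besselRatio ν (a L)`, which blows up as `a → 0`. -/
theorem tendsto_integral_besselRate_zero [IsFiniteMeasure F] (hF0 : 0 < F (Ioi 0))
    (hν : -1 / 2 < ν) (hF : Integrable (fun r : ℝ≥0 => √(2 * (r : ℝ))) F) :
    Tendsto (fun a => ∫ r, besselRate ν a r ∂F) (𝓝[>] 0) atTop := by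
  obtain ⟨n, hn⟩ := exists_measure_Icc_pos hF0
  set A := Icc ((n : ℝ≥0) + 1)⁻¹ ((n : ℝ≥0) + 1)
  set l := √(2 * ((n : ℝ) + 1)⁻¹)
  set L := √(2 * ((n : ℝ) + 1))
  have hl : 0 < l := Real.sqrt_pos.2 (by positivity)
  have hL : 0 < L := Real.sqrt_pos.2 (by positivity)
  have hm : 0 < F.real A := ENNReal.toReal_pos hn.ne' (measure_ne_top F A)
  have hlim : Tendsto (fun a => F.real A * (l * besselRatio ν (a * L))) (𝓝[>] 0) atTop := by
    refine ((tendsto_besselRatio_zero hν).comp ?_).const_mul_atTop hl |>.const_mul_atTop hm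
    refine tendsto_nhdsWithin_iff.2 ⟨?_, ?_⟩
    · have h1 : Continuous fun a : ℝ => a * L := by fun_prop
      simpa using (h1.tendsto 0).mono_left nhdsWithin_le_nhds
    · filter_upwards [self_mem_nhdsWithin] with a ha
      exact mul_pos ha hL
  refine tendsto_atTop_mono' _ ?_ hlim
  filter_upwards [self_mem_nhdsWithin] with a ha
  rw [mem_Ioi] at ha
  have hi := integrable_besselRate hν hF ha
  calc F.real A * (l * besselRatio ν (a * L)) = ∫ _ in A, l * besselRatio ν (a * L) ∂F := by
        rw [setIntegral_const, smul_eq_mul]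
    _ ≤ ∫ r in A, besselRate ν a r ∂F := by
        refine setIntegral_mono_on (integrable_const _) hi.integrableOn measurableSet_Icc fun r hr => ?_
        have h0 : (0 : ℝ≥0) < ((n : ℝ≥0) + 1)⁻¹ := by positivity
        have hr0 : 0 < r := h0.trans_le hr.1
        have hr1 : ((n : ℝ) + 1)⁻¹ ≤ r := by exact_mod_cast NNReal.coe_le_coe.2 hr.1
        have hr2 : (r : ℝ) ≤ n + 1 := by exact_mod_cast NNReal.coe_le_coe.2 hr.2
        have e1 : l ≤ √(2 * r) := Real.sqrt_le_sqrt (by linarith)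
        have e2 : √(2 * r) ≤ L := Real.sqrt_le_sqrt (by linarith)
        have e3 : 0 < √(2 * (r : ℝ)) := hl.trans_le e1
        rw [besselRate_of_ne_zero _ _ hr0.ne']
        exact mul_le_mul e1 (antitoneOn_besselRatio hν (mem_Ioi.2 (by positivity))
          (mem_Ioi.2 (by positivity)) (mul_le_mul_of_nonneg_left e2 ha.le))
          (besselRatio_pos ν (by positivity)).le e3.le
    _ ≤ ∫ r, besselRate ν a r ∂F :=
        setIntegral_le_integral hi (Eventually.of_forall (besselRate_nonneg ν ha))

theorem exists_bessel_root [IsFiniteMeasure F] (hF0 : 0 < F (Ioi 0)) (hν : -1 / 2 < ν)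
    (hF : Integrable (fun r : ℝ≥0 => √(2 * (r : ℝ))) F) {K : ℝ} (hK : 0 < K) :
    ∃ a : ℝ, 0 < a ∧ a < K ∧ ∫ r, besselRate ν a r ∂F = 1 / (K - a) := by
  have hK2 := half_pos hK
  have hlow : ∀ᶠ a in 𝓝[>] (0 : ℝ), 2 / K ≤ ∫ r, besselRate ν a r ∂F :=
    (tendsto_integral_besselRate_zero hF0 hν hF).eventually_ge_atTop _
  obtain ⟨a, haR, ha⟩ := (hlow.and (Ioo_mem_nhdsGT hK2)).exists
  set B := ∫ r, besselRate ν (K / 2) r ∂F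
  have hB : 0 ≤ B := integral_nonneg fun r => besselRate_nonneg ν hK2 r
  -- At distance `d` from `K` the function `1 / (K - a)` is at least `B + 1`, while the integrated
  -- rate has not grown beyond its value `B` at `K / 2`.
  set d := min (K / 2) (B + 1)⁻¹
  have hd : 0 < d := lt_min hK2 (by positivity)
  have hdK : d ≤ K / 2 := min_le_left _ _
  have hab : a ≤ K - d := by linarith [ha.2]
  have hcont : ContinuousOn (fun a => 1 / (K - a) - ∫ r, besselRate ν a r ∂F) (Icc a (K - d)) := by
    intro y hy
    have hy0 : 0 < y := ha.1.trans_le hy.1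
    have hyK : K - y ≠ 0 := by
      have := hy.2
      exact (by linarith : 0 < K - y).ne'
    exact ((continuousAt_const.div (continuousAt_const.sub continuousAt_id) hyK).sub
      (continuousAt_integral_besselRate hν hF hy0)).continuousWithinAt
  have h0 : (0 : ℝ) ∈ Icc (1 / (K - a) - ∫ r, besselRate ν a r ∂F)
      (1 / (K - (K - d)) - ∫ r, besselRate ν (K - d) r ∂F) := by
    constructor
    · have h1 : 1 / (K - a) ≤ 1 / (K / 2) :=
        one_div_le_one_div_of_le hK2 (by linarith [ha.2])
      have h2 : 1 / (K / 2) = 2 / K := by field_simp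
      linarith
    · have h1 : B ≤ 1 / d := by
        rw [le_div_iff₀ hd]
        calc B * d ≤ B * (B + 1)⁻¹ := mul_le_mul_of_nonneg_left (min_le_right _ _) hB
          _ ≤ (B + 1) * (B + 1)⁻¹ := by
              refine mul_le_mul_of_nonneg_right (by linarith) (by positivity)
          _ = 1 := mul_inv_cancel₀ (by positivity)
      have h2 := integral_besselRate_anti hν hF hK2 (by linarith : K / 2 ≤ K - d)
      rw [sub_sub_cancel]
      linarith
  obtain ⟨y, hy, hy0⟩ := intermediate_value_Icc hab hcont h0
  exact ⟨y, ha.1.trans_le hy.1, by linarith [hy.2], (sub_eq_zero.1 hy0).symm⟩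

theorem bessel_root_iff [IsFiniteMeasure F] (hν : -1 / 2 < ν)
    (hF : Integrable (fun r : ℝ≥0 => √(2 * (r : ℝ))) F) {K a b : ℝ} (hb0 : 0 < b) (hbK : b < K)
    (hb : ∫ r, besselRate ν b r ∂F = 1 / (K - b)) (ha0 : 0 < a) (haK : a < K) :
    -(∫ r, besselRate ν a r ∂F) + 1 / (K - a) = 0 ↔ a = b := by
  constructor
  · intro h
    rcases lt_trichotomy a b with hlt | heq | hlt
    · have h1 := integral_besselRate_anti hν hF ha0 hlt.le
      have h2 : 1 / (K - a) < 1 / (K - b) := one_div_lt_one_div_of_lt (by linarith) (by linarith)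
      linarith
    · exact heq
    · have h1 := integral_besselRate_anti hν hF hb0 hlt.le
      have h2 : 1 / (K - b) < 1 / (K - a) := one_div_lt_one_div_of_lt (by linarith) (by linarith)
      linarith
  · rintro rfl
    linarith

/-- For `ν = 1/2` the recurrence closes up, since `K_{-1/2} = K_{1/2}`: it gives `K_{3/2} = (1 +
1/z) K_{1/2}` with no explicit formula for either function. -/
theorem besselRate_half {a : ℝ} (ha : 0 < a) (r : ℝ≥0) :
    besselRate (1 / 2) a r = √(2 * r) + 1 / a := by
  rcases eq_or_ne r 0 with rfl | hr
  · rw [besselRate_zero, max_eq_left (by norm_num)]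
    norm_num
  · have hr' : (0 : ℝ) < r := NNReal.coe_pos.2 (pos_iff_ne_zero.2 hr)
    have hc : 0 < √(2 * (r : ℝ)) := Real.sqrt_pos.2 (by positivity)
    have hz := mul_pos ha hc
    have h1 := besselK_recurrence (1 / 2) hz
    have h2 : (1 / 2 : ℝ) - 1 = -(1 / 2) := by norm_num
    rw [h2, besselK_neg] at h1
    have hK := besselK_pos (1 / 2) hz
    rw [besselRate_of_ne_zero _ _ hr, besselRatio, ← mul_div_assoc, div_eq_iff hK.ne', add_mul]
    refine mul_left_cancel₀ ha.ne' ?_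
    rw [mul_add, ← mul_assoc a (1 / a), mul_one_div_cancel ha.ne']
    linarith

variable {Ω : Type*} [MeasurableSpace Ω] {D : RegularDiffusion Ω}

theorem bessel_isOptimalThreshold [IsProbabilityMeasure F] (hF0 : 0 < F (Ioi 0)) {K : ℝ≥0}
    (hK : 0 < K) (hν : -1 / 2 < ν) (h : IsBesselProcess D ν)
    (hF : Integrable (fun r : ℝ≥0 => √(2 * (r : ℝ))) F) {aStar : ℝ≥0} (h0 : 0 < aStar)
    (haK : aStar < K) (hstar : ∫ r, besselRate ν aStar r ∂F = 1 / ((K : ℝ) - aStar)) {φ : ℝ → ℝ}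
    (hφ : CondIII φ) : IsOptimalThreshold D F φ K aStar :=
  (hasDecayRate_bessel hν h).isOptimalThreshold hφ
    ((stoppedSubmartingale_of_bessel hν h).condI hφ hF0 hK)
    (fun _ ha _ => integrable_besselRate hν hF ha) h0 haK hstar

theorem bessel_threshold [IsProbabilityMeasure F] (hF0 : 0 < F (Ioi 0)) {K : ℝ≥0} (hK : 0 < K)
    (hν : -1 / 2 < ν) (h : IsBesselProcess D ν)
    (hF : Integrable (fun r : ℝ≥0 => √(2 * (r : ℝ))) F) :
    ∃ aStar : ℝ≥0, 0 < aStar ∧ aStar < K ∧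
      (∀ a : ℝ≥0, 0 < a → a < K → (Integrable (besselRate ν a) F ∧
        (-(∫ r, besselRate ν a r ∂F) + 1 / ((K : ℝ) - a) = 0 ↔ a = aStar))) ∧
      ∀ φ : ℝ → ℝ, CondIII φ → IsOptimalThreshold D F φ K aStar := by
  obtain ⟨b, hb0, hbK, hb⟩ := exists_bessel_root hF0 hν hF (NNReal.coe_pos.2 hK)
  lift b to ℝ≥0 using hb0.le
  refine ⟨b, hb0, hbK, fun a ha haK => ⟨integrable_besselRate hν hF ha,
    (bessel_root_iff hν hF hb0 hbK hb ha haK).trans NNReal.coe_inj⟩, fun φ hφ =>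
    bessel_isOptimalThreshold hF0 hK hν h hF hb0 hbK hb hφ⟩

theorem integral_sqrt_pos (hF0 : 0 < F (Ioi 0))
    (hF : Integrable (fun r : ℝ≥0 => √(2 * (r : ℝ))) F) : 0 < ∫ r : ℝ≥0, √(2 * (r : ℝ)) ∂F := by
  refine (integral_pos_iff_support_of_nonneg (fun r => Real.sqrt_nonneg _) hF).2
    (hF0.trans_le (measure_mono fun r hr => ?_))
  have hr' : (0 : ℝ) < r := hr
  exact (Real.sqrt_pos.2 (by positivity)).ne'

/-- The smooth-fit equation becomes `M + 1/a = 1/(K - a)`, that is, `M a² + (2 - M K) a - K = 0`,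
whose positive root is the stated threshold. -/
theorem bessel_three_threshold [IsProbabilityMeasure F] (hF0 : 0 < F (Ioi 0)) {K : ℝ≥0}
    (hK : 0 < K) (h : IsBesselProcess D (1 / 2))
    (hF : Integrable (fun r : ℝ≥0 => √(2 * (r : ℝ))) F) :
    ∃ aStar : ℝ≥0, 0 < aStar ∧ aStar < K ∧
      (aStar : ℝ) = ((∫ r : ℝ≥0, √(2 * (r : ℝ)) ∂F) * K - 2 +
          √(4 + (∫ r : ℝ≥0, √(2 * (r : ℝ)) ∂F) ^ 2 * K ^ 2)) /
        (2 * ∫ r : ℝ≥0, √(2 * (r : ℝ)) ∂F) ∧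
      ∀ φ : ℝ → ℝ, CondIII φ → IsOptimalThreshold D F φ K aStar := by
  set M := ∫ r : ℝ≥0, √(2 * (r : ℝ)) ∂F with hMdef
  have hM : 0 < M := integral_sqrt_pos hF0 hF
  have hK' : (0 : ℝ) < K := hK
  have hMK : 0 < M * K := mul_pos hM hK'
  set s := √(4 + M ^ 2 * (K : ℝ) ^ 2)
  have hs : s ^ 2 = 4 + M ^ 2 * (K : ℝ) ^ 2 := Real.sq_sqrt (by positivity)
  have hs0 : 0 ≤ s := Real.sqrt_nonneg _
  -- The two bounds `2 < s < M K + 2` are what place the root strictly between `0` and `K`.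
  have hs2 : 2 < s := by nlinarith [mul_pos hMK hMK]
  have hsK : s < M * K + 2 := by nlinarith
  obtain ⟨a, ha⟩ : ∃ a : ℝ≥0, (a : ℝ) = (M * K - 2 + s) / (2 * M) :=
    ⟨_, Real.coe_toNNReal _ (div_nonneg (by linarith) (by linarith))⟩
  have ha0 : (0 : ℝ) < a := by
    rw [ha]
    exact div_pos (by linarith) (by linarith)
  have haK : (a : ℝ) < K := by
    rw [ha, div_lt_iff₀ (by linarith)]
    linarith
  refine ⟨a, ha0, haK, ha, fun φ hφ =>
    bessel_isOptimalThreshold hF0 hK (by norm_num) h hF ha0 haK ?_ hφ⟩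
  simp only [besselRate_half ha0]
  rw [integral_add hF (integrable_const _), ← hMdef, integral_const, probReal_univ, one_smul]
  have hKa : (0 : ℝ) < K - a := sub_pos.2 haK
  have hs3 : s = 2 * M * a - M * K + 2 := by
    rw [ha]
    field_simp
    ring
  rw [hs3] at hs
  have hquad : M * (a : ℝ) ^ 2 + (2 - M * K) * a - K = 0 := by
    have : 4 * M * (M * (a : ℝ) ^ 2 + (2 - M * K) * a - K) = 0 := by linear_combination hs
    exact (mul_eq_zero.1 this).resolve_left (by positivity)
  field_simp
  linarith

end BesselThreshold

end DiverseStopping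

/-! ### The general theorem and the three explicit cases -/

theorem mainTheorem2 {Ω : Type*} [MeasurableSpace Ω] (D : DiverseStopping.RegularDiffusion Ω)
    (F : Measure ℝ≥0) [IsProbabilityMeasure F] (hF : 0 < F (Ioi 0)) (K : ℝ≥0) (hK : 0 < K) :
    -- the general result
    (∀ φ : ℝ → ℝ, DiverseStopping.CondI D F φ K → DiverseStopping.CondII D K →
      DiverseStopping.CondIII φ →
      ∃ aStar ≤ K, DiverseStopping.IsOptimalThreshold D F φ K aStar) ∧
    -- geometric Brownian motion: an explicit threshold, the same for all attitude functions
    (∀ μ σ : ℝ, 0 < μ → 0 < σ → DiverseStopping.IsGeometricBrownianMotion D μ σ →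
      Integrable (DiverseStopping.gbmExponent μ σ) F →
      ∃ aStar : ℝ≥0, 0 < aStar ∧ aStar < K ∧
        (aStar : ℝ) = (∫ r, DiverseStopping.gbmExponent μ σ r ∂F) /
          (1 + ∫ r, DiverseStopping.gbmExponent μ σ r ∂F) * K ∧
        ∀ φ : ℝ → ℝ, DiverseStopping.CondIII φ →
          DiverseStopping.IsOptimalThreshold D F φ K aStar) ∧
    -- Bessel processes: the threshold is the unique root of an explicit equation
    (∀ ν : ℝ, -1 / 2 < ν → DiverseStopping.IsBesselProcess D ν →
      Integrable (fun r : ℝ≥0 => √(2 * (r : ℝ))) F →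
      ∃ aStar : ℝ≥0, 0 < aStar ∧ aStar < K ∧
        (∀ a : ℝ≥0, 0 < a → a < K →
          (Integrable (DiverseStopping.besselRate ν a) F ∧
            (-(∫ r, DiverseStopping.besselRate ν a r ∂F) + 1 / ((K : ℝ) - a) = 0 ↔
              a = aStar))) ∧
        ∀ φ : ℝ → ℝ, DiverseStopping.CondIII φ →
          DiverseStopping.IsOptimalThreshold D F φ K aStar) ∧
    -- the Bessel process of dimension three: an explicit threshold
    (DiverseStopping.IsBesselProcess D (1 / 2) →
      Integrable (fun r : ℝ≥0 => √(2 * (r : ℝ))) F →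
      ∃ aStar : ℝ≥0, 0 < aStar ∧ aStar < K ∧
        (aStar : ℝ) = ((∫ r : ℝ≥0, √(2 * (r : ℝ)) ∂F) * K - 2 +
            √(4 + (∫ r : ℝ≥0, √(2 * (r : ℝ)) ∂F) ^ 2 * K ^ 2)) /
          (2 * ∫ r : ℝ≥0, √(2 * (r : ℝ)) ∂F) ∧
        ∀ φ : ℝ → ℝ, DiverseStopping.CondIII φ →
          DiverseStopping.IsOptimalThreshold D F φ K aStar) := by
  refine ⟨fun φ hI hII hφ => ?_, fun μ σ hμ hσ h hint => ?_, fun ν hν h hint => ?_,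
    fun h hint => ?_⟩
  · obtain ⟨a, ha, hstar⟩ := DiverseStopping.exists_smoothFit_threshold hF hII.logConvex
    exact ⟨a, ha,
      DiverseStopping.isOptimalThreshold_of_smoothFit_iff hφ hI hII.logConvex ha hstar⟩
  · exact DiverseStopping.gbm_threshold hF hK hμ hσ h hint
  · exact DiverseStopping.bessel_threshold hF hK hν h hint
  · exact DiverseStopping.bessel_three_threshold hF hK h hint
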